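/- **Conventions.** A *$C^*$-precategory* $\mathcal T$ with objects $\mathbb N=\{0,1,2,\dots\}$ consists of complex Banach spaces $\mathcal T(n,m)$ (morphisms from $n$ to $m$), an associative bilinear composition $\mathcal T(n,m)\times\mathcal T(l,n)\to\mathcal T(l,m)$, $(a,b)\mapsto ab$, with $\|ab\|\le\|a\|\,\|b\|$ (identity morphisms are not required), and an antilinear involutive contravariant functor $*$ which fixes objects, satisfies $\|a^*a\|=\|a\|^2$, and is such that $a^*a$ is a positive element of the $C^*$-algebra $\mathcal T(n,n)$ for all $a\in\mathcal T(n,m)$. An *ideal* is a family of closed subspaces $\mathcal K(n,m)\subset\mathcal T(n,m)$ that is stable under composition with morphisms of $\mathcal T$ on both sides. A *right tensor $C^*$-precategory* carries in addition an endomorphism $\otimes 1:\mathcal T(n,m)\to\mathcal T(n+1,m+1)$ (linear, multiplicative, $*$-preserving). Put $J(\mathcal K)(n,m)=\{a\in\mathcal K(n,m): a\otimes1\in\mathcal K(n+1,m+1)\}$ and $(\ker\otimes1)^\perp(n,m)=\{a\in\mathcal T(n,m): ab=0\text{ for all }b\in\mathcal T(n,n)\text{ with }b\otimes1=0\}$.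 The ideal $\mathcal K$ *admits a transfer action* if there are maps $\mathcal L:\mathcal K(n+1,m+1)\to\mathcal K(n,m)$ with $\mathcal L(a)\otimes1=a$ and $\mathcal L(a(b\otimes1))=\mathcal L(a)b$ for $a\in\mathcal K(n+1,m+1)$, $b\in\mathcal K(k,n)$. A *right tensor representation* of $\mathcal K$ in a $C^*$-algebra $B$ is a family of linear maps $\pi_{nm}:\mathcal K(m,n)\to B$ with $\pi_{mn}(a^*)=\pi_{nm}(a)^*$, $\pi_{lm}(ba)=\pi_{ln}(b)\pi_{nm}(a)$ and $\pi_{nm}(a)\pi_{m+k,l}(b)=\pi_{n+k,l}((a\otimes1^k)b)$; it is *faithful* if every $\pi_{nm}$ is injective, and *coisometric* on an ideal $\mathcal J\subset J(\mathcal K)$ if $\pi_{nm}(a)=\pi_{n+1,m+1}(a\otimes1)$ for all $a\in\mathcal J(m,n)$. For an ideal $\mathcal J\subset J(\mathcal K)$ let $\mathcal O_{\mathcal T}(\mathcal K,\mathcal J)$, with universal representation $i=\{i_{(n,m)}\}$, be the universal $C^*$-algebra generated by a right tensor representation of $\mathcal K$ coisometric on $\mathcal J$; its gauge action $\gamma$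 of the circle is given by $\gamma_z(i_{(n,m)}(a))=z^{\,n-m}\,i_{(n,m)}(a)$, $a\in\mathcal K(m,n)$. A *$C^*$-correspondence* $X$ over a $C^*$-algebra $A$ is a right Hilbert $A$-module with a $*$-homomorphism $\phi$ from $A$ to the adjointable operators on $X$; $\mathcal K(X)$ is the closed span of the operators $\Theta_{x,y}z=x\langle y,z\rangle_A$, $J(X)=\phi^{-1}(\mathcal K(X))$, and $(\ker\phi)^\perp=\{a\in A: a\ker\phi=0\}$. It is a *Hilbert bimodule* if it is also a left Hilbert $A$-module with a left inner product ${}_A\langle\cdot,\cdot\rangle$ such that $x\langle y,z\rangle_A={}_A\langle x,y\rangle z$. For a closed two-sided ideal $J\subset J(X)$ of $A$, the relative Cuntz–Pimsner algebra $\mathcal O(J,X)$ is universal for representations $(\pi,t)$ of $X$ that are coisometric on $J$ (that is, $\pi_{11}(\phi(a))=\pi(a)$ for $a\in J$, where $\pi_{11}(\Theta_{x,y})=t(x)t(y)^*$); its gauge action fixes $\pi(A)$ and multiplies $t(x)$ by $z$. If $X$ is a Hilbert bimodule, the crossed product $A\rtimes_X\mathbb Z$ is universal for representations $(\pi,t)$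 of $X$ with $t(x)t(y)^*=\pi({}_A\langle x,y\rangle)$. In both cases the $k$-th spectral subspace is $\{x:\gamma_z(x)=z^kx\text{ for all }|z|=1\}$, $k\in\mathbb Z$. **Theorem.** (A) Let $\mathcal K$ and $\mathcal J$ be ideals in a right tensor $C^*$-precategory $\mathcal T$ with $\mathcal J\subset J(\mathcal K)$. The universal representation $i$ of $\mathcal K$ in $\mathcal O_{\mathcal T}(\mathcal K,\mathcal J)$ is faithful and, for every $k\in\mathbb N$, maps $\mathcal K(0,k)$ onto the $k$-th spectral subspace of $\mathcal O_{\mathcal T}(\mathcal K,\mathcal J)$ for the gauge action, if and only if $$\mathcal J=J(\mathcal K)\cap(\ker\otimes1)^\perp$$ and $\mathcal K$ admits a transfer action. (B) Let $X$ be a $C^*$-correspondence over a $C^*$-algebra $A$ and let $J\subset J(X)$ be a closed two-sided ideal of $A$. The universal representation of $X$ embeds $A$ into $\mathcal O(J,X)$ injectively and onto the $0$-th spectral subspace if and only if $X$ is a Hilbert bimodule over $A$ and $$J=(\ker\phi)^\perp\cap J(X).$$ If this is the case, then $(\ker\phi)^\perp\cap J(X)$ is the closed linear span of $\{{}_A\langle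 x,y\rangle: x,y\in X\}$, there is an isomorphism $\mathcal O(J,X)\cong A\rtimes_X\mathbb Z$ that intertwines the universal maps on $A$ and on $X$, and for each $n\ge1$ the assignment $x_1\otimes\dots\otimes x_n\mapsto t(x_1)\cdots t(x_n)$ extends to a linear isometry of $X^{\otimes n}$ onto the $n$-th spectral subspace of $\mathcal O(J,X)$. -/

import Mathlib

open scoped ENNReal

universe u

noncomputable section

/-- A set `G` of generators together with a class of admissible families of elements of C*-algebras
("families satisfying the relations"), for which the norm of each generator is bounded. -/
structure CStarRelations (G : Type u) where
  Holds : ∀ (B : Type u) [NonUnitalCStarAlgebra B], (G → B) → Prop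
  bound : G → ℝ
  norm_le : ∀ (B : Type u) [NonUnitalCStarAlgebra B] (f : G → B), Holds B f →
    ∀ g, ‖f g‖ ≤ bound g

namespace CStarRelations

variable {G : Type u}

/-- Evaluation of a (nonassociative) *-polynomial in the generators; `(g, true)` stands for `g*`. -/
def evalWord {B : Type u} [NonUnitalCStarAlgebra B] (f : G → B) :
    FreeNonUnitalNonAssocAlgebra ℂ (G × Bool) →ₙₐ[ℂ] B :=
  FreeNonUnitalNonAssocAlgebra.lift ℂ (fun p => if p.2 then star (f p.1) else f p.1)

/-- Index set for a set of C*-algebras with admissible families which realises all the C*-seminorms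
on *-polynomials that come from admissible families. -/
def Index (R : CStarRelations G) : Type u :=
  {p : FreeNonUnitalNonAssocAlgebra ℂ (G × Bool) → ℝ //
    ∃ (B : Type u) (_ : NonUnitalCStarAlgebra B) (f : G → B),
      R.Holds B f ∧ ∀ w, p w = ‖evalWord f w‖}

def Fiber (R : CStarRelations G) (p : R.Index) : Type u := p.2.choose

instance (R : CStarRelations G) (p : R.Index) : NonUnitalCStarAlgebra (R.Fiber p) :=
  p.2.choose_spec.choose

def fiberMap (R : CStarRelations G) (p : R.Index) : G → R.Fiber p :=
  p.2.choose_spec.choose_spec.choose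

theorem fiberMap_holds (R : CStarRelations G) (p : R.Index) :
    R.Holds (R.Fiber p) (R.fiberMap p) :=
  p.2.choose_spec.choose_spec.choose_spec.1

theorem norm_evalWord_fiberMap (R : CStarRelations G) (p : R.Index)
    (w : FreeNonUnitalNonAssocAlgebra ℂ (G × Bool)) :
    ‖evalWord (R.fiberMap p) w‖ = p.1 w :=
  (p.2.choose_spec.choose_spec.choose_spec.2 w).symm

/-- The `ℓ^∞`-product of the C*-algebras indexed by `Index`. -/
abbrev Product (R : CStarRelations G) : Type u := lp R.Fiber ∞

/-- The generators in the product. -/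
def gen (R : CStarRelations G) (g : G) : R.Product :=
  ⟨fun p => R.fiberMap p g, memℓp_infty ⟨R.bound g, by
    rintro _ ⟨p, rfl⟩
    exact R.norm_le _ _ (R.fiberMap_holds p) g⟩⟩

/-- The C*-algebra generated by the generators in the product. -/
def subalg (R : CStarRelations G) : NonUnitalStarSubalgebra ℂ R.Product :=
  (NonUnitalStarAlgebra.adjoin ℂ (Set.range R.gen)).topologicalClosure

/-- The universal C*-algebra generated by the generators subject to the relations; its universal
property is `exists_lift` together with `hom_ext`. -/
def Universal (R : CStarRelations G) : Type u := R.subalg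

instance (R : CStarRelations G) : NonUnitalCStarAlgebra R.Universal :=
  NonUnitalStarSubalgebra.nonUnitalCStarAlgebra R.subalg
    (h_closed := NonUnitalStarSubalgebra.isClosed_topologicalClosure _)

/-- The canonical image of a generator in the universal C*-algebra. -/
def ι (R : CStarRelations G) (g : G) : R.Universal :=
  ⟨R.gen g, NonUnitalStarSubalgebra.le_topologicalClosure _
    (NonUnitalStarAlgebra.subset_adjoin ℂ _ ⟨g, rfl⟩)⟩

def incl (R : CStarRelations G) : R.Universal →⋆ₙₐ[ℂ] R.Product where
  toFun x := x.1
  map_smul' _ _ := rfl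
  map_zero' := rfl
  map_add' _ _ := rfl
  map_mul' _ _ := rfl
  map_star' _ := rfl

def proj (R : CStarRelations G) (p : R.Index) : R.Universal →⋆ₙₐ[ℂ] R.Fiber p where
  toFun x := (R.incl x : ∀ p, R.Fiber p) p
  map_smul' _ _ := rfl
  map_zero' := rfl
  map_add' _ _ := rfl
  map_mul' _ _ := rfl
  map_star' _ := rfl

theorem proj_ι (R : CStarRelations G) (p : R.Index) (g : G) :
    R.proj p (R.ι g) = R.fiberMap p g := rfl

theorem ext_proj (R : CStarRelations G) {x y : R.Universal} (h : ∀ p, R.proj p x = R.proj p y) :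
    x = y :=
  Subtype.ext (lp.ext (funext h))

theorem evalWord_pair {B C : Type u} [NonUnitalCStarAlgebra B] [NonUnitalCStarAlgebra C]
    (f : G → B) (h : G → C) {x : B × C}
    (hx : x ∈ NonUnitalStarAlgebra.adjoin ℂ (Set.range fun g => (f g, h g))) :
    ∃ w, x = (evalWord f w, evalWord h w) := by
  change x ∈ NonUnitalAlgebra.adjoin ℂ _ at hx
  induction hx using NonUnitalAlgebra.adjoin_induction with
  | mem x hx =>
    rcases hx with ⟨g, rfl⟩ | ⟨g, hg⟩
    · exact ⟨FreeNonUnitalNonAssocAlgebra.of ℂ (g, false), by simp [evalWord]⟩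
    · refine ⟨FreeNonUnitalNonAssocAlgebra.of ℂ (g, true), ?_⟩
      rw [← star_star x, ← hg]
      simp only [evalWord, FreeNonUnitalNonAssocAlgebra.lift_of_apply, if_true]
      rfl
  | add x y _ _ hx hy =>
    obtain ⟨v, rfl⟩ := hx; obtain ⟨w, rfl⟩ := hy
    exact ⟨v + w, by simp⟩
  | zero => exact ⟨0, by simp only [map_zero]; rfl⟩
  | mul x y _ _ hx hy =>
    obtain ⟨v, rfl⟩ := hx; obtain ⟨w, rfl⟩ := hy
    exact ⟨v * w, by simp⟩
  | smul c x _ hx =>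
    obtain ⟨v, rfl⟩ := hx
    exact ⟨c • v, by simp⟩

theorem evalWord_gen (R : CStarRelations G) (p : R.Index)
    (w : FreeNonUnitalNonAssocAlgebra ℂ (G × Bool)) :
    (evalWord R.gen w : ∀ p, R.Fiber p) p = evalWord (R.fiberMap p) w := by
  let ev : R.Product →ₙₐ[ℂ] R.Fiber p :=
    { toFun := fun x => (x : ∀ p, R.Fiber p) p
      map_smul' := fun _ _ => rfl
      map_zero' := rfl
      map_add' := fun _ _ => rfl
      map_mul' := fun _ _ => rfl }
  have h : ev.comp (evalWord R.gen) = evalWord (R.fiberMap p) := by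
    apply FreeNonUnitalNonAssocAlgebra.hom_ext
    rintro ⟨g, b⟩
    cases b <;> simp [evalWord, ev] <;> rfl
  exact congrArg (fun F => F w) h

theorem norm_evalWord_le (R : CStarRelations G) {B : Type u} [NonUnitalCStarAlgebra B]
    (f : G → B) (hf : R.Holds B f) (w : FreeNonUnitalNonAssocAlgebra ℂ (G × Bool)) :
    ‖evalWord f w‖ ≤ ‖evalWord R.gen w‖ := by
  let p : R.Index := ⟨fun w => ‖evalWord f w‖, B, _, f, hf, fun _ => rfl⟩
  calc ‖evalWord f w‖ = ‖(evalWord R.gen w : ∀ p, R.Fiber p) p‖ := by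
        rw [evalWord_gen, norm_evalWord_fiberMap]
    _ ≤ ‖evalWord R.gen w‖ := lp.norm_apply_le_norm (by simp) _ _

/-- Homomorphisms on the universal C*-algebra are determined by their values on generators. -/
theorem hom_ext (R : CStarRelations G) {B : Type u} [NonUnitalCStarAlgebra B]
    (Φ Ψ : R.Universal →⋆ₙₐ[ℂ] B) (h : ∀ g, Φ (R.ι g) = Ψ (R.ι g)) : Φ = Ψ := by
  have hΦ : Continuous Φ := AddMonoidHomClass.continuous_of_bound Φ 1
    (by simpa only [one_mul] using NonUnitalStarAlgHom.norm_apply_le Φ)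
  have hΨ : Continuous Ψ := AddMonoidHomClass.continuous_of_bound Ψ 1
    (by simpa only [one_mul] using NonUnitalStarAlgHom.norm_apply_le Ψ)
  let T : NonUnitalStarSubalgebra ℂ R.Product :=
    { carrier := {x | ∃ y : R.Universal, R.incl y = x ∧ Φ y = Ψ y}
      add_mem' := by
        rintro _ _ ⟨y, rfl, hy⟩ ⟨z, rfl, hz⟩; exact ⟨y + z, map_add _ _ _, by simp [hy, hz]⟩
      zero_mem' := ⟨0, map_zero _, by simp⟩
      mul_mem' := by
        rintro _ _ ⟨y, rfl, hy⟩ ⟨z, rfl, hz⟩; exact ⟨y * z, map_mul _ _ _, by simp [hy, hz]⟩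
      smul_mem' := by rintro c _ ⟨y, rfl, hy⟩; exact ⟨c • y, map_smul _ _ _, by simp [hy]⟩
      star_mem' := by rintro _ ⟨y, rfl, hy⟩; exact ⟨star y, map_star _ _, by simp [hy, map_star]⟩ }
  have hT : IsClosed (T : Set R.Product) := by
    have : (T : Set R.Product) = R.incl '' {y | Φ y = Ψ y} := by
      ext x
      exact ⟨fun ⟨y, h1, h2⟩ => ⟨y, h2, h1⟩, fun ⟨y, h1, h2⟩ => ⟨y, h2, h1⟩⟩
    rw [this]
    have hemb : Topology.IsClosedEmbedding R.incl :=
      (NonUnitalStarSubalgebra.isClosed_topologicalClosure _).isClosedEmbedding_subtypeVal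
    exact hemb.isClosedMap _ (isClosed_eq hΦ hΨ)
  have hsub : R.subalg ≤ T := by
    refine NonUnitalStarSubalgebra.topologicalClosure_minimal _ ?_ hT
    refine NonUnitalStarAlgebra.adjoin_le ?_
    rintro _ ⟨g, rfl⟩
    exact ⟨R.ι g, rfl, h g⟩
  refine NonUnitalStarAlgHom.ext fun x => ?_
  obtain ⟨y, h1, h2⟩ := hsub x.2
  have : y = x := Subtype.ext h1
  exact this ▸ h2

/-- Each admissible family in a C*-algebra `B` is the image of the generators under a
*-homomorphism from the universal C*-algebra. -/
theorem exists_lift (R : CStarRelations G) {B : Type u} [NonUnitalCStarAlgebra B]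
    (f : G → B) (hf : R.Holds B f) :
    ∃ Φ : R.Universal →⋆ₙₐ[ℂ] B, ∀ g, Φ (R.ι g) = f g := by
  let S : NonUnitalStarSubalgebra ℂ (R.Product × B) :=
    (NonUnitalStarAlgebra.adjoin ℂ (Set.range fun g => (R.gen g, f g))).topologicalClosure
  have hSc : IsClosed (S : Set (R.Product × B)) :=
    NonUnitalStarSubalgebra.isClosed_topologicalClosure _
  have hle : ∀ x ∈ S, ‖x.2‖ ≤ ‖x.1‖ := by
    intro x hx
    have hcl : IsClosed {x : R.Product × B | ‖x.2‖ ≤ ‖x.1‖} :=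
      isClosed_le (by fun_prop) (by fun_prop)
    refine closure_minimal ?_ hcl (show x ∈ closure _ from hx)
    intro y hy
    obtain ⟨w, rfl⟩ := evalWord_pair _ _ hy
    exact R.norm_evalWord_le f hf w
  have huniq : ∀ x ∈ S, ∀ y ∈ S, x.1 = y.1 → x.2 = y.2 := by
    intro x hx y hy h
    have := hle (x - y) (sub_mem hx hy)
    simpa [h, sub_eq_zero] using this
  let T : NonUnitalStarSubalgebra ℂ R.Product :=
    { carrier := {a | ∃ b, (a, b) ∈ S}
      add_mem' := by rintro a a' ⟨b, hb⟩ ⟨b', hb'⟩; exact ⟨b + b', add_mem hb hb'⟩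
      zero_mem' := ⟨0, zero_mem S⟩
      mul_mem' := by rintro a a' ⟨b, hb⟩ ⟨b', hb'⟩; exact ⟨b * b', mul_mem hb hb'⟩
      smul_mem' := by rintro c a ⟨b, hb⟩; exact ⟨c • b, SMulMemClass.smul_mem c hb⟩
      star_mem' := by rintro a ⟨b, hb⟩; exact ⟨star b, star_mem hb⟩ }
  have hT : IsClosed (T : Set R.Product) := by
    have : (T : Set R.Product) = Set.range (fun x : S => (x : R.Product × B).1) := by
      ext a
      constructor
      · rintro ⟨b, hb⟩; exact ⟨⟨(a, b), hb⟩, rfl⟩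
      · rintro ⟨⟨⟨a', b⟩, hb⟩, rfl⟩; exact ⟨b, hb⟩
    rw [this]
    have hiso : Isometry (fun x : S => (x : R.Product × B).1) := by
      refine Isometry.of_dist_eq fun x y => ?_
      rw [Subtype.dist_eq, dist_eq_norm, dist_eq_norm]
      have := hle (x - y) (sub_mem x.2 y.2)
      rw [Prod.norm_def, max_eq_left this]
      rfl
    have : CompleteSpace S := hSc.completeSpace_coe
    exact hiso.isClosedEmbedding.isClosed_range
  have hsub : R.subalg ≤ T := by
    refine NonUnitalStarSubalgebra.topologicalClosure_minimal _ ?_ hT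
    refine NonUnitalStarAlgebra.adjoin_le ?_
    rintro _ ⟨g, rfl⟩
    exact ⟨f g, NonUnitalStarSubalgebra.le_topologicalClosure _
      (NonUnitalStarAlgebra.subset_adjoin ℂ _ ⟨g, rfl⟩)⟩
  choose F hF using fun x : R.subalg => hsub x.2
  refine ⟨{ toFun := F
            map_smul' := fun c x => ?_
            map_zero' := ?_
            map_add' := fun x y => ?_
            map_mul' := fun x y => ?_
            map_star' := fun x => ?_ }, fun g => ?_⟩
  · exact huniq _ (hF (c • x : R.subalg)) _ (SMulMemClass.smul_mem c (hF x)) rfl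
  · exact huniq _ (hF 0) _ (zero_mem S) rfl
  · exact huniq _ (hF (x + y : R.subalg)) _ (add_mem (hF x) (hF y)) rfl
  · exact huniq _ (hF (x * y : R.subalg)) _ (mul_mem (hF x) (hF y)) rfl
  · exact huniq _ (hF (star x : R.subalg)) _ (star_mem (hF x)) rfl
  · exact huniq _ (hF _) (R.gen g, f g) (NonUnitalStarSubalgebra.le_topologicalClosure _
      (NonUnitalStarAlgebra.subset_adjoin ℂ _ ⟨g, rfl⟩)) rfl

end CStarRelations


/-- A C*-precategory whose objects are the natural numbers: a category without the requirement of
identity morphisms, with Banach spaces `Hom n m` of morphisms from `n` to `m`, contractive bilinear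
composition (`comp a b` is `a` after `b`), an antilinear involutive contravariant functor `adj`
satisfying `‖a* a‖ = ‖a‖ ^ 2`, and such that `a* a` is positive in the C*-algebra `Hom n n`,
that is of the form `b* b` with `b` in `Hom n n`. -/
structure CStarPrecategory where
  Hom : ℕ → ℕ → Type u
  [normed : ∀ n m, NormedAddCommGroup (Hom n m)]
  [space : ∀ n m, NormedSpace ℂ (Hom n m)]
  [complete : ∀ n m, CompleteSpace (Hom n m)]
  comp : ∀ {l n m : ℕ}, Hom n m →ₗ[ℂ] Hom l n →ₗ[ℂ] Hom l m
  comp_assoc : ∀ {k l n m : ℕ} (a : Hom n m) (b : Hom l n) (c : Hom k l),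
    comp (comp a b) c = comp a (comp b c)
  norm_comp_le : ∀ {l n m : ℕ} (a : Hom n m) (b : Hom l n), ‖comp a b‖ ≤ ‖a‖ * ‖b‖
  adj : ∀ {n m : ℕ}, Hom n m →ₗ⋆[ℂ] Hom m n
  adj_adj : ∀ {n m : ℕ} (a : Hom n m), adj (adj a) = a
  adj_comp : ∀ {l n m : ℕ} (a : Hom n m) (b : Hom l n), adj (comp a b) = comp (adj b) (adj a)
  norm_adj_comp_self : ∀ {n m : ℕ} (a : Hom n m), ‖comp (adj a) a‖ = ‖a‖ ^ 2
  adj_comp_self_pos : ∀ {n m : ℕ} (a : Hom n m), ∃ b : Hom n n, comp (adj a) a = comp (adj b) b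

attribute [instance] CStarPrecategory.normed CStarPrecategory.space CStarPrecategory.complete

/-- A closed two-sided ideal in a C*-precategory. (That ideals are self-adjoint is automatic.) -/
structure CStarPrecategory.Ideal (T : CStarPrecategory.{u}) where
  space : ∀ n m : ℕ, Submodule ℂ (T.Hom n m)
  isClosed : ∀ n m, IsClosed (space n m : Set (T.Hom n m))
  comp_mem_left : ∀ {l n m : ℕ} (a : T.Hom n m) {b : T.Hom l n}, b ∈ space l n →
    T.comp a b ∈ space l m
  comp_mem_right : ∀ {l n m : ℕ} {a : T.Hom n m} (b : T.Hom l n), a ∈ space n m →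
    T.comp a b ∈ space l m
  adj_mem : ∀ {n m : ℕ} {a : T.Hom n m}, a ∈ space n m → T.adj a ∈ space m n

/-- A right tensor C*-precategory: a C*-precategory with an endomorphism `⊗ 1` taking the object
`n` to `n + 1`. -/
structure RightTensorCStarPrecategory extends CStarPrecategory.{u} where
  tensor : ∀ {n m : ℕ}, Hom n m →ₗ[ℂ] Hom (n + 1) (m + 1)
  tensor_comp : ∀ {l n m : ℕ} (a : Hom n m) (b : Hom l n),
    tensor (comp a b) = comp (tensor a) (tensor b)
  tensor_adj : ∀ {n m : ℕ} (a : Hom n m), tensor (adj a) = adj (tensor a)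

namespace RightTensorCStarPrecategory

/-- Closed two-sided ideals of the underlying C*-precategory. -/
abbrev Ideal (T : RightTensorCStarPrecategory.{u}) := T.toCStarPrecategory.Ideal

variable {T : RightTensorCStarPrecategory.{u}}

/-- The iterate `⊗ 1^k` of the right tensoring. -/
def tensorPow : ∀ (k : ℕ) {n m : ℕ}, T.Hom n m →ₗ[ℂ] T.Hom (n + k) (m + k)
  | 0, _, _ => LinearMap.id
  | k + 1, _, _ => T.tensor ∘ₗ tensorPow k

/-- The kernel of the right tensoring. -/
def tensorKer (n m : ℕ) : Submodule ℂ (T.Hom n m) := LinearMap.ker T.tensor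

/-- The annihilator of an ideal `I`, formed by those `a` from `n` to `m` for which
`a I(n, n) = 0`. On the diagonal this is the usual annihilator in a C*-algebra. -/
def annihilator (I : ∀ n m : ℕ, Submodule ℂ (T.Hom n m)) (n m : ℕ) :
    Submodule ℂ (T.Hom n m) where
  carrier := {a | ∀ b ∈ I n n, T.comp a b = 0}
  add_mem' := fun ha hb c hc => by simp [ha c hc, hb c hc]
  zero_mem' := fun c _ => by simp
  smul_mem' := fun z a ha c hc => by simp [ha c hc]

/-- The ideal `J(K) = (⊗ 1)⁻¹(K) ∩ K`. -/
def idealJ (K : T.Ideal) (n m : ℕ) : Submodule ℂ (T.Hom n m) :=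
  K.space n m ⊓ (K.space (n + 1) (m + 1)).comap T.tensor

/-- A transfer action on `K`: maps `L : K(n + 1, m + 1) → K(n, m)` with `L(a) ⊗ 1 = a` and
`L(a (b ⊗ 1)) = L(a) b`. -/
structure TransferAction (K : T.Ideal) where
  toFun : ∀ {n m : ℕ}, K.space (n + 1) (m + 1) → K.space n m
  tensor_toFun : ∀ {n m : ℕ} (a : K.space (n + 1) (m + 1)),
    T.tensor (toFun a : T.Hom n m) = a
  toFun_comp_tensor : ∀ {k n m : ℕ} (a : K.space (n + 1) (m + 1)) (b : K.space k n),
    (toFun ⟨T.comp (a : T.Hom (n + 1) (m + 1)) (T.tensor (b : T.Hom k n)),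
      K.comp_mem_right _ a.2⟩ : T.Hom k m) = T.comp (toFun a : T.Hom n m) (b : T.Hom k n)

/-- The ideal `K` admits a transfer action. -/
def AdmitsTransferAction (K : T.Ideal) : Prop := Nonempty (TransferAction K)

/-- A right tensor representation of the ideal `K` in a C*-algebra `B`: linear maps
`π_{n m} : K(m, n) → B` compatible with adjoints and composition such that
`π_{n m}(a) π_{m + k, l}(b) = π_{n + k, l}((a ⊗ 1^k) b)`. -/
structure Representation (K : T.Ideal) (B : Type u) [NonUnitalCStarAlgebra B] where
  toFun : ∀ n m : ℕ, K.space m n →ₗ[ℂ] B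
  map_adj : ∀ (n m : ℕ) (a : K.space m n), toFun m n ⟨T.adj (a : T.Hom m n), K.adj_mem a.2⟩ =
    star (toFun n m a)
  map_comp : ∀ (l n m : ℕ) (b : K.space n l) (a : K.space m n),
    toFun l m ⟨T.comp (b : T.Hom n l) (a : T.Hom m n), K.comp_mem_left _ a.2⟩ =
      toFun l n b * toFun n m a
  map_tensor : ∀ (n m k l : ℕ) (a : K.space m n) (b : K.space l (m + k)),
    toFun n m a * toFun (m + k) l b =
      toFun (n + k) l ⟨T.comp (T.tensorPow k (a : T.Hom m n)) (b : T.Hom l (m + k)),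
        K.comp_mem_left _ b.2⟩

/-- The representation is coisometric on the ideal `J`: `π(a) = π(a ⊗ 1)` for all `a` in `J`.
The membership conditions hold automatically when `J` is contained in `J(K)`. -/
def Representation.IsCoisometricOn {K : T.Ideal} {B : Type u} [NonUnitalCStarAlgebra B]
    (π : Representation K B) (J : T.Ideal) : Prop :=
  ∀ (n m : ℕ) (a : T.Hom m n), a ∈ J.space m n → ∀ (ha : a ∈ K.space m n)
    (ha' : T.tensor a ∈ K.space (m + 1) (n + 1)),
    π.toFun n m ⟨a, ha⟩ = π.toFun (n + 1) (m + 1) ⟨T.tensor a, ha'⟩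

/-- The representation is faithful: each of the maps `π_{n m}` is injective. -/
def Representation.IsFaithful {K : T.Ideal} {B : Type u} [NonUnitalCStarAlgebra B]
    (π : Representation K B) : Prop :=
  ∀ n m, Function.Injective (π.toFun n m)

/-- The C*-algebra `K(n, n)`. -/
def Diag (K : T.Ideal) (n : ℕ) : Type u := K.space n n

section Diag
variable (K : T.Ideal) (n : ℕ)

instance : NormedAddCommGroup (Diag K n) := inferInstanceAs (NormedAddCommGroup (K.space n n))
instance : NormedSpace ℂ (Diag K n) := inferInstanceAs (NormedSpace ℂ (K.space n n))
instance : CompleteSpace (Diag K n) := (K.isClosed n n).completeSpace_coe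

instance : Mul (Diag K n) :=
  ⟨fun a b => ⟨T.comp a.1 b.1, K.comp_mem_left _ b.2⟩⟩

instance : Star (Diag K n) := ⟨fun a => ⟨T.adj a.1, K.adj_mem a.2⟩⟩

theorem Diag.ext {a b : Diag K n} (h : a.1 = b.1) : a = b := Subtype.ext h

instance : NonUnitalNormedRing (Diag K n) :=
  { (inferInstance : NormedAddCommGroup (Diag K n)), (inferInstance : Mul (Diag K n)) with
    left_distrib := fun a b c => Diag.ext K n (map_add (T.comp a.1) b.1 c.1)
    right_distrib := fun a b c => Diag.ext K n (LinearMap.map_add₂ T.comp a.1 b.1 c.1)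
    zero_mul := fun a => Diag.ext K n (LinearMap.map_zero₂ T.comp a.1)
    mul_zero := fun a => Diag.ext K n (map_zero (T.comp a.1))
    mul_assoc := fun a b c => Diag.ext K n (T.comp_assoc a.1 b.1 c.1)
    norm_mul_le := fun a b => T.norm_comp_le a.1 b.1 }

instance : NonUnitalCStarAlgebra (Diag K n) :=
  { (inferInstance : NonUnitalNormedRing (Diag K n)),
    (inferInstance : NormedSpace ℂ (Diag K n)), (inferInstance : CompleteSpace (Diag K n)),
    (inferInstance : Star (Diag K n)) with
    star_involutive := fun a => Diag.ext K n (T.adj_adj a.1)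
    star_mul := fun a b => Diag.ext K n (T.adj_comp a.1 b.1)
    star_add := fun a b => Diag.ext K n (map_add T.adj a.1 b.1)
    norm_mul_self_le := fun a => by
      rw [← sq]
      exact (T.norm_adj_comp_self a.1).ge
    smul_assoc := fun c a b => Diag.ext K n (LinearMap.map_smul₂ T.comp c a.1 b.1)
    smul_comm := fun c a b => Diag.ext K n (map_smul (T.comp a.1) c b.1).symm
    star_smul := fun c a => Diag.ext K n (map_smulₛₗ T.adj c a.1) }

end Diag

theorem Representation.norm_le {K : T.Ideal} {B : Type u} [NonUnitalCStarAlgebra B]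
    (π : Representation K B) (n m : ℕ) (a : K.space m n) : ‖π.toFun n m a‖ ≤ ‖a‖ := by
  let ρ : Diag K m →⋆ₙₐ[ℂ] B :=
    { toFun := π.toFun m m
      map_smul' := fun c x => map_smul (π.toFun m m) c x
      map_zero' := map_zero (π.toFun m m)
      map_add' := fun x y => map_add (π.toFun m m) x y
      map_mul' := fun x y => π.map_comp m m m x y
      map_star' := fun x => π.map_adj m m x }
  let c : Diag K m := ⟨T.comp (T.adj (a : T.Hom m n)) a, K.comp_mem_left _ a.2⟩
  have h1 : ρ c = star (π.toFun n m a) * π.toFun n m a := by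
    rw [← π.map_adj, ← π.map_comp]
    rfl
  have h2 : ‖c‖ = ‖a‖ ^ 2 := T.norm_adj_comp_self (a : T.Hom m n)
  have h3 : ‖π.toFun n m a‖ ^ 2 ≤ ‖a‖ ^ 2 := by
    rw [← h2, sq, ← CStarRing.norm_star_mul_self, ← h1]
    exact NonUnitalStarAlgHom.norm_apply_le ρ c
  exact le_of_sq_le_sq h3 (norm_nonneg _)

/-- Generators and relations of the C*-algebra of `K` relative to `J`: the generators are the elements
of all the spaces `K(m, n)`, and the admissible families are the right tensor representations
of `K` coisometric on `J`. -/
def relations (K J : T.Ideal) : CStarRelations (Σ p : ℕ × ℕ, K.space p.2 p.1) where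
  Holds B _ f := ∃ π : Representation K B, π.IsCoisometricOn J ∧ ∀ g, f g = π.toFun g.1.1 g.1.2 g.2
  bound g := ‖g.2‖
  norm_le := by
    rintro B _ f ⟨π, _, h⟩ g
    rw [h g]
    exact π.norm_le _ _ _

/-- The C*-algebra `O_T(K, J)`, universal for right tensor representations of `K` that are
coisometric on `J`. -/
abbrev universalAlgebra (K J : T.Ideal) : Type u := (relations K J).Universal

/-- The representation of `K` that gives the admissible family with index `p`. -/
def fiberRep (K J : T.Ideal) (p : (relations K J).Index) :
    Representation K ((relations K J).Fiber p) :=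
  ((relations K J).fiberMap_holds p).choose

theorem fiberRep_coisometric (K J : T.Ideal) (p : (relations K J).Index) :
    (fiberRep K J p).IsCoisometricOn J :=
  ((relations K J).fiberMap_holds p).choose_spec.1

theorem proj_ι (K J : T.Ideal) (p : (relations K J).Index) (n m : ℕ) (a : K.space m n) :
    (relations K J).proj p ((relations K J).ι ⟨(n, m), a⟩) = (fiberRep K J p).toFun n m a :=
  ((relations K J).fiberMap_holds p).choose_spec.2 ⟨(n, m), a⟩

def universalMap (K J : T.Ideal) (n m : ℕ) : K.space m n →ₗ[ℂ] universalAlgebra K J where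
  toFun := fun a => (relations K J).ι ⟨(n, m), a⟩
  map_add' := fun a b => (relations K J).ext_proj fun p => by
    rw [map_add, proj_ι, proj_ι, proj_ι, map_add]
  map_smul' := fun c a => (relations K J).ext_proj fun p => by
    rw [map_smul, proj_ι, proj_ι, map_smul, RingHom.id_apply]

theorem proj_universalMap (K J : T.Ideal) (p : (relations K J).Index) (n m : ℕ)
    (a : K.space m n) :
    (relations K J).proj p (universalMap K J n m a) = (fiberRep K J p).toFun n m a :=
  proj_ι K J p n m a

/-- The universal representation of `K` in `O_T(K, J)`. -/
def universalRep (K J : T.Ideal) : Representation K (universalAlgebra K J) where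
  toFun := universalMap K J
  map_adj n m a := (relations K J).ext_proj fun p => by
    rw [map_star, proj_universalMap, proj_universalMap, Representation.map_adj]
  map_comp l n m b a := (relations K J).ext_proj fun p => by
    rw [map_mul, proj_universalMap, proj_universalMap, proj_universalMap, Representation.map_comp]
  map_tensor n m k l a b := (relations K J).ext_proj fun p => by
    rw [map_mul, proj_universalMap, proj_universalMap, proj_universalMap,
      Representation.map_tensor]

end RightTensorCStarPrecategory


namespace RightTensorCStarPrecategory
variable {T : RightTensorCStarPrecategory.{u}}

theorem universalRep_coisometric (K J : T.Ideal) : (universalRep K J).IsCoisometricOn J :=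
  fun n m a ha hK hK' => (relations K J).ext_proj fun p => by
    exact ((proj_universalMap K J p n m ⟨a, hK⟩).trans
      (fiberRep_coisometric K J p n m a ha hK hK')).trans
      (proj_universalMap K J p (n + 1) (m + 1) ⟨T.tensor a, hK'⟩).symm

/-- Every right tensor representation coisometric on `J` integrates to a representation of
`O_T(K, J)`. -/
theorem exists_lift {K J : T.Ideal} {B : Type u} [NonUnitalCStarAlgebra B]
    (π : Representation K B) (hπ : π.IsCoisometricOn J) :
    ∃ Φ : universalAlgebra K J →⋆ₙₐ[ℂ] B,
      ∀ n m a, Φ ((universalRep K J).toFun n m a) = π.toFun n m a := by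
  obtain ⟨Φ, hΦ⟩ := (relations K J).exists_lift (fun g => π.toFun g.1.1 g.1.2 g.2) ⟨π, hπ, fun _ => rfl⟩
  exact ⟨Φ, fun n m a => hΦ ⟨(n, m), a⟩⟩

/-- The representation `π` twisted by the character `z`: `π_{n m}` is multiplied by `z ^ (n - m)`. -/
def Representation.rotate {K : T.Ideal} {B : Type u} [NonUnitalCStarAlgebra B]
    (π : Representation K B) (z : Circle) : Representation K B where
  toFun n m := ((z : ℂ) ^ ((n : ℤ) - m)) • π.toFun n m
  map_adj n m a := by
    simp only [LinearMap.smul_apply, π.map_adj, star_smul, star_zpow₀]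
    congr 1
    have h : star (z : ℂ) = (z : ℂ)⁻¹ := by
      rw [← Circle.coe_inv, Circle.coe_inv_eq_conj]; rfl
    rw [h, inv_zpow', neg_sub]
  map_comp l n m b a := by
    simp only [LinearMap.smul_apply, π.map_comp, smul_mul_smul_comm]
    rw [← zpow_add₀ z.coe_ne_zero, sub_add_sub_cancel]
  map_tensor n m k l a b := by
    simp only [LinearMap.smul_apply, smul_mul_smul_comm, π.map_tensor]
    rw [← zpow_add₀ z.coe_ne_zero]
    congr 2
    push_cast
    ring

theorem Representation.rotate_coisometric {K J : T.Ideal} {B : Type u} [NonUnitalCStarAlgebra B]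
    {π : Representation K B} (hπ : π.IsCoisometricOn J) (z : Circle) :
    (π.rotate z).IsCoisometricOn J := fun n m a ha hK hK' => by
  simp only [rotate, LinearMap.smul_apply, hπ n m a ha hK hK']
  congr 2
  push_cast
  ring

/-- The gauge action on `O_T(K, J)`, determined by `γ_z(i_{n m}(a)) = z ^ (n - m) i_{n m}(a)` for
`a` in `K(m, n)`. -/
def gauge (K J : T.Ideal) (z : Circle) : universalAlgebra K J →⋆ₙₐ[ℂ] universalAlgebra K J :=
  (exists_lift _ (Representation.rotate_coisometric (universalRep_coisometric K J) z)).choose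

theorem gauge_universalRep (K J : T.Ideal) (z : Circle) (n m : ℕ) (a : K.space m n) :
    gauge K J z ((universalRep K J).toFun n m a) =
      (z : ℂ) ^ ((n : ℤ) - m) • (universalRep K J).toFun n m a :=
  (exists_lift _ (Representation.rotate_coisometric (universalRep_coisometric K J) z)).choose_spec n m a

/-- The `k`-th spectral subspace `{x | γ_z(x) = z ^ k x for all z}` of the gauge action. -/
def spectralSubspace (K J : T.Ideal) (k : ℤ) : Submodule ℂ (universalAlgebra K J) where
  carrier := {x | ∀ z : Circle, gauge K J z x = (z : ℂ) ^ k • x}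
  add_mem' := fun hx hy z => by rw [map_add, hx z, hy z, smul_add]
  zero_mem' := fun z => by rw [map_zero, smul_zero]
  smul_mem' := fun c x hx z => by rw [map_smul, hx z, smul_comm]

end RightTensorCStarPrecategory

/-- The triangle inequality for the seminorm of a positive algebra valued sesquilinear form. -/
theorem sqrt_norm_form_add_le {V : Type*} [AddCommGroup V] [Module ℂ V] {A : Type*}
    [NonUnitalCStarAlgebra A] [PartialOrder A] [StarOrderedRing A] (Q : V →ₗ⋆[ℂ] V →ₗ[ℂ] A)
    (hpos : ∀ v, 0 ≤ Q v v) (v w : V) :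
    √‖Q (v + w) (v + w)‖ ≤ √‖Q v v‖ + √‖Q w w‖ := by
  have key : ∀ r s : ℝ, r * s = 1 →
      ‖Q (v + w) (v + w)‖ ≤ (1 + r ^ 2) * ‖Q v v‖ + (1 + s ^ 2) * ‖Q w w‖ := by
    intro r s hrs
    have h1 := hpos ((r : ℂ) • v - (s : ℂ) • w)
    have hrs' : (r : ℂ) * s = 1 := by exact_mod_cast hrs
    have hsr' : (s : ℂ) * r = 1 := by rw [mul_comm, hrs']
    have h2 : Q (v + w) (v + w) + Q ((r : ℂ) • v - (s : ℂ) • w) ((r : ℂ) • v - (s : ℂ) • w)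
        = ((1 + r ^ 2 : ℝ) : ℂ) • Q v v + ((1 + s ^ 2 : ℝ) : ℂ) • Q w w := by
      simp only [map_add, map_sub, LinearMap.add_apply, LinearMap.sub_apply, map_smul,
        LinearMap.map_smulₛₗ, LinearMap.smul_apply, Complex.conj_ofReal, smul_smul, smul_sub,
        hrs', hsr']
      push_cast
      module
    have h3 : Q (v + w) (v + w) ≤
        ((1 + r ^ 2 : ℝ) : ℂ) • Q v v + ((1 + s ^ 2 : ℝ) : ℂ) • Q w w := by
      rw [← h2]; exact le_add_of_nonneg_right h1
    refine (CStarAlgebra.norm_le_norm_of_nonneg_of_le (hpos _) h3).trans ?_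
    refine (norm_add_le _ _).trans ?_
    rw [norm_smul, norm_smul, Complex.norm_real, Complex.norm_real, Real.norm_of_nonneg (by positivity),
      Real.norm_of_nonneg (by positivity)]
  set a := √‖Q v v‖ with ha
  set b := √‖Q w w‖ with hb
  have ha2 : ‖Q v v‖ = a ^ 2 := (Real.sq_sqrt (norm_nonneg _)).symm
  have hb2 : ‖Q w w‖ = b ^ 2 := (Real.sq_sqrt (norm_nonneg _)).symm
  have ha0 : 0 ≤ a := Real.sqrt_nonneg _
  have hb0 : 0 ≤ b := Real.sqrt_nonneg _
  refine le_of_forall_pos_le_add fun ε hε => ?_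
  refine Real.sqrt_le_iff.2 ⟨by positivity, ?_⟩
  have hx : 0 < a + ε / 2 := by positivity
  have hy : 0 < b + ε / 2 := by positivity
  have h := key √((b + ε / 2) / (a + ε / 2)) √((a + ε / 2) / (b + ε / 2)) (by
    rw [← Real.sqrt_mul (by positivity), div_mul_div_comm, mul_comm (b + ε / 2),
      div_self (by positivity), Real.sqrt_one])
  rw [Real.sq_sqrt (by positivity), Real.sq_sqrt (by positivity), ha2, hb2] at h
  refine h.trans ?_
  calc (1 + (b + ε / 2) / (a + ε / 2)) * a ^ 2 + (1 + (a + ε / 2) / (b + ε / 2)) * b ^ 2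
      ≤ (1 + (b + ε / 2) / (a + ε / 2)) * (a + ε / 2) ^ 2
        + (1 + (a + ε / 2) / (b + ε / 2)) * (b + ε / 2) ^ 2 := by gcongr <;> linarith
    _ = (a + b + ε) ^ 2 := by field_simp; ring


/-- A C*-correspondence over `A`: a right Hilbert `A`-module `X` (with right action `ract` and inner
product `inner` conjugate linear in the first variable) and a left action `φ` of `A` by adjointable
operators which is a *-homomorphism, that is `⟨φ(a) x, y⟩ = ⟨x, φ(a*) y⟩`. -/
structure CStarCorrespondence (A : Type u) [NonUnitalCStarAlgebra A] where
  X : Type u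
  [normed : NormedAddCommGroup X]
  [space : NormedSpace ℂ X]
  [complete : CompleteSpace X]
  ract : X →ₗ[ℂ] A →ₗ[ℂ] X
  inner : X →ₗ⋆[ℂ] X →ₗ[ℂ] A
  ract_mul : ∀ x a b, ract x (a * b) = ract (ract x a) b
  inner_ract : ∀ x y a, inner x (ract y a) = inner x y * a
  star_inner : ∀ x y, star (inner x y) = inner y x
  inner_self_pos : ∀ x, ∃ b, inner x x = star b * b
  norm_sq : ∀ x, ‖x‖ ^ 2 = ‖inner x x‖
  φ : A →ₙₐ[ℂ] (X →L[ℂ] X)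
  inner_φ : ∀ a x y, inner (φ a x) y = inner x (φ (star a) y)

attribute [instance] CStarCorrespondence.normed CStarCorrespondence.space
  CStarCorrespondence.complete

namespace CStarCorrespondence

variable {A : Type u} [NonUnitalCStarAlgebra A] (E : CStarCorrespondence A)

theorem inner_ract_left (x y : E.X) (a : A) :
    E.inner (E.ract x a) y = star a * E.inner x y := by
  rw [← E.star_inner, E.inner_ract, star_mul, E.star_inner]

theorem norm_inner_le (x y : E.X) : ‖E.inner x y‖ ≤ ‖x‖ * ‖y‖ := by
  let _ : PartialOrder Aᵐᵒᵖ := CStarAlgebra.spectralOrder Aᵐᵒᵖ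
  have _ : StarOrderedRing Aᵐᵒᵖ := CStarAlgebra.spectralOrderedRing Aᵐᵒᵖ
  let _ : SMul Aᵐᵒᵖ E.X := ⟨fun a x => E.ract x a.unop⟩
  let _ : CStarModule Aᵐᵒᵖ E.X :=
    { inner := fun x y => MulOpposite.op (E.inner x y)
      inner_add_right := fun {x y z} => by simp
      inner_self_nonneg := fun {x} => by
        obtain ⟨b, hb⟩ := E.inner_self_pos x
        have : MulOpposite.op (E.inner x x) =
            star (MulOpposite.op (star b)) * MulOpposite.op (star b) := by
          rw [hb, ← MulOpposite.op_star, star_star, ← MulOpposite.op_mul]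
        rw [this]
        exact star_mul_self_nonneg _
      inner_self := fun {x} => by
        rw [MulOpposite.op_eq_zero_iff]
        constructor
        · intro h
          have := E.norm_sq x
          rw [h, norm_zero] at this
          exact norm_eq_zero.1 (pow_eq_zero_iff (two_ne_zero)|>.1 this)
        · rintro rfl; simp
      inner_op_smul_right := fun {a x y} => by
        change MulOpposite.op (E.inner x (E.ract y a.unop)) = _
        rw [E.inner_ract]; rfl
      inner_smul_right_complex := fun {z x y} => by simp
      star_inner := fun x y => by rw [← MulOpposite.op_star, E.star_inner]
      norm_eq_sqrt_norm_inner_self := fun x => by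
        rw [MulOpposite.norm_op, ← E.norm_sq, Real.sqrt_sq (norm_nonneg _)] }
  exact CStarModule.norm_inner_le (A := Aᵐᵒᵖ) E.X (x := x) (y := y)

theorem norm_ract_le (x : E.X) (a : A) : ‖E.ract x a‖ ≤ ‖x‖ * ‖a‖ := by
  refine le_of_sq_le_sq ?_ (by positivity)
  rw [E.norm_sq, E.inner_ract, E.inner_ract_left, mul_pow, E.norm_sq]
  calc _ ≤ ‖star a‖ * ‖E.inner x x‖ * ‖a‖ := (norm_mul_le _ _).trans (by gcongr; exact norm_mul_le _ _)
    _ = _ := by rw [norm_star]; ring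

/-- The operator `Θ_{x, y} z = x ⟨y, z⟩`. -/
def theta (x y : E.X) : E.X →L[ℂ] E.X :=
  LinearMap.mkContinuous (E.ract x ∘ₗ E.inner y) (‖x‖ * ‖y‖) fun z => by
    calc ‖E.ract x (E.inner y z)‖ ≤ ‖x‖ * ‖E.inner y z‖ := E.norm_ract_le _ _
      _ ≤ ‖x‖ * (‖y‖ * ‖z‖) := by gcongr; exact E.norm_inner_le _ _
      _ = _ := by ring

/-- The "compact" operators: the closed linear span of the operators `Θ_{x, y}`. -/
def compacts : Submodule ℂ (E.X →L[ℂ] E.X) :=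
  (Submodule.span ℂ {T | ∃ x y, T = E.theta x y}).topologicalClosure

theorem theta_mem (x y : E.X) : E.theta x y ∈ E.compacts :=
  Submodule.le_topologicalClosure _ (Submodule.subset_span ⟨x, y, rfl⟩)

/-- The ideal `J(X) = φ⁻¹(K(X))`. -/
def J : Submodule ℂ A := E.compacts.comap (E.φ : A →ₗ[ℂ] (E.X →L[ℂ] E.X))

/-- The annihilator of the kernel of `φ`. -/
def kerPerp : Submodule ℂ A where
  carrier := {a | ∀ b, E.φ b = 0 → a * b = 0}
  add_mem' := fun ha hb c hc => by rw [add_mul, ha c hc, hb c hc, add_zero]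
  zero_mem' := fun c _ => zero_mul c
  smul_mem' := fun z a ha c hc => by rw [smul_mul_assoc, ha c hc, smul_zero]

/-- A representation `(π, t)` of the C*-correspondence in a C*-algebra. -/
structure Representation (B : Type u) [NonUnitalCStarAlgebra B] where
  π : A →⋆ₙₐ[ℂ] B
  t : E.X →ₗ[ℂ] B
  t_ract : ∀ x a, t (E.ract x a) = t x * π a
  star_t_mul_t : ∀ x y, star (t x) * t y = π (E.inner x y)
  t_φ : ∀ a x, t (E.φ a x) = π a * t x

variable {E}

/-- The representation `(π, t)` is coisometric on `J`: the map `π₁₁` on `K(X)` determined by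
`π₁₁(Θ_{x, y}) = t(x) t(y)*` satisfies `π₁₁(φ(a)) = π(a)` for `a` in `J`. -/
def Representation.IsCoisometricOn {B : Type u} [NonUnitalCStarAlgebra B]
    (ρ : E.Representation B) (J : Submodule ℂ A) : Prop :=
  ∃ π₁₁ : E.compacts →ₗ[ℂ] B, (∀ k, ‖π₁₁ k‖ ≤ ‖k‖) ∧
    (∀ x y, π₁₁ ⟨E.theta x y, E.theta_mem x y⟩ = ρ.t x * star (ρ.t y)) ∧
    ∀ a ∈ J, ∀ h : E.φ a ∈ E.compacts, π₁₁ ⟨E.φ a, h⟩ = ρ.π a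

theorem Representation.norm_t_le {B : Type u} [NonUnitalCStarAlgebra B]
    (ρ : E.Representation B) (x : E.X) : ‖ρ.t x‖ ≤ ‖x‖ := by
  refine le_of_sq_le_sq ?_ (norm_nonneg _)
  rw [E.norm_sq, sq, ← CStarRing.norm_star_mul_self, ρ.star_t_mul_t]
  exact NonUnitalStarAlgHom.norm_apply_le ρ.π _

variable (E)

/-- A left `A`-valued inner product on a C*-correspondence `X` that makes it a Hilbert bimodule:
`X` is also a left Hilbert `A`-module and `x ⟨y, z⟩ = ⟪x, y⟫ z`, where `⟪x, y⟫` denotes the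
left inner product. -/
structure LeftInner where
  toFun : E.X →ₗ[ℂ] E.X →ₗ⋆[ℂ] A
  left : ∀ a x y, toFun (E.φ a x) y = a * toFun x y
  star_toFun : ∀ x y, star (toFun x y) = toFun y x
  self_pos : ∀ x, ∃ b, toFun x x = star b * b
  definite : ∀ x, toFun x x = 0 → x = 0
  complete : ∀ u : ℕ → E.X,
    (∀ ε > 0, ∃ N, ∀ m ≥ N, ∀ n ≥ N, ‖toFun (u m - u n) (u m - u n)‖ < ε) →
    ∃ x, Filter.Tendsto (fun n => ‖toFun (u n - x) (u n - x)‖) Filter.atTop (nhds 0)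
  imprimitivity : ∀ x y z, E.ract x (E.inner y z) = E.φ (toFun x y) z

/-- The C*-correspondence is a Hilbert bimodule. -/
def IsHilbertBimodule : Prop := Nonempty E.LeftInner

section TensorPower

/-- The inner product of the elementary tensors `x 0 ⊗ ... ⊗ x n` and `y 0 ⊗ ... ⊗ y n` in the
internal tensor power of `X`. -/
def tensorForm : ∀ n : ℕ, (Fin (n + 1) → E.X) → (Fin (n + 1) → E.X) → A
  | 0, x, y => E.inner (x 0) (y 0)
  | n + 1, x, y => E.inner (x (Fin.last (n + 1)))
      (E.φ (tensorForm n (Fin.init x) (Fin.init y)) (y (Fin.last (n + 1))))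

theorem star_tensorForm (n : ℕ) (x y : Fin (n + 1) → E.X) :
    star (E.tensorForm n x y) = E.tensorForm n y x := by
  induction n with
  | zero => exact E.star_inner _ _
  | succ n ih => simp only [tensorForm]; rw [E.star_inner, E.inner_φ, ih]

theorem exists_pos_neg {C : Type*} [NonUnitalCStarAlgebra C] (a : C) (ha : IsSelfAdjoint a) :
    ∃ p q s : C, a = p - star s * s ∧ p = star q * q ∧ (star s * s) * p = 0 := by
  let _ : PartialOrder C := CStarAlgebra.spectralOrder C
  have _ : StarOrderedRing C := CStarAlgebra.spectralOrderedRing C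
  obtain ⟨s, hs⟩ := CStarAlgebra.nonneg_iff_eq_star_mul_self.1 (CFC.negPart_nonneg a)
  obtain ⟨q, hq⟩ := CStarAlgebra.nonneg_iff_eq_star_mul_self.1 (CFC.posPart_nonneg a)
  refine ⟨a⁺, q, s, ?_, hq, ?_⟩
  · rw [← hs, CFC.posPart_sub_negPart a ha]
  · rw [← hs, CFC.negPart_mul_posPart]

theorem exists_factor_of_nonneg {ι : Type*} [Fintype ι] [PartialOrder A] [StarOrderedRing A]
    (G : ι → ι → A) (hG : ∀ i j, star (G i j) = G j i)
    (hpos : ∀ c : ι → A, 0 ≤ ∑ i, ∑ j, star (c i) * G i j * c j) :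
    ∃ b : ι → ι → A, ∀ i j, G i j = ∑ l, star (b l i) * b l j := by
  let M : CStarMatrix ι ι A := CStarMatrix.ofMatrix (Matrix.of G)
  have hM : IsSelfAdjoint M := by
    ext i j
    exact hG j i
  obtain ⟨P, Q, S, hsub, hQ, hNP⟩ := exists_pos_neg M hM
  obtain ⟨N, hS⟩ : ∃ N, N = star S * S := ⟨_, rfl⟩
  rw [← hS] at hsub hNP
  have hNs : star N = N := by rw [hS, star_mul, star_star]
  have h1 : star (S * N) * (S * N) = - (N * M * N) := by
    have h3 : N * M * N = - (N * N * N) := by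
      rw [hsub, mul_sub, hNP, zero_sub, neg_mul]
    rw [h3, neg_neg, star_mul, hNs]
    calc N * star S * (S * N) = N * (star S * S) * N := by simp only [mul_assoc]
      _ = _ := by rw [← hS]
  have hz : S * N = 0 := by
    ext l k
    have h2 : (star (S * N) * (S * N)) k k
        = ∑ l, star ((S * N) l k) * (S * N) l k := by
      rw [CStarMatrix.mul_apply]; rfl
    have h4 : (N * M * N) k k = ∑ i, ∑ j, star (N i k) * G i j * N j k := by
      rw [CStarMatrix.mul_apply]
      simp only [CStarMatrix.mul_apply, Finset.sum_mul]
      rw [Finset.sum_comm]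
      refine Finset.sum_congr rfl fun i _ => Finset.sum_congr rfl fun j _ => ?_
      have : star (N i k) = N k i := by
        conv_rhs => rw [← hNs]
        rfl
      rw [this]; rfl
    have h5 : ∑ l, star ((S * N) l k) * (S * N) l k = 0 := by
      apply le_antisymm
      · rw [← h2, h1, CStarMatrix.neg_apply, h4]
        exact neg_nonpos.2 (hpos _)
      · exact Finset.sum_nonneg fun _ _ => star_mul_self_nonneg _
    have h6 := (Finset.sum_eq_zero_iff_of_nonneg
      (fun l _ => star_mul_self_nonneg ((S * N) l k))).1 h5 l (Finset.mem_univ _)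
    exact (CStarRing.star_mul_self_eq_zero_iff _).1 h6
  have hN0 : N = 0 := by
    have : star N * N = 0 := by
      rw [hNs]
      nth_rewrite 1 [hS]
      rw [mul_assoc, hz, mul_zero]
    exact (CStarRing.star_mul_self_eq_zero_iff _).1 this
  have hMQ : M = star Q * Q := by rw [hsub, hN0, sub_zero, hQ]
  refine ⟨Q, fun i j => ?_⟩
  have : M i j = (star Q * Q) i j := by rw [← hMQ]
  rw [CStarMatrix.mul_apply] at this
  exact this

theorem inner_sum_sum {ι : Type*} [Fintype ι] (x : ι → E.X) :
    E.inner (∑ i, x i) (∑ j, x j) = ∑ i, ∑ j, E.inner (x i) (x j) := by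
  simp only [map_sum, LinearMap.sum_apply]
  exact Finset.sum_comm

theorem φ_ract (a : A) (x : E.X) (b : A) : E.φ a (E.ract x b) = E.ract (E.φ a x) b := by
  have h : ∀ z : E.X, E.inner (E.φ a (E.ract x b) - E.ract (E.φ a x) b) z = 0 := by
    intro z
    rw [map_sub, LinearMap.sub_apply, E.inner_φ, E.inner_ract_left, E.inner_ract_left, E.inner_φ,
      sub_self]
  have h2 := E.norm_sq (E.φ a (E.ract x b) - E.ract (E.φ a x) b)
  rw [h, norm_zero] at h2
  exact sub_eq_zero.1 (norm_eq_zero.1 (pow_eq_zero_iff two_ne_zero |>.1 h2))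

theorem tensorForm_factor (n : ℕ) {ι : Type*} [Fintype ι] (x : ι → Fin (n + 1) → E.X) :
    ∃ b : ι → ι → A, ∀ i j, E.tensorForm n (x i) (x j) = ∑ l, star (b l i) * b l j := by
  let _ : PartialOrder A := CStarAlgebra.spectralOrder A
  have _ : StarOrderedRing A := CStarAlgebra.spectralOrderedRing A
  have hself : ∀ z : E.X, 0 ≤ E.inner z z := by
    intro z
    obtain ⟨b, hb⟩ := E.inner_self_pos z
    rw [hb]; exact star_mul_self_nonneg _
  have hgram : ∀ (z : ι → E.X) (c : ι → A),
      ∑ i, ∑ j, star (c i) * E.inner (z i) (z j) * c j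
        = E.inner (∑ i, E.ract (z i) (c i)) (∑ j, E.ract (z j) (c j)) := by
    intro z c
    rw [E.inner_sum_sum]
    simp only [E.inner_ract, E.inner_ract_left]
  induction n with
  | zero =>
    refine exists_factor_of_nonneg _ (fun i j => E.star_tensorForm 0 _ _) fun c => ?_
    simp only [tensorForm]
    rw [hgram (fun i => x i 0) c]
    exact hself _
  | succ n ih =>
    obtain ⟨b, hb⟩ := ih (fun i => Fin.init (x i))
    refine exists_factor_of_nonneg _ (fun i j => E.star_tensorForm _ _ _) fun c => ?_
    have h : ∀ i j, E.tensorForm (n + 1) (x i) (x j)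
        = ∑ l, E.inner (E.φ (b l i) (x i (Fin.last _))) (E.φ (b l j) (x j (Fin.last _))) := by
      intro i j
      simp only [tensorForm]
      rw [hb i j, map_sum, sum_apply, map_sum]
      refine Finset.sum_congr rfl fun l _ => ?_
      rw [E.inner_φ, map_mul]
      rfl
    simp only [h, Finset.mul_sum, Finset.sum_mul]
    have : ∑ i, ∑ j, ∑ l, star (c i) *
          E.inner (E.φ (b l i) (x i (Fin.last _))) (E.φ (b l j) (x j (Fin.last _))) * c j
        = ∑ l, ∑ i, ∑ j, star (c i) *
          E.inner (E.φ (b l i) (x i (Fin.last _))) (E.φ (b l j) (x j (Fin.last _))) * c j := by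
      rw [Finset.sum_comm' (t' := Finset.univ) (s' := fun _ => Finset.univ) (by simp)]
      conv_rhs => rw [Finset.sum_comm]
      rw [Finset.sum_comm]
      refine Finset.sum_congr rfl fun i _ => ?_
      rw [Finset.sum_comm]
    rw [this]
    refine Finset.sum_nonneg fun l _ => ?_
    rw [hgram (fun i => E.φ (b l i) (x i (Fin.last _))) c]
    exact hself _

/-- The sesquilinear extension of `tensorForm` to formal combinations of elementary tensors. -/
def preInner (n : ℕ) (ξ η : (Fin (n + 1) → E.X) →₀ ℂ) : A :=
  ξ.sum fun x c => η.sum fun y d => (star c * d) • E.tensorForm n x y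

/-- `preInner` as a sesquilinear map. -/
def preForm (n : ℕ) : ((Fin (n + 1) → E.X) →₀ ℂ) →ₗ⋆[ℂ]
    ((Fin (n + 1) → E.X) →₀ ℂ) →ₗ[ℂ] A :=
  LinearMap.mk₂'ₛₗ (starRingEnd ℂ) (RingHom.id ℂ) (fun ξ η => E.preInner n ξ η)
    (fun ξ ξ' η => by
      refine Finsupp.sum_add_index' (fun x => by simp) (fun x c c' => ?_)
      rw [← Finsupp.sum_add]
      simp only [star_add, add_mul, add_smul])
    (fun c ξ η => by
      unfold preInner
      rw [Finsupp.smul_sum]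
      refine (Finsupp.sum_smul_index (fun x => by simp)).trans ?_
      refine Finsupp.sum_congr fun x _ => ?_
      rw [Finsupp.smul_sum]
      simp only [star_mul', smul_smul, mul_assoc]
      rfl)
    (fun ξ η η' => by
      unfold preInner
      rw [← Finsupp.sum_add]
      refine Finsupp.sum_congr fun x _ => ?_
      refine Finsupp.sum_add_index' (fun y => by simp) (fun y c c' => ?_)
      rw [mul_add, add_smul])
    (fun c ξ η => by
      unfold preInner
      rw [Finsupp.smul_sum]
      refine Finsupp.sum_congr fun x _ => ?_
      rw [Finsupp.smul_sum]
      refine (Finsupp.sum_smul_index (fun x => by simp)).trans ?_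
      simp only [smul_smul, mul_left_comm, RingHom.id_apply])

theorem preInner_self_pos (n : ℕ) (ξ : (Fin (n + 1) → E.X) →₀ ℂ) [PartialOrder A]
    [StarOrderedRing A] : 0 ≤ E.preInner n ξ ξ := by
  classical
  obtain ⟨b, hb⟩ := E.tensorForm_factor n (fun x : ξ.support => x.1)
  have h : E.preInner n ξ ξ
      = ∑ l, star (∑ i : ξ.support, ξ i.1 • b l i) * ∑ j : ξ.support, ξ j.1 • b l j := by
    symm
    calc _ = ∑ l, ∑ i : ξ.support, ∑ j : ξ.support,
          (star (ξ i.1) * ξ j.1) • (star (b l i) * b l j) := by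
          refine Finset.sum_congr rfl fun l _ => ?_
          rw [star_sum, Finset.sum_mul_sum]
          simp only [star_smul, smul_mul_smul_comm]
      _ = ∑ i : ξ.support, ∑ j : ξ.support, (star (ξ i.1) * ξ j.1) • E.tensorForm n i.1 j.1 := by
          rw [Finset.sum_comm]
          refine Finset.sum_congr rfl fun i _ => ?_
          rw [Finset.sum_comm]
          refine Finset.sum_congr rfl fun j _ => ?_
          rw [hb, Finset.smul_sum]
      _ = ∑ i : ξ.support, ∑ y ∈ ξ.support, (star (ξ i.1) * ξ y) • E.tensorForm n i.1 y :=
          Finset.sum_congr rfl fun i _ => Finset.sum_coe_sort ξ.support fun y =>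
            (star (ξ i.1) * ξ y) • E.tensorForm n i.1 y
      _ = _ := Finset.sum_coe_sort ξ.support fun x => ∑ y ∈ ξ.support,
            (star (ξ x) * ξ y) • E.tensorForm n x y
  rw [h]
  exact Finset.sum_nonneg fun l _ => star_mul_self_nonneg _

/-- Formal linear combinations of elementary tensors of length `n + 1`, with the seminorm
`ξ ↦ ‖⟨ξ, ξ⟩‖ ^ (1 / 2)`. -/
def PreTensorPower (n : ℕ) : Type u := (Fin (n + 1) → E.X) →₀ ℂ

instance (n : ℕ) : AddCommGroup (E.PreTensorPower n) :=
  inferInstanceAs (AddCommGroup ((Fin (n + 1) → E.X) →₀ ℂ))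

instance (n : ℕ) : Module ℂ (E.PreTensorPower n) :=
  inferInstanceAs (Module ℂ ((Fin (n + 1) → E.X) →₀ ℂ))

instance (n : ℕ) : Norm (E.PreTensorPower n) := ⟨fun ξ => √‖E.preInner n ξ ξ‖⟩

theorem preTensorPower_core (n : ℕ) : SeminormedSpace.Core ℂ (E.PreTensorPower n) where
  norm_nonneg ξ := Real.sqrt_nonneg _
  norm_smul c ξ := by
    change √‖E.preForm n (c • (show (Fin (n + 1) → E.X) →₀ ℂ from ξ)) (c • (show (Fin (n + 1) → E.X) →₀ ℂ from ξ))‖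
      = ‖c‖ * √‖E.preForm n ξ ξ‖
    rw [map_smul, LinearMap.map_smulₛₗ₂, norm_smul, norm_smul, RCLike.norm_conj, ← mul_assoc,
      Real.sqrt_mul (by positivity), Real.sqrt_mul_self (norm_nonneg _)]
  norm_triangle ξ η := by
    let _ : PartialOrder A := CStarAlgebra.spectralOrder A
    have _ : StarOrderedRing A := CStarAlgebra.spectralOrderedRing A
    exact sqrt_norm_form_add_le (E.preForm n) (fun v => E.preInner_self_pos n v) ξ η

instance (n : ℕ) : SeminormedAddCommGroup (E.PreTensorPower n) :=
  SeminormedAddCommGroup.ofCore (E.preTensorPower_core n)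

instance (n : ℕ) : NormedSpace ℂ (E.PreTensorPower n) :=
  { (inferInstance : Module ℂ (E.PreTensorPower n)) with
    norm_smul_le := fun c ξ => ((E.preTensorPower_core n).norm_smul c ξ).le }

/-- The internal tensor power of `X` with `n + 1` factors, `X^{⊗ (n + 1)}`: the Hausdorff completion
of the space of formal combinations of elementary tensors. -/
abbrev TensorPower (n : ℕ) : Type u := UniformSpace.Completion (E.PreTensorPower n)

/-- An elementary tensor as a formal combination. -/
def PreTensorPower.single {n : ℕ} (x : Fin (n + 1) → E.X) : E.PreTensorPower n :=
  Finsupp.single x 1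

/-- The elementary tensor `x 0 ⊗ ... ⊗ x n`. -/
def tmul {n : ℕ} (x : Fin (n + 1) → E.X) : E.TensorPower n :=
  (PreTensorPower.single E x : E.PreTensorPower n)

theorem norm_tmul {n : ℕ} (x : Fin (n + 1) → E.X) : ‖E.tmul x‖ ^ 2 = ‖E.tensorForm n x x‖ := by
  have : ‖E.tmul x‖ = √‖E.preInner n (Finsupp.single x 1) (Finsupp.single x 1)‖ :=
    UniformSpace.Completion.norm_coe _
  rw [this, Real.sq_sqrt (norm_nonneg _), preInner, Finsupp.sum_single_index (by simp),
    Finsupp.sum_single_index (by simp)]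
  simp

end TensorPower

end CStarCorrespondence


namespace CStarCorrespondence

variable {A : Type u} [NonUnitalCStarAlgebra A] (E : CStarCorrespondence A)

/-- Generators and relations for the C*-algebra universal for the representations `(π, t)` of the
C*-correspondence that have the property `P`. -/
def relations (P : ∀ (B : Type u) [NonUnitalCStarAlgebra B], E.Representation B → Prop) :
    CStarRelations (A ⊕ E.X) where
  Holds B _ f := ∃ ρ : E.Representation B, P B ρ ∧
    (∀ a, f (Sum.inl a) = ρ.π a) ∧ ∀ x, f (Sum.inr x) = ρ.t x
  bound := Sum.elim (fun a => ‖a‖) (fun x => ‖x‖)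
  norm_le := by
    rintro B _ f ⟨ρ, _, h1, h2⟩ (a | x)
    · rw [h1]; exact NonUnitalStarAlgHom.norm_apply_le ρ.π a
    · rw [h2]; exact ρ.norm_t_le x

section Universal

variable (P : ∀ (B : Type u) [NonUnitalCStarAlgebra B], E.Representation B → Prop)

/-- The representation that gives the admissible family with index `p`. -/
def fiberRep (p : (E.relations P).Index) : E.Representation ((E.relations P).Fiber p) :=
  ((E.relations P).fiberMap_holds p).choose

theorem fiberRep_holds (p : (E.relations P).Index) : P _ (E.fiberRep P p) :=
  ((E.relations P).fiberMap_holds p).choose_spec.1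

theorem proj_inl (p : (E.relations P).Index) (a : A) :
    (E.relations P).proj p ((E.relations P).ι (Sum.inl a)) = (E.fiberRep P p).π a :=
  ((E.relations P).fiberMap_holds p).choose_spec.2.1 a

theorem proj_inr (p : (E.relations P).Index) (x : E.X) :
    (E.relations P).proj p ((E.relations P).ι (Sum.inr x)) = (E.fiberRep P p).t x :=
  ((E.relations P).fiberMap_holds p).choose_spec.2.2 x

/-- The universal representation on `A`. -/
def universalπ : A →⋆ₙₐ[ℂ] (E.relations P).Universal where
  toFun a := (E.relations P).ι (Sum.inl a)
  map_smul' c a := (E.relations P).ext_proj fun p => by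
    rw [map_smul, proj_inl, proj_inl, map_smul]
    rfl
  map_zero' := (E.relations P).ext_proj fun p => by
    rw [map_zero, proj_inl, map_zero]
  map_add' a b := (E.relations P).ext_proj fun p => by
    rw [map_add, proj_inl, proj_inl, proj_inl, map_add]
  map_mul' a b := (E.relations P).ext_proj fun p => by
    rw [map_mul, proj_inl, proj_inl, proj_inl, map_mul]
  map_star' a := (E.relations P).ext_proj fun p => by
    rw [map_star, proj_inl, proj_inl, map_star]

/-- The universal representation on `X`. -/
def universalt : E.X →ₗ[ℂ] (E.relations P).Universal where
  toFun x := (E.relations P).ι (Sum.inr x)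
  map_smul' c x := (E.relations P).ext_proj fun p => by
    rw [map_smul, proj_inr, proj_inr, map_smul, RingHom.id_apply]
  map_add' x y := (E.relations P).ext_proj fun p => by
    rw [map_add, proj_inr, proj_inr, proj_inr, map_add]

theorem proj_universalπ (p : (E.relations P).Index) (a : A) :
    (E.relations P).proj p (E.universalπ P a) = (E.fiberRep P p).π a := E.proj_inl P p a

theorem proj_universalt (p : (E.relations P).Index) (x : E.X) :
    (E.relations P).proj p (E.universalt P x) = (E.fiberRep P p).t x := E.proj_inr P p x

/-- The universal representation among those with property `P`. -/
def universalRep : E.Representation (E.relations P).Universal where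
  π := E.universalπ P
  t := E.universalt P
  t_ract x a := (E.relations P).ext_proj fun p => by
    rw [map_mul, proj_universalt, proj_universalt, proj_universalπ, Representation.t_ract]
  star_t_mul_t x y := (E.relations P).ext_proj fun p => by
    rw [map_mul, map_star, proj_universalt, proj_universalt, proj_universalπ,
      Representation.star_t_mul_t]
  t_φ a x := (E.relations P).ext_proj fun p => by
    rw [map_mul, proj_universalt, proj_universalt, proj_universalπ, Representation.t_φ]

theorem exists_lift {B : Type u} [NonUnitalCStarAlgebra B] (ρ : E.Representation B)
    (hρ : P B ρ) :
    ∃ Φ : (E.relations P).Universal →⋆ₙₐ[ℂ] B,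
      (∀ a, Φ ((E.universalRep P).π a) = ρ.π a) ∧ ∀ x, Φ ((E.universalRep P).t x) = ρ.t x := by
  obtain ⟨Φ, hΦ⟩ := (E.relations P).exists_lift (Sum.elim (fun a => ρ.π a) fun x => ρ.t x)
    ⟨ρ, hρ, fun _ => rfl, fun _ => rfl⟩
  exact ⟨Φ, fun a => hΦ (Sum.inl a), fun x => hΦ (Sum.inr x)⟩

end Universal

/-- The relations of the relative Cuntz-Pimsner algebra. -/
abbrev cuntzPimsnerRelations (J : Submodule ℂ A) : CStarRelations (A ⊕ E.X) :=
  E.relations fun _ _ ρ => ρ.IsCoisometricOn J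

/-- The relative Cuntz-Pimsner algebra `O(J, X)`, universal for representations of `X` that are
coisometric on `J`. -/
abbrev CuntzPimsner (J : Submodule ℂ A) : Type u := (E.cuntzPimsnerRelations J).Universal

/-- The universal representation of `X` in `O(J, X)`. -/
abbrev toCuntzPimsner (J : Submodule ℂ A) : E.Representation (E.CuntzPimsner J) :=
  E.universalRep fun _ _ ρ => ρ.IsCoisometricOn J

theorem toCuntzPimsner_coisometric (J : Submodule ℂ A) :
    (E.toCuntzPimsner J).IsCoisometricOn J := by
  set R := E.cuntzPimsnerRelations J with hR
  have hfib := E.fiberRep_holds fun _ _ ρ => ρ.IsCoisometricOn J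
  choose ψ hnorm htheta hJ using hfib
  let g : E.compacts → R.Product := fun k => ⟨fun p => ψ p k, memℓp_infty ⟨‖k‖, by
    rintro _ ⟨p, rfl⟩
    exact hnorm p k⟩⟩
  let G : E.compacts →ₗ[ℂ] R.Product :=
    { toFun := g
      map_add' := fun k l => lp.ext (funext fun p => map_add (ψ p) k l)
      map_smul' := fun c k => lp.ext (funext fun p => map_smul (ψ p) c k) }
  have hGn : ∀ k, ‖G k‖ ≤ ‖k‖ := fun k =>
    lp.norm_le_of_forall_le (norm_nonneg _) fun p => hnorm p k
  have hGc : Continuous G := AddMonoidHomClass.continuous_of_bound G 1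
    fun k => (hGn k).trans (one_mul _).ge
  have hGt : ∀ x y, G ⟨E.theta x y, E.theta_mem x y⟩ =
      R.incl ((E.toCuntzPimsner J).t x * star ((E.toCuntzPimsner J).t y)) := by
    intro x y
    refine lp.ext (funext fun p => ?_)
    have : R.proj p ((E.toCuntzPimsner J).t x * star ((E.toCuntzPimsner J).t y)) =
        ψ p ⟨E.theta x y, E.theta_mem x y⟩ := by
      rw [map_mul, map_star, htheta]
      congr 1
      · exact E.proj_universalt _ p x
      · exact congrArg star (E.proj_universalt _ p y)
    exact this.symm
  have hmem : ∀ k : E.compacts, G k ∈ R.subalg := by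
    have hspan : ∀ k (hk : k ∈ Submodule.span ℂ {T | ∃ x y, T = E.theta x y}),
        G ⟨k, Submodule.le_topologicalClosure _ hk⟩ ∈ R.subalg := by
      intro k hk
      induction hk using Submodule.span_induction with
      | mem k hk =>
        obtain ⟨x, y, rfl⟩ := hk
        rw [hGt]
        exact ((E.toCuntzPimsner J).t x * star ((E.toCuntzPimsner J).t y)).2
      | zero =>
        have : G ⟨0, Submodule.zero_mem _⟩ = 0 := map_zero G
        rw [this]; exact zero_mem _
      | add k l hk hl ihk ihl =>
        have := add_mem ihk ihl
        rw [← map_add] at this; exact this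
      | smul c k hk ih =>
        have := SMulMemClass.smul_mem c ih
        rw [← map_smul] at this; exact this
    intro k
    have hcl : IsClosed {k : E.compacts | G k ∈ R.subalg} :=
      (NonUnitalStarSubalgebra.isClosed_topologicalClosure _).preimage hGc
    have hk : k ∈ closure {k : E.compacts |
        k.1 ∈ Submodule.span ℂ {T | ∃ x y, T = E.theta x y}} := by
      rw [closure_subtype]
      refine closure_mono ?_ k.2
      intro l hl
      exact ⟨⟨l, Submodule.le_topologicalClosure _ hl⟩, hl, rfl⟩
    exact closure_minimal (fun l hl => hspan l.1 hl) hcl hk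
  refine ⟨{ toFun := fun k => ⟨G k, hmem k⟩
            map_add' := fun k l => Subtype.ext (map_add G k l)
            map_smul' := fun c k => Subtype.ext (map_smul G c k) }, hGn, ?_, ?_⟩
  · intro x y
    exact Subtype.ext (hGt x y)
  · intro a ha h
    refine R.ext_proj fun p => ?_
    exact (hJ p a ha h).trans (E.proj_universalπ _ p a).symm

variable {E}

/-- The representation `(π, z t)`. -/
def Representation.rotate {B : Type u} [NonUnitalCStarAlgebra B] (ρ : E.Representation B)
    (z : Circle) : E.Representation B where
  π := ρ.π
  t := (z : ℂ) • ρ.t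
  t_ract x a := by simp only [LinearMap.smul_apply, ρ.t_ract, smul_mul_assoc]
  star_t_mul_t x y := by
    have h : star (z : ℂ) * z = 1 := by
      rw [show star (z : ℂ) = (z : ℂ)⁻¹ by rw [← Circle.coe_inv, Circle.coe_inv_eq_conj]; rfl]
      exact inv_mul_cancel₀ z.coe_ne_zero
    simp only [LinearMap.smul_apply, star_smul, smul_mul_smul_comm, h, one_smul, ρ.star_t_mul_t]
  t_φ a x := by simp only [LinearMap.smul_apply, ρ.t_φ, mul_smul_comm]

theorem Representation.rotate_coisometric {B : Type u} [NonUnitalCStarAlgebra B]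
    {ρ : E.Representation B} {J : Submodule ℂ A} (hρ : ρ.IsCoisometricOn J) (z : Circle) :
    (ρ.rotate z).IsCoisometricOn J := by
  obtain ⟨ψ, h1, h2, h3⟩ := hρ
  refine ⟨ψ, h1, fun x y => ?_, h3⟩
  have h : (z : ℂ) * star (z : ℂ) = 1 := by
    rw [show star (z : ℂ) = (z : ℂ)⁻¹ by rw [← Circle.coe_inv, Circle.coe_inv_eq_conj]; rfl]
    exact mul_inv_cancel₀ z.coe_ne_zero
  simp only [h2, rotate, LinearMap.smul_apply, star_smul, smul_mul_smul_comm, h, one_smul]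

variable (E)

/-- The gauge action on `O(J, X)`, determined by `γ_z(π(a)) = π(a)` and `γ_z(t(x)) = z t(x)`. -/
def gauge (J : Submodule ℂ A) (z : Circle) : E.CuntzPimsner J →⋆ₙₐ[ℂ] E.CuntzPimsner J :=
  (E.exists_lift _ _
    (Representation.rotate_coisometric (E.toCuntzPimsner_coisometric J) z)).choose

theorem gauge_π (J : Submodule ℂ A) (z : Circle) (a : A) :
    E.gauge J z ((E.toCuntzPimsner J).π a) = (E.toCuntzPimsner J).π a :=
  (E.exists_lift _ _
    (Representation.rotate_coisometric (E.toCuntzPimsner_coisometric J) z)).choose_spec.1 a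

theorem gauge_t (J : Submodule ℂ A) (z : Circle) (x : E.X) :
    E.gauge J z ((E.toCuntzPimsner J).t x) = (z : ℂ) • (E.toCuntzPimsner J).t x :=
  (E.exists_lift _ _
    (Representation.rotate_coisometric (E.toCuntzPimsner_coisometric J) z)).choose_spec.2 x

/-- The `k`-th spectral subspace `{b | γ_z(b) = z ^ k b for all z}` of the gauge action. -/
def spectralSubspace (J : Submodule ℂ A) (k : ℤ) : Submodule ℂ (E.CuntzPimsner J) where
  carrier := {b | ∀ z : Circle, E.gauge J z b = (z : ℂ) ^ k • b}
  add_mem' := fun hx hy z => by rw [map_add, hx z, hy z, smul_add]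
  zero_mem' := fun z => by rw [map_zero, smul_zero]
  smul_mem' := fun c x hx z => by rw [map_smul, hx z, smul_comm]

variable {E} in
/-- The relations of the crossed product by a Hilbert bimodule: representations `(π, t)` with
`t(x) t(y)* = π(⟪x, y⟫)`. -/
abbrev crossedProductRelations (L : E.LeftInner) : CStarRelations (A ⊕ E.X) :=
  E.relations fun _ _ ρ => ∀ x y, ρ.t x * star (ρ.t y) = ρ.π (L.toFun x y)

variable {E} in
/-- The crossed product of `A` by the Hilbert bimodule `X` with left inner product `L`, universal for
the covariant representations. -/
abbrev CrossedProduct (L : E.LeftInner) : Type u := (crossedProductRelations L).Universal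

variable {E} in
/-- The universal covariant representation of `X` in the crossed product. -/
abbrev toCrossedProduct (L : E.LeftInner) : E.Representation (CrossedProduct L) :=
  E.universalRep fun _ _ ρ => ∀ x y, ρ.t x * star (ρ.t y) = ρ.π (L.toFun x y)

variable {E} in
/-- The product `t(x 0) ... t(x n)`. -/
def Representation.prodT {B : Type u} [NonUnitalCStarAlgebra B] (ρ : E.Representation B) :
    ∀ n : ℕ, (Fin (n + 1) → E.X) → B
  | 0, x => ρ.t (x 0)
  | n + 1, x => prodT ρ n (Fin.init x) * ρ.t (x (Fin.last (n + 1)))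

end CStarCorrespondence

end

/-! Both parts rest on a detection principle, `exists_detecting_representation`. For an object `k`
and a positive functional `ω` on `T(k,k)`, each `T(k,p)` carries the semi-inner product `ω(x* y)`.
On the Hilbert sum over all `(k,ω)` and all `p`, a morphism `a ∈ T(m,n)` acts as `⊕_j a ⊗ 1^j`,
sending `x ∈ T(k,m+j)` to `(a ⊗ 1^j) x`, and as zero on `T(k,p)` with `p < m`. This is a right
tensor representation of all of `T`. The actions of `c` and `c ⊗ 1` differ by one corner operator,
namely `c` on a single summand. Dividing by the closed span of the corners from `J`, inside its
idealizer, therefore makes the representation coisometric on `J`. If `⊗ 1` is injective on `J`, it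
is isometric there, whereas the entries of an element of the closed span of corners become
arbitrarily small along every diagonal. Hence only forced identifications occur: if `a' ∈ K(q,p)`
and `a ∈ K(q+r,p+r)` have equal images, then `a = a' ⊗ 1^r` and `a' ⊗ 1^j ∈ J` for `j < r`.

(A) If `i` is faithful, `i(c) = i(c ⊗ 1)` shows that `⊗ 1` is injective on `J`. An element of
`K(m+1,n+1)` with `m ≤ n` has the same image as some element of `K(0,n-m)`, so by detection it lies
in `J ⊗ 1`; adjoints give the case `n ≤ m`. The inverse of `⊗ 1` on `J` is then the transfer action,
and `J` is all of `J(K) ∩ (ker ⊗ 1)^⊥`. Conversely, `⊗ 1` is injective on `J(K) ∩ (ker ⊗ 1)^⊥`, so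
detection with `r = 0` gives faithfulness. The values of the transfer action lie in `J`, so `i(L(a))
= i(a)` lowers indices until everything of degree `k ≥ 0` sits in `i(K(0,k))`. Averaging over roots
of unity (`mem_of_spectral`) identifies that range with the spectral subspace.

(B) If `π` is injective with range the fixed points, then `t(x)t(y)*` is some `π(L(x,y))`, and `L`
is a left inner product. To see that `L(x,y) ∈ J`, detection is applied to the precategory whose
morphisms from `n` to `m` are the elements of degree `m - n` of `O(J,X)`, with `⊗ 1` the identity,
and to the ideal induced by `π(J)` (`toFun_mem_of_range_eq`). For a Hilbert bimodule, `φ` maps the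
closed span of the left inner products isometrically onto `K(X)`; this span is therefore `(ker φ)^⊥
∩ J(X)` (`ideal_eq`), and coisometric on it means the same as covariant for `L`. Injectivity of `π`
comes from a two-sided Fock space built from `X` and its dual (`exists_covariant_representation`).
Covariance makes products of words collapse to words, and averaging then gives the spectral
subspaces. The tensor powers embed isometrically because the inner products of elementary tensors
and of products of the `t(x)` agree. -/

noncomputable section

/-! ### Positive functionals. -/

/-- A positive hermitian contractive linear functional on a C*-algebra. -/
structure PosFunctional (A : Type u) [NonUnitalCStarAlgebra A] where
  toCLM : A →L[ℂ] ℂ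
  norm_le : ∀ a, ‖toCLM a‖ ≤ ‖a‖
  nonneg : ∀ a, 0 ≤ (toCLM (star a * a)).re
  map_star : ∀ a, toCLM (star a) = star (toCLM a)

/-- The norm of a positive element lies in its spectrum, and adding `1` shifts the spectrum. -/
theorem norm_one_add_of_nonneg {U : Type*} [CStarAlgebra U] [PartialOrder U] [StarOrderedRing U]
    [Nontrivial U] {c : U} (hc : 0 ≤ c) : 1 + ‖c‖ ≤ ‖1 + c‖ := by
  have h1 : ‖c‖ ∈ spectrum ℝ c := CStarAlgebra.norm_mem_spectrum_of_nonneg hc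
  have h2 : 1 + ‖c‖ ∈ spectrum ℝ (1 + c) := by
    have := (spectrum.add_mem_add_iff (a := c) (r := ‖c‖) (s := (1 : ℝ))).2 h1
    rwa [map_one, add_comm ‖c‖] at this
  exact (Real.le_norm_self _).trans (spectrum.norm_le_norm_of_mem h2)

/-- Positive functionals attain the norm of a given positive element. -/
theorem exists_posFunctional {A : Type u} [NonUnitalCStarAlgebra A] (b : A) :
    ∃ ω : PosFunctional A, (ω.toCLM (star b * b)).re = ‖b‖ ^ 2 := by
  let U := Unitization ℂ A
  let _ : PartialOrder U := CStarAlgebra.spectralOrder U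
  have _ : StarOrderedRing U := CStarAlgebra.spectralOrderedRing U
  set c : U := ((star b * b : A) : U) with hc
  have hc' : c = star (b : U) * b := by simp [hc]
  have hc0 : 0 ≤ c := by rw [hc']; exact star_mul_self_nonneg _
  have hcn : ‖c‖ = ‖b‖ ^ 2 := by
    rw [hc', CStarRing.norm_star_mul_self, Unitization.norm_inr, sq]
  -- A functional norming `1 + c`. Since `‖1 + c‖ ≥ 1 + ‖c‖`, contractivity leaves no slack: the
  -- real parts of `f 1` and `f c` must be `1` and `‖c‖`.
  obtain ⟨f, hf, hfc⟩ := exists_dual_vector'' ℂ (1 + c)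
  have hle : ∀ x, ‖f x‖ ≤ ‖x‖ := fun x => (f.le_opNorm x).trans (by
    nlinarith [norm_nonneg x])
  have h3 : (f 1).re + (f c).re = ‖1 + c‖ := by
    rw [← Complex.add_re, ← map_add, hfc]; simp
  have h1 : (f 1).re ≤ 1 := (Complex.re_le_norm _).trans ((hle 1).trans (by simp))
  have h2 : (f c).re ≤ ‖c‖ := (Complex.re_le_norm _).trans (hle c)
  have h4 := norm_one_add_of_nonneg hc0
  have h5 : (f 1).re = 1 := by linarith
  have h6 : (f c).re = ‖c‖ := by linarith
  -- A contractive functional equal to `1` at the unit is positive: `0 ≤ a ≤ 1` forces `‖1 - a‖ ≤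
  -- 1`, hence `1 - Re f(a) ≤ 1`.
  have hpos1 : ∀ a : U, 0 ≤ a → ‖a‖ ≤ 1 → 0 ≤ (f a).re := by
    intro a ha ha1
    have h7 : ‖1 - a‖ ≤ 1 := by
      have h8 : a ≤ 1 := (CStarAlgebra.norm_le_one_iff_of_nonneg a).1 ha1
      rw [CStarAlgebra.norm_le_one_iff_of_nonneg _ (sub_nonneg.2 h8)]
      exact sub_le_self _ ha
    have h8 : (f (1 - a)).re ≤ 1 := (Complex.re_le_norm _).trans ((hle _).trans h7)
    rw [map_sub, Complex.sub_re, h5] at h8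
    linarith
  have hpos : ∀ a : U, 0 ≤ a → 0 ≤ (f a).re := by
    intro a ha
    by_cases h0 : ‖a‖ = 0
    · rw [norm_eq_zero.1 h0]; simp
    have hn : 0 < ‖a‖ := lt_of_le_of_ne (norm_nonneg _) (Ne.symm h0)
    have := hpos1 (‖a‖⁻¹ • a) (smul_nonneg (by positivity) ha)
      (by rw [norm_smul, norm_inv, norm_norm, inv_mul_cancel₀ h0])
    have h9 : f (‖a‖⁻¹ • a) = (‖a‖⁻¹ : ℝ) • f a := by
      rw [← Complex.coe_smul, map_smul, Complex.coe_smul]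
    rw [h9, Complex.smul_re, smul_eq_mul] at this
    exact nonneg_of_mul_nonneg_right this (by positivity)
  -- Passing to the hermitian part does not change real parts at self-adjoint elements.
  let g : A →ₗ[ℂ] ℂ :=
    { toFun := fun a => (f (a : U) + star (f ((star a : A) : U))) / 2
      map_add' := fun x y => by
        simp only [star_add, Unitization.inr_add, map_add]; ring
      map_smul' := fun z x => by
        simp only [star_smul, Unitization.inr_smul, map_smul, smul_eq_mul, RingHom.id_apply,
          star_mul', star_star]
        ring }
  have hg : ∀ a, ‖g a‖ ≤ 1 * ‖a‖ := fun a => by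
    have e1 : ‖f (a : U)‖ ≤ ‖a‖ := (hle _).trans (Unitization.norm_inr _).le
    have e2 : ‖f ((star a : A) : U)‖ ≤ ‖a‖ :=
      (hle _).trans ((Unitization.norm_inr _).trans (norm_star a)).le
    change ‖(f (a : U) + star (f ((star a : A) : U))) / 2‖ ≤ _
    rw [norm_div, Complex.norm_ofNat]
    have := norm_add_le (f (a : U)) (star (f ((star a : A) : U)))
    rw [norm_star] at this
    linarith
  have hgs : ∀ a : A, star a = a → (g a).re = (f (a : U)).re := fun a ha => by
    change ((f (a : U) + star (f ((star a : A) : U))) / 2).re = _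
    rw [ha]
    simp
  refine ⟨⟨g.mkContinuous 1 hg, fun a => by simpa using hg a, fun a => ?_, fun a => ?_⟩, ?_⟩
  · change 0 ≤ (g _).re
    rw [hgs _ (by simp), Unitization.inr_mul, Unitization.inr_star]
    exact hpos _ (star_mul_self_nonneg _)
  · change (f ((star a : A) : U) + star (f ((star (star a) : A) : U))) / 2 =
      star ((f (a : U) + star (f ((star a : A) : U))) / 2)
    rw [star_star, star_div₀, star_add, star_star, add_comm]
    simp
  · change (g _).re = _
    rw [hgs _ (by simp)]
    exact h6.trans hcn

end
-- Hilbert spaces of positive kernels, with operators induced by maps of the index set.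
noncomputable section

open scoped InnerProductSpace

/-- A positive semidefinite kernel. -/
structure PosKernel (ι : Type u) where
  k : ι → ι → ℂ
  conj_symm : ∀ i j, star (k i j) = k j i
  nonneg : ∀ ξ : ι →₀ ℂ, 0 ≤ (ξ.sum fun i c => ξ.sum fun j d => star c * d * k i j).re

namespace PosKernel

variable {ι : Type u} (κ : PosKernel ι)

/-- Formal combinations of the points, with the semi-inner product given by the kernel. -/
def Pre (_ : PosKernel ι) : Type u := ι →₀ ℂ

instance : AddCommGroup κ.Pre := inferInstanceAs (AddCommGroup (ι →₀ ℂ))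
instance : Module ℂ κ.Pre := inferInstanceAs (Module ℂ (ι →₀ ℂ))

def form (ξ η : ι →₀ ℂ) : ℂ := ξ.sum fun i c => η.sum fun j d => star c * d * κ.k i j

theorem form_conj (ξ η : ι →₀ ℂ) : star (κ.form ξ η) = κ.form η ξ := by
  unfold form
  rw [Finsupp.sum_comm]
  simp only [Finsupp.sum, star_sum, star_mul', star_star, κ.conj_symm]
  refine Finset.sum_congr rfl fun i _ => Finset.sum_congr rfl fun j _ => by ring

theorem form_add (ξ ξ' η : ι →₀ ℂ) : κ.form (ξ + ξ') η = κ.form ξ η + κ.form ξ' η := by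
  refine Finsupp.sum_add_index' (fun x => by simp) (fun x c c' => ?_)
  rw [← Finsupp.sum_add]
  simp only [star_add, add_mul]

theorem form_smul (ξ η : ι →₀ ℂ) (c : ℂ) : κ.form (c • ξ) η = star c * κ.form ξ η := by
  unfold form
  refine (Finsupp.sum_smul_index (fun x => by simp)).trans ?_
  rw [Finsupp.mul_sum]
  refine Finsupp.sum_congr fun x _ => ?_
  rw [Finsupp.mul_sum]
  simp only [star_mul', mul_assoc]

theorem form_add_right (ξ η η' : ι →₀ ℂ) : κ.form ξ (η + η') = κ.form ξ η + κ.form ξ η' := by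
  rw [← κ.form_conj, form_add, star_add, form_conj, form_conj]

theorem form_smul_right (ξ η : ι →₀ ℂ) (c : ℂ) : κ.form ξ (c • η) = c * κ.form ξ η := by
  rw [← κ.form_conj, form_smul, star_mul', star_star, form_conj]

theorem form_mapDomain (s t : ι → ι) (ξ η : ι →₀ ℂ) :
    κ.form (ξ.mapDomain s) (η.mapDomain t) =
      ξ.sum fun i c => η.sum fun j d => star c * d * κ.k (s i) (t j) := by
  unfold form
  rw [Finsupp.sum_mapDomain_index (fun i => by simp) (fun i c c' => by
    rw [← Finsupp.sum_add]; simp only [star_add, add_mul])]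
  refine Finsupp.sum_congr fun i _ => ?_
  rw [Finsupp.sum_mapDomain_index (fun i => by simp) (fun i c c' => by ring)]

instance core : PreInnerProductSpace.Core ℂ κ.Pre where
  inner := κ.form
  conj_inner_symm ξ η := κ.form_conj η ξ
  re_inner_nonneg ξ := κ.nonneg ξ
  add_left := κ.form_add
  smul_left ξ η c := κ.form_smul ξ η c

instance : SeminormedAddCommGroup κ.Pre :=
  InnerProductSpace.Core.toSeminormedAddCommGroup (c := κ.core)
instance : InnerProductSpace ℂ κ.Pre := InnerProductSpace.ofCore κ.core

/-- The Hilbert space of the kernel. -/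
abbrev Space : Type u := UniformSpace.Completion κ.Pre

def emb : (ι →₀ ℂ) →ₗ[ℂ] κ.Space where
  toFun ξ := ((id ξ : κ.Pre) : κ.Space)
  map_add' ξ η := UniformSpace.Completion.coe_add (id ξ : κ.Pre) (id η : κ.Pre)
  map_smul' c ξ := UniformSpace.Completion.coe_smul c (id ξ : κ.Pre)

theorem inner_emb (ξ η : ι →₀ ℂ) : ⟪κ.emb ξ, κ.emb η⟫_ℂ = κ.form ξ η :=
  UniformSpace.Completion.inner_coe (𝕜 := ℂ) (id ξ : κ.Pre) (id η : κ.Pre)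

theorem form_self_re (ξ : ι →₀ ℂ) : (κ.form ξ ξ).re = ‖κ.emb ξ‖ ^ 2 := by
  rw [← inner_self_eq_norm_sq (𝕜 := ℂ), inner_emb]; rfl

def vec (i : ι) : κ.Space := κ.emb (Finsupp.single i 1)

theorem emb_eq (ξ : ι →₀ ℂ) : κ.emb ξ = ξ.sum fun i c => c • κ.vec i := by
  conv_lhs => rw [← ξ.sum_single]
  rw [Finsupp.sum, map_sum, Finsupp.sum]
  refine Finset.sum_congr rfl fun i _ => ?_
  rw [vec, ← map_smul, Finsupp.smul_single, smul_eq_mul, mul_one]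

theorem inner_vec (i j : ι) : ⟪κ.vec i, κ.vec j⟫_ℂ = κ.k i j := by
  unfold vec
  rw [inner_emb, form, Finsupp.sum_single_index (by simp), Finsupp.sum_single_index (by simp)]
  simp

theorem norm_vec_sq (i : ι) : ‖κ.vec i‖ ^ 2 = (κ.k i i).re := by
  rw [← κ.inner_vec, ← inner_self_eq_norm_sq (𝕜 := ℂ)]; rfl

theorem span_vec_dense : Dense (Submodule.span ℂ (Set.range κ.vec) : Set κ.Space) := by
  refine UniformSpace.Completion.denseRange_coe.mono ?_
  rintro _ ⟨ξ, rfl⟩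
  have h : ∀ η : ι →₀ ℂ, κ.emb η ∈ Submodule.span ℂ (Set.range κ.vec) := fun η => by
    rw [emb_eq]
    exact Submodule.sum_mem _ fun i _ =>
      Submodule.smul_mem _ _ (Submodule.subset_span (Set.mem_range_self i))
  exact h ξ

theorem clm_ext {F : Type*} [NormedAddCommGroup F] [NormedSpace ℂ F] {S T : κ.Space →L[ℂ] F}
    (h : ∀ i, S (κ.vec i) = T (κ.vec i)) : S = T := by
  refine ContinuousLinearMap.ext fun x => ?_
  refine κ.span_vec_dense.induction (P := fun x => S x = T x) (fun y hy => ?_)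
    (isClosed_eq S.continuous T.continuous) x
  induction hy using Submodule.span_induction with
  | mem y hy => obtain ⟨i, rfl⟩ := hy; exact h i
  | zero => simp
  | add y z _ _ h1 h2 => simp [h1, h2]
  | smul c y _ h1 => simp [h1]

theorem eq_of_inner {x y : κ.Space} (h : ∀ i, ⟪κ.vec i, x⟫_ℂ = ⟪κ.vec i, y⟫_ℂ) : x = y := by
  have : innerSL ℂ x = innerSL ℂ y := κ.clm_ext fun i => by
    rw [innerSL_apply_apply, innerSL_apply_apply, ← inner_conj_symm, h, inner_conj_symm]
  refine ext_inner_right ℂ fun z => ?_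
  exact congrArg (fun f => f z) this

/-- The source of all operators on kernel spaces. The estimate on finite combinations also makes the
induced map respect null vectors. -/
theorem exists_op_of_bound (s : ι → ι) {C : ℝ} (hC : 0 ≤ C)
    (h : ∀ ξ : ι →₀ ℂ, (κ.form (ξ.mapDomain s) (ξ.mapDomain s)).re ≤ C ^ 2 * (κ.form ξ ξ).re) :
    ∃ S : κ.Space →L[ℂ] κ.Space, ‖S‖ ≤ C ∧ ∀ i, S (κ.vec i) = κ.vec (s i) := by
  let S₀ : κ.Pre →L[ℂ] κ.Pre := LinearMap.mkContinuous (Finsupp.lmapDomain ℂ ℂ s) C fun ξ => by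
    refine le_of_sq_le_sq ?_ (by positivity)
    rw [mul_pow, ← inner_self_eq_norm_sq (𝕜 := ℂ), ← inner_self_eq_norm_sq (𝕜 := ℂ)]
    exact h ξ
  refine ⟨S₀.completion, ?_, fun i => ?_⟩
  · refine ContinuousLinearMap.opNorm_le_bound _ hC fun x => ?_
    induction x using UniformSpace.Completion.induction_on with
    | hp => exact isClosed_le (by fun_prop) (by fun_prop)
    | ih ξ =>
      simp only [ContinuousLinearMap.completion_apply_coe, UniformSpace.Completion.norm_coe]
      exact (S₀.le_opNorm ξ).trans (by gcongr; exact LinearMap.mkContinuous_norm_le _ hC _)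
  · refine (ContinuousLinearMap.completion_apply_coe S₀ _).trans ?_
    change κ.emb (Finsupp.mapDomain s (Finsupp.single i 1)) = _
    rw [Finsupp.mapDomain_single]
    rfl

theorem adjoint_vec {s s' : ι → ι} (hs : ∀ i j, κ.k (s i) j = κ.k i (s' j))
    {S : κ.Space →L[ℂ] κ.Space} (hS : ∀ i, S (κ.vec i) = κ.vec (s i)) (j : ι) :
    (star S) (κ.vec j) = κ.vec (s' j) := by
  refine κ.eq_of_inner fun i => ?_
  rw [ContinuousLinearMap.star_eq_adjoint, ContinuousLinearMap.adjoint_inner_right, hS, inner_vec,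
    inner_vec, hs]

/-- Maps `s` for which `s' s` is bounded are bounded. -/
theorem exists_op_of_sq (s u : ι → ι) (hs : ∀ i j, κ.k (s i) (s j) = κ.k i (u j))
    {U : κ.Space →L[ℂ] κ.Space} (hU : ∀ i, U (κ.vec i) = κ.vec (u i)) :
    ∃ S : κ.Space →L[ℂ] κ.Space, ‖S‖ ≤ √‖U‖ ∧ ∀ i, S (κ.vec i) = κ.vec (s i) := by
  refine κ.exists_op_of_bound s (Real.sqrt_nonneg _) fun ξ => ?_
  rw [Real.sq_sqrt (norm_nonneg _)]
  set x : κ.Space := κ.emb ξ with hx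
  -- By `hs`, `U` plays the role of `S* S`, so Cauchy–Schwarz bounds `S`.
  have h1 : κ.form (ξ.mapDomain s) (ξ.mapDomain s) = ⟪x, U x⟫_ℂ := by
    rw [form_mapDomain, hx, emb_eq]
    simp only [Finsupp.sum, map_sum, sum_inner, inner_sum, inner_smul_left, inner_smul_right,
      map_smul, hU, inner_vec, hs]
    rw [Finset.sum_comm]
    refine Finset.sum_congr rfl fun j _ => ?_
    rw [Finset.mul_sum]
    refine Finset.sum_congr rfl fun i _ => ?_
    rw [mul_comm (star _), mul_assoc]
    rfl
  rw [h1, form_self_re]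
  calc (⟪x, U x⟫_ℂ).re ≤ ‖⟪x, U x⟫_ℂ‖ := Complex.re_le_norm _
    _ ≤ ‖x‖ * ‖U x‖ := norm_inner_le_norm _ _
    _ ≤ ‖x‖ * (‖U‖ * ‖x‖) := by gcongr; exact U.le_opNorm x
    _ = _ := by ring

/-- The hypothesis expresses `S* S = S`. Then `‖Sx‖² = ⟨x, Sx⟩ ≤ ‖x‖ ‖Sx‖`, and one factor cancels.
-/
theorem exists_op_of_idempotent (s : ι → ι) (hs : ∀ i j, κ.k (s i) (s j) = κ.k i (s j)) :
    ∃ S : κ.Space →L[ℂ] κ.Space, ‖S‖ ≤ 1 ∧ ∀ i, S (κ.vec i) = κ.vec (s i) := by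
  refine κ.exists_op_of_bound s zero_le_one fun ξ => ?_
  have h : κ.form (ξ.mapDomain s) (ξ.mapDomain s) = κ.form ξ (ξ.mapDomain s) := by
    have := κ.form_mapDomain id s ξ ξ
    rw [Finsupp.mapDomain_id] at this
    rw [this, form_mapDomain]
    simp only [hs, id]
  have h2 : ‖κ.emb (ξ.mapDomain s)‖ ^ 2 ≤ ‖κ.emb ξ‖ * ‖κ.emb (ξ.mapDomain s)‖ := by
    rw [← form_self_re, h, ← inner_emb]
    exact (Complex.re_le_norm _).trans (norm_inner_le_norm _ _)
  have h3 : ‖κ.emb (ξ.mapDomain s)‖ ≤ ‖κ.emb ξ‖ := by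
    rcases (norm_nonneg (κ.emb (ξ.mapDomain s))).eq_or_lt with h0 | h0
    · rw [← h0]; exact norm_nonneg _
    · rw [sq] at h2; exact le_of_mul_le_mul_right h2 h0
  rw [one_pow, one_mul, form_self_re, form_self_re]
  gcongr

/-- *-representations of C*-algebras by maps of the index set are contractive. -/
theorem exists_op_of_rep {D : Type*} [NonUnitalCStarAlgebra D] (σ : D → ι → ι)
    (β : ι → ι → D →ₗ[ℂ] ℂ) (hβ : ∀ i j d, κ.k i (σ d j) = β i j d)
    (hmul : ∀ i j d e, κ.k i (σ (d * e) j) = κ.k i (σ d (σ e j)))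
    (hstar : ∀ i j d, κ.k (σ d i) j = κ.k i (σ (star d) j)) (d : D) :
    ∃ S : κ.Space →L[ℂ] κ.Space, ‖S‖ ≤ ‖d‖ ∧ ∀ i, S (κ.vec i) = κ.vec (σ d i) := by
  refine κ.exists_op_of_bound _ (norm_nonneg d) fun ξ => ?_
  -- `F d` is `⟨ξ, σ(d) ξ⟩`. The maps `σ d` only permute indices, so linearity in `d` is available
  -- only after pairing.
  let F : D →ₗ[ℂ] ℂ := ξ.sum fun i c => ξ.sum fun j c' => (star c * c') • β i j
  have hF : ∀ d, κ.form ξ (ξ.mapDomain (σ d)) = F d := fun d => by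
    have := κ.form_mapDomain id (σ d) ξ ξ
    rw [Finsupp.mapDomain_id] at this
    rw [this]
    simp only [F, Finsupp.sum, LinearMap.sum_apply, LinearMap.smul_apply, smul_eq_mul, id, hβ]
  have hF2 : ∀ d e, κ.form (ξ.mapDomain (σ d)) (ξ.mapDomain (σ e)) = F (star d * e) := fun d e => by
    rw [← hF, form_mapDomain]
    have := κ.form_mapDomain id (σ (star d * e)) ξ ξ
    rw [Finsupp.mapDomain_id] at this
    rw [this]
    simp only [id, hmul, hstar]
  have hF3 : ∀ d, κ.form (ξ.mapDomain (σ d)) ξ = F (star d) := fun d => by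
    rw [← hF]
    have h1 := κ.form_mapDomain id (σ (star d)) ξ ξ
    have h2 := κ.form_mapDomain (σ d) id ξ ξ
    rw [Finsupp.mapDomain_id] at h1 h2
    rw [h1, h2]
    simp only [id, hstar]
  let U := Unitization ℂ D
  let _ : PartialOrder U := CStarAlgebra.spectralOrder U
  have _ : StarOrderedRing U := CStarAlgebra.spectralOrderedRing U
  -- In the unitization `‖d‖² - d* d = f* f` with `f = μ + g`. Comparing scalar parts and `D`-parts
  -- gives `e1` and `e2`.
  have hpos : 0 ≤ algebraMap ℝ U (‖d‖ ^ 2) - star (d : U) * d := by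
    rw [sub_nonneg]
    have : ‖d‖ ^ 2 = ‖star (d : U) * d‖ := by
      rw [CStarRing.norm_star_mul_self, Unitization.norm_inr, sq]
    rw [this]
    exact IsSelfAdjoint.le_algebraMap_norm_self
  obtain ⟨f, hf⟩ := CStarAlgebra.nonneg_iff_eq_star_mul_self.1 hpos
  set μ := f.fst with hμ
  set g := f.snd with hg
  have hf' : algebraMap ℝ (Unitization ℂ D) (‖d‖ ^ 2) - star (d : Unitization ℂ D) * d =
    star f * f := hf
  rw [Unitization.algebraMap_eq_inl_comp] at hf'
  have e1 : ((‖d‖ ^ 2 : ℝ) : ℂ) = star μ * μ := by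
    have : ((‖d‖ ^ 2 : ℝ) : ℂ) - star (0 : ℂ) * 0 = star μ * μ :=
      congrArg (fun u : Unitization ℂ D => u.fst) hf'
    simpa using this
  have e2 : -(star d * d) = star μ • g + μ • star g + star g * g := by
    have : 0 - (star (0 : ℂ) • d + (0 : ℂ) • star d + star d * d) =
        star μ • g + μ • star g + star g * g :=
      congrArg (fun u : Unitization ℂ D => u.snd) hf'
    simpa using this
  -- Positivity at `f ξ = μ ξ + σ(g) ξ` is the inequality `0 ≤ ‖d‖² ⟨ξ, ξ⟩ - ⟨σ(d) ξ, σ(d) ξ⟩`.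
  have e3 := κ.nonneg (μ • ξ + ξ.mapDomain (σ g))
  change 0 ≤ (κ.form _ _).re at e3
  rw [form_add, form_add_right, form_add_right, form_smul, form_smul, form_smul_right,
    form_smul_right, hF2, hF3, hF] at e3
  have e4 : star μ * (μ * κ.form ξ ξ) + star μ * F g + (μ * F (star g) + F (star g * g)) =
      ((‖d‖ ^ 2 : ℝ) : ℂ) * κ.form ξ ξ - F (star d * d) := by
    have := congrArg F e2
    rw [map_neg, map_add, map_add, map_smul, map_smul, smul_eq_mul, smul_eq_mul] at this
    rw [sub_eq_add_neg, this, e1]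
    ring
  rw [e4, Complex.sub_re, Complex.re_ofReal_mul] at e3
  rw [hF2]
  linarith

/-- A kernel which is positive on the fibres of a map and vanishes off the fibres is positive. -/
theorem nonneg_of_fibres {β : Type*} (p : ι → β) (k : ι → ι → ℂ)
    (h0 : ∀ i j, p i ≠ p j → k i j = 0)
    (h : ∀ (b : β) (s : Finset ι) (c : ι → ℂ), (∀ i ∈ s, p i = b) →
      0 ≤ (∑ i ∈ s, ∑ j ∈ s, star (c i) * c j * k i j).re) (ξ : ι →₀ ℂ) :
    0 ≤ (ξ.sum fun i c => ξ.sum fun j d => star c * d * k i j).re := by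
  classical
  have e : (ξ.sum fun i c => ξ.sum fun j d => star c * d * k i j) =
      ∑ b ∈ ξ.support.image p, ∑ i ∈ ξ.support with p i = b, ∑ j ∈ ξ.support with p j = b,
        star (ξ i) * ξ j * k i j := by
    rw [Finsupp.sum, ← Finset.sum_fiberwise_of_maps_to (t := ξ.support.image p) (g := p)
      (fun i hi => Finset.mem_image_of_mem _ hi)]
    refine Finset.sum_congr rfl fun b _ => Finset.sum_congr rfl fun i hi => ?_
    rw [Finsupp.sum, Finset.sum_filter]
    refine Finset.sum_congr rfl fun j _ => ?_
    split_ifs with hj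
    · rfl
    · rw [h0 i j (by rw [(Finset.mem_filter.1 hi).2]; exact Ne.symm hj), mul_zero]
  rw [e, Complex.re_sum]
  exact Finset.sum_nonneg fun b _ => h b _ ξ fun i hi => (Finset.mem_filter.1 hi).2

end PosKernel

end
noncomputable section

/-! ### Approximate units of closed *-subalgebras. -/

section ApproximateUnits

variable {B : Type u} [NonUnitalCStarAlgebra B]

/-- `1 - b* b` is a contraction in the unitization. -/
theorem norm_sub_star_mul_self_mul_le {b : B} (hb : ‖star b * b‖ ≤ 1) (z : B) :
    ‖z - star b * b * z‖ ≤ ‖z‖ := by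
  let _ : PartialOrder B := CStarAlgebra.spectralOrder B
  have _ : StarOrderedRing B := CStarAlgebra.spectralOrderedRing B
  refine CStarAlgebra.norm_sub_mul_self_le_of_inr z le_rfl (star_mul_self_nonneg b) hb
    (norm_nonneg z) ?_
  rw [Unitization.inr_zero, sub_zero, mul_one, CStarRing.norm_star_mul_self, Unitization.norm_inr,
    sq]

/-- The form `b* b` records positivity without fixing an order on `B`. -/
theorem exists_approx_unit (N : NonUnitalStarSubalgebra ℂ B) (hN : IsClosed (N : Set B)) {i : B}
    (hi : i ∈ N) {ε : ℝ} (hε : 0 < ε) :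
    ∃ b : B, star b * b ∈ N ∧ ‖star b * b‖ ≤ 1 ∧ ‖i - i * (star b * b)‖ < ε := by
  let _ : NonUnitalCStarAlgebra N :=
    NonUnitalStarSubalgebra.nonUnitalCStarAlgebra N (h_closed := hN)
  let _ : PartialOrder N := CStarAlgebra.spectralOrder N
  have _ : StarOrderedRing N := CStarAlgebra.spectralOrderedRing N
  have h := CStarAlgebra.increasingApproximateUnit N
  have h1 := (Metric.tendsto_nhds.1 (h.tendsto_mul_left ⟨i, hi⟩)) ε hε
  have := h.neBot
  obtain ⟨e, he1, he2, he3⟩ := (h1.and (h.eventually_nonneg.and h.eventually_norm)).exists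
  obtain ⟨b, rfl⟩ := CStarAlgebra.nonneg_iff_eq_star_mul_self.1 he2
  refine ⟨b, (star b * b).2, he3, ?_⟩
  rw [dist_comm, dist_eq_norm] at he1
  exact he1

/-- Only `a* a` has to lie in `N`, since `‖a - a e‖² = ‖(1 - e)(a* a - a* a e)‖ ≤ ‖a* a - a* a e‖`.
-/
theorem exists_approx_right_unit (N : NonUnitalStarSubalgebra ℂ B) (hN : IsClosed (N : Set B))
    {a : B} (ha : star a * a ∈ N) {ε : ℝ} (hε : 0 < ε) : ∃ e ∈ N, ‖a - a * e‖ < ε := by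
  obtain ⟨b, hb1, hb2, hb3⟩ := exists_approx_unit N hN ha (pow_pos hε 2)
  refine ⟨_, hb1, lt_of_pow_lt_pow_left₀ 2 hε.le ?_⟩
  rw [sq, ← CStarRing.norm_star_mul_self]
  refine lt_of_le_of_lt ?_ hb3
  refine le_trans (le_of_eq ?_) (norm_sub_star_mul_self_mul_le hb2 _)
  congr 1
  simp only [star_sub, star_mul, star_star, mul_sub, sub_mul, mul_assoc]
  abel

/-- Closed two-sided ideals of C*-algebras are self-adjoint. -/
theorem star_mem_of_closed_ideal (I : Submodule ℂ B) (hc : IsClosed (I : Set B))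
    (hl : ∀ b, ∀ x ∈ I, b * x ∈ I) (hr : ∀ b, ∀ x ∈ I, x * b ∈ I) {x : B} (hx : x ∈ I) :
    star x ∈ I := by
  -- `N = I ∩ I*` contains `x x*`, so `x* e` approximates `x*` for suitable `e ∈ N`; and `x* e ∈ I`.
  let N : NonUnitalStarSubalgebra ℂ B :=
    { carrier := {y | y ∈ I ∧ star y ∈ I}
      add_mem' := fun h h' => ⟨add_mem h.1 h'.1, by rw [star_add]; exact add_mem h.2 h'.2⟩
      zero_mem' := ⟨zero_mem _, by rw [star_zero]; exact zero_mem _⟩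
      mul_mem' := fun h h' => ⟨hl _ _ h'.1, by rw [star_mul]; exact hl _ _ h.2⟩
      smul_mem' := fun c y h => ⟨I.smul_mem c h.1, by rw [star_smul]; exact I.smul_mem _ h.2⟩
      star_mem' := fun h => ⟨h.2, by rw [star_star]; exact h.1⟩ }
  have hN : IsClosed (N : Set B) := hc.inter (hc.preimage continuous_star)
  refine hc.closure_subset (Metric.mem_closure_iff.2 fun ε hε => ?_)
  obtain ⟨e, he, h⟩ := exists_approx_right_unit (a := star x) N hN
    ⟨hr _ _ (by rwa [star_star]), by
      rw [star_mul, star_star]; exact hr _ _ hx⟩ hε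
  exact ⟨_, hl _ _ he.1, by rwa [dist_eq_norm]⟩

/-- If `b a c` belongs to a closed subspace for all `b` and `c` then so does `a`. -/
theorem mem_of_forall_mul_mul_mem (I : Submodule ℂ B) (hc : IsClosed (I : Set B)) {a : B}
    (h : ∀ b c, b * a * c ∈ I) : a ∈ I := by
  have h1 : ∀ b, b * a ∈ I := fun b => by
    refine hc.closure_subset (Metric.mem_closure_iff.2 fun ε hε => ?_)
    obtain ⟨e, -, he⟩ := exists_approx_right_unit (a := b * a) ⊤ isClosed_univ trivial hε
    exact ⟨_, h b e, by rwa [dist_eq_norm]⟩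
  refine hc.closure_subset (Metric.mem_closure_iff.2 fun ε hε => ?_)
  obtain ⟨e, -, he⟩ := exists_approx_right_unit (a := star a) ⊤ isClosed_univ trivial hε
  refine ⟨_, h1 (star e), ?_⟩
  rw [dist_eq_norm, ← norm_star, star_sub, star_mul, star_star]
  exact he

end ApproximateUnits

/-! ### Quotients of C*-algebras by closed ideals. -/

section Quotient

/-- A closed self-adjoint two-sided ideal of a C*-algebra. -/
structure ClosedStarIdeal (B : Type u) [NonUnitalCStarAlgebra B] where
  space : Submodule ℂ B
  isClosed : IsClosed (space : Set B)
  mul_mem_left : ∀ b, ∀ x ∈ space, b * x ∈ space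
  mul_mem_right : ∀ b, ∀ x ∈ space, x * b ∈ space
  star_mem : ∀ x ∈ space, star x ∈ space

namespace ClosedStarIdeal

variable {B : Type u} [NonUnitalCStarAlgebra B] (I : ClosedStarIdeal B)

/-- The quotient of a C*-algebra by a closed ideal. -/
def Quot : Type u := B ⧸ I.space

instance : IsClosed (I.space : Set B) := I.isClosed
instance : NormedAddCommGroup I.Quot :=
  inferInstanceAs (NormedAddCommGroup (B ⧸ I.space))
instance : NormedSpace ℂ I.Quot := inferInstanceAs (NormedSpace ℂ (B ⧸ I.space))
instance : CompleteSpace I.Quot := inferInstanceAs (CompleteSpace (B ⧸ I.space))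

def toQuot : B →ₗ[ℂ] I.Quot := I.space.mkQ

theorem mk_surjective : Function.Surjective I.toQuot := I.space.mkQ_surjective

theorem mk_eq_mk {x y : B} : I.toQuot x = I.toQuot y ↔ x - y ∈ I.space :=
  Submodule.Quotient.eq I.space

theorem mk_eq_zero {x : B} : I.toQuot x = 0 ↔ x ∈ I.space :=
  Submodule.Quotient.mk_eq_zero I.space

theorem norm_mk_le (x : B) : ‖I.toQuot x‖ ≤ ‖x‖ := Submodule.Quotient.norm_mk_le I.space x

theorem exists_mk_eq (q : I.Quot) {ε : ℝ} (hε : 0 < ε) : ∃ x, I.toQuot x = q ∧ ‖x‖ < ‖q‖ + ε :=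
  Submodule.Quotient.norm_mk_lt (S := I.space) q hε

instance : Mul I.Quot :=
  ⟨Quotient.map₂ (· * ·) (by
    intro a a' ha b b' hb
    refine (Submodule.quotientRel_def _).2 ?_
    have h1 := (Submodule.quotientRel_def _).1 ha
    have h2 := (Submodule.quotientRel_def _).1 hb
    have : a * b - a' * b' = (a - a') * b + a' * (b - b') := by
      rw [sub_mul, mul_sub, sub_add_sub_cancel]
    rw [this]
    exact add_mem (I.mul_mem_right _ _ h1) (I.mul_mem_left _ _ h2))⟩

instance : Star I.Quot :=
  ⟨Quotient.map star (by
    intro a a' ha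
    refine (Submodule.quotientRel_def _).2 ?_
    rw [← star_sub]
    exact I.star_mem _ ((Submodule.quotientRel_def _).1 ha))⟩

theorem mk_mul (x y : B) : I.toQuot (x * y) = I.toQuot x * I.toQuot y := rfl

theorem mk_star (x : B) : I.toQuot (star x) = star (I.toQuot x) := rfl

theorem norm_mul_le' (p q : I.Quot) : ‖p * q‖ ≤ ‖p‖ * ‖q‖ := by
  have h : ∀ ε > 0, ‖p * q‖ ≤ (‖p‖ + ε) * (‖q‖ + ε) := fun ε hε => by
    obtain ⟨x, rfl, hx⟩ := I.exists_mk_eq p hε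
    obtain ⟨y, rfl, hy⟩ := I.exists_mk_eq q hε
    rw [← mk_mul]
    exact (I.norm_mk_le _).trans ((norm_mul_le _ _).trans (by gcongr))
  have hlim : Filter.Tendsto (fun ε : ℝ => (‖p‖ + ε) * (‖q‖ + ε)) (nhdsWithin 0 (Set.Ioi 0))
      (nhds ((‖p‖ + 0) * (‖q‖ + 0))) :=
    (Continuous.tendsto (by fun_prop) 0).mono_left nhdsWithin_le_nhds
  rw [add_zero, add_zero] at hlim
  exact ge_of_tendsto hlim (Filter.eventually_of_mem self_mem_nhdsWithin h)

/-- This is the C*-inequality of the quotient. For `e` in the ideal, `x` and `x(1 - e)` have the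
same class, and `‖x(1 - e)‖² ≤ ‖x* x (1 - e)‖`. With `e` an approximate unit for `i`, the term `i(1
- e)` costs at most `ε`. -/
theorem norm_mk_sq_le (x i : B) (hi : i ∈ I.space) : ‖I.toQuot x‖ * ‖I.toQuot x‖ ≤ ‖star x * x + i‖ := by
  let N : NonUnitalStarSubalgebra ℂ B :=
    { carrier := I.space
      add_mem' := add_mem
      zero_mem' := zero_mem _
      mul_mem' := fun _ h => I.mul_mem_left _ _ h
      smul_mem' := fun c _ h => I.space.smul_mem c h
      star_mem' := fun h => I.star_mem _ h }
  refine le_of_forall_pos_le_add fun ε hε => ?_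
  obtain ⟨b, hb1, hb2, hb3⟩ := exists_approx_unit N I.isClosed hi hε
  set e := star b * b with he
  have hes : star e = e := by simp [he]
  have h1 : I.toQuot x = I.toQuot (x - x * e) := by
    rw [mk_eq_mk, sub_sub_cancel]
    exact I.mul_mem_left _ _ hb1
  set w := star x * x + i with hw
  calc ‖I.toQuot x‖ * ‖I.toQuot x‖ ≤ ‖x - x * e‖ * ‖x - x * e‖ := by
        rw [h1]; gcongr <;> exact I.norm_mk_le _
    _ = ‖star (x - x * e) * (x - x * e)‖ := (CStarRing.norm_star_mul_self).symm
    _ = ‖(star x * x - star x * x * e) - e * (star x * x - star x * x * e)‖ := by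
        congr 1
        simp only [star_sub, star_mul, hes, mul_sub, sub_mul, mul_assoc]
        abel
    _ ≤ ‖star x * x - star x * x * e‖ := norm_sub_star_mul_self_mul_le hb2 _
    _ = ‖(w - w * e) - (i - i * e)‖ := by
        congr 1
        rw [hw, add_mul]; abel
    _ ≤ ‖w - w * e‖ + ‖i - i * e‖ := norm_sub_le _ _
    _ ≤ ‖w‖ + ε := by
        refine add_le_add ?_ hb3.le
        rw [← norm_star, star_sub, star_mul, hes, ← norm_star w]
        exact norm_sub_star_mul_self_mul_le hb2 _

instance : NonUnitalNormedRing I.Quot :=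
  { (inferInstance : NormedAddCommGroup I.Quot), (inferInstance : Mul I.Quot) with
    left_distrib := fun p q r => by
      obtain ⟨x, rfl⟩ := I.mk_surjective p
      obtain ⟨y, rfl⟩ := I.mk_surjective q
      obtain ⟨z, rfl⟩ := I.mk_surjective r
      simp only [← mk_mul, ← map_add, mul_add]
    right_distrib := fun p q r => by
      obtain ⟨x, rfl⟩ := I.mk_surjective p
      obtain ⟨y, rfl⟩ := I.mk_surjective q
      obtain ⟨z, rfl⟩ := I.mk_surjective r
      simp only [← mk_mul, ← map_add, add_mul]
    zero_mul := fun p => by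
      obtain ⟨x, rfl⟩ := I.mk_surjective p
      rw [← map_zero I.toQuot, ← mk_mul, zero_mul]
    mul_zero := fun p => by
      obtain ⟨x, rfl⟩ := I.mk_surjective p
      rw [← map_zero I.toQuot, ← mk_mul, mul_zero]
    mul_assoc := fun p q r => by
      obtain ⟨x, rfl⟩ := I.mk_surjective p
      obtain ⟨y, rfl⟩ := I.mk_surjective q
      obtain ⟨z, rfl⟩ := I.mk_surjective r
      simp only [← mk_mul, mul_assoc]
    norm_mul_le := I.norm_mul_le' }

instance : NonUnitalCStarAlgebra I.Quot :=
  { (inferInstance : NonUnitalNormedRing I.Quot), (inferInstance : NormedSpace ℂ I.Quot),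
    (inferInstance : CompleteSpace I.Quot), (inferInstance : Star I.Quot) with
    star_involutive := fun p => by
      obtain ⟨x, rfl⟩ := I.mk_surjective p
      rw [← mk_star, ← mk_star, star_star]
    star_mul := fun p q => by
      obtain ⟨x, rfl⟩ := I.mk_surjective p
      obtain ⟨y, rfl⟩ := I.mk_surjective q
      rw [← mk_mul, ← mk_star, star_mul]; rfl
    star_add := fun p q => by
      obtain ⟨x, rfl⟩ := I.mk_surjective p
      obtain ⟨y, rfl⟩ := I.mk_surjective q
      rw [← map_add, ← mk_star, star_add, map_add]; rfl
    norm_mul_self_le := fun p => by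
      refine le_of_forall_pos_le_add fun ε hε => ?_
      obtain ⟨x, rfl⟩ := I.mk_surjective p
      obtain ⟨y, hy, hy'⟩ := I.exists_mk_eq (star (I.toQuot x) * I.toQuot x) hε
      rw [← mk_star, ← mk_mul, mk_eq_mk] at hy
      have := I.norm_mk_sq_le x _ hy
      rw [add_sub_cancel] at this
      exact this.trans hy'.le
    smul_assoc := fun c p q => by
      obtain ⟨x, rfl⟩ := I.mk_surjective p
      obtain ⟨y, rfl⟩ := I.mk_surjective q
      change (c • I.toQuot x) * I.toQuot y = c • (I.toQuot x * I.toQuot y)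
      rw [← map_smul, ← mk_mul, ← mk_mul, ← map_smul, smul_mul_assoc]
    smul_comm := fun c p q => by
      obtain ⟨x, rfl⟩ := I.mk_surjective p
      obtain ⟨y, rfl⟩ := I.mk_surjective q
      change c • (I.toQuot x * I.toQuot y) = I.toQuot x * (c • I.toQuot y)
      rw [← map_smul, ← mk_mul, ← mk_mul, ← map_smul, mul_smul_comm]
    star_smul := fun c p => by
      obtain ⟨x, rfl⟩ := I.mk_surjective p
      rw [← map_smul, ← mk_star, star_smul, map_smul]; rfl }

end ClosedStarIdeal

end Quotient

/-! ### Projection to a spectral subspace by averaging over roots of unity. -/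

section Averaging

variable {B : Type*} [NormedAddCommGroup B] [NormedSpace ℂ B]

/-- An element of degree `k` for an action of the circle belongs to the closed homogeneous subspace
`N k` when the homogeneous subspaces span a dense subspace. -/
theorem mem_of_spectral (γ : Circle → B →ₗ[ℂ] B) (hγ : ∀ z x, ‖γ z x‖ ≤ ‖x‖)
    (N : ℤ → Submodule ℂ B) (hN : ∀ d, ∀ x ∈ N d, ∀ z, γ z x = (z : ℂ) ^ d • x)
    (hd : ∀ x, x ∈ closure ((⨆ d, N d : Submodule ℂ B) : Set B)) {k : ℤ}
    (hk : IsClosed (N k : Set B)) {x : B} (hx : ∀ z, γ z x = (z : ℂ) ^ k • x) : x ∈ N k := by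
  -- Averaging over the `n`-th roots of unity replaces the integral over the circle, so no
  -- continuity of `z ↦ γ z x` is needed.
  let ζ : ℕ → Circle := fun n => Circle.exp (2 * Real.pi / n)
  have hζ : ∀ n : ℕ, n ≠ 0 → IsPrimitiveRoot (ζ n : ℂ) n := fun n hn => by
    have := Complex.isPrimitiveRoot_exp n hn
    convert this using 1
    simp only [ζ, Circle.coe_exp]
    congr 1
    push_cast
    ring
  let E : ℕ → B →ₗ[ℂ] B := fun n =>
    (n : ℂ)⁻¹ • ∑ l ∈ Finset.range n, (ζ n : ℂ) ^ (-(k * l)) • γ (ζ n ^ l)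
  have hE : ∀ n x, E n x = (n : ℂ)⁻¹ • ∑ l ∈ Finset.range n, (ζ n : ℂ) ^ (-(k * l)) • γ (ζ n ^ l) x :=
    fun n x => by
      simp only [E, LinearMap.smul_apply, LinearMap.sum_apply]
  have hEhom : ∀ n : ℕ, n ≠ 0 → ∀ d x, (∀ z, γ z x = (z : ℂ) ^ d • x) →
      E n x = ((n : ℂ)⁻¹ * ∑ l ∈ Finset.range n, ((ζ n : ℂ) ^ (d - k)) ^ l) • x := by
    intro n hn d x h
    rw [hE, mul_smul, Finset.sum_smul]
    congr 1
    refine Finset.sum_congr rfl fun l _ => ?_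
    rw [h, smul_smul, Circle.coe_pow, ← zpow_natCast (ζ n : ℂ) l, ← zpow_mul,
      ← zpow_add₀ (ζ n).coe_ne_zero, ← zpow_natCast _ l, ← zpow_mul]
    congr 2
    ring
  have hEk : ∀ n : ℕ, n ≠ 0 → ∀ x, (∀ z, γ z x = (z : ℂ) ^ k • x) → E n x = x := by
    intro n hn x h
    rw [hEhom n hn k x h]
    simp [hn]
  -- The geometric sum with ratio `ζ^(d-k)` vanishes unless `n` divides `d - k`, which `0 < |d - k|
  -- < n` excludes.
  have hE0 : ∀ n : ℕ, n ≠ 0 → ∀ d, d ≠ k → (d - k).natAbs < n → ∀ x,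
      (∀ z, γ z x = (z : ℂ) ^ d • x) → E n x = 0 := by
    intro n hn d hdk hlt x h
    have h1 : (ζ n : ℂ) ^ (d - k) ≠ 1 := fun h1 => by
      have h2 := ((hζ n hn).zpow_eq_one_iff_dvd _).1 h1
      have h3 := Int.natAbs_dvd_natAbs.2 h2
      rw [Int.natAbs_natCast] at h3
      exact absurd (Nat.le_of_dvd (Int.natAbs_pos.2 (sub_ne_zero.2 hdk)) h3) (not_le.2 hlt)
    have h2 : ((ζ n : ℂ) ^ (d - k)) ^ n = 1 := by
      rw [← zpow_natCast, zpow_comm, zpow_natCast, (hζ n hn).pow_eq_one, one_zpow]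
    rw [hEhom n hn d x h, geom_sum_eq h1, h2]
    simp
  have hEn : ∀ n : ℕ, n ≠ 0 → ∀ x, ‖E n x‖ ≤ ‖x‖ := by
    intro n hn x
    rw [hE, norm_smul, norm_inv, Complex.norm_natCast, inv_mul_le_iff₀ (by positivity)]
    refine (norm_sum_le _ _).trans ?_
    calc _ ≤ ∑ l ∈ Finset.range n, ‖x‖ := Finset.sum_le_sum fun l _ => by
          rw [norm_smul, norm_zpow, Circle.norm_coe, one_zpow, one_mul]
          exact hγ _ _
      _ = _ := by simp
  -- On a finite sum of homogeneous elements the averages are eventually constant, equal to a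
  -- component in `N k`.
  have hspan : ∀ y ∈ (⨆ d, N d : Submodule ℂ B), ∃ M : ℕ, ∃ w ∈ N k, ∀ n : ℕ, M < n → E n y = w := by
    intro y hy
    induction hy using Submodule.iSup_induction' with
    | mem d y hy =>
      by_cases hdk : d = k
      · subst hdk
        exact ⟨0, y, hy, fun n hn => hEk n hn.ne' y (hN _ y hy)⟩
      · exact ⟨(d - k).natAbs, 0, zero_mem _, fun n hn =>
          hE0 n (by omega) d hdk hn y (hN _ y hy)⟩
    | zero => exact ⟨0, 0, zero_mem _, fun n _ => map_zero _⟩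
    | add y y' _ _ h h' =>
      obtain ⟨M, w, hw, h⟩ := h
      obtain ⟨M', w', hw', h'⟩ := h'
      exact ⟨max M M', w + w', add_mem hw hw', fun n hn => by
        rw [map_add, h n (by omega), h' n (by omega)]⟩
  refine hk.closure_subset (Metric.mem_closure_iff.2 fun ε hε => ?_)
  obtain ⟨y, hy, hxy⟩ := Metric.mem_closure_iff.1 (hd x) ε hε
  obtain ⟨M, w, hw, hM⟩ := hspan y hy
  refine ⟨w, hw, ?_⟩
  have h1 := hM (M + 1) (Nat.lt_succ_self M)
  rw [dist_eq_norm] at hxy ⊢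
  calc ‖x - w‖ = ‖E (M + 1) (x - y)‖ := by rw [map_sub, h1, hEk _ (Nat.succ_ne_zero M) x hx]
    _ ≤ ‖x - y‖ := hEn _ (Nat.succ_ne_zero M) _
    _ < ε := hxy

end Averaging

/-! ### Total sets in universal C*-algebras. -/

namespace CStarRelations

variable {G : Type u} (R : CStarRelations G)

theorem mem_of_generators (S : NonUnitalStarSubalgebra ℂ R.Universal)
    (hS : IsClosed (S : Set R.Universal)) (h : ∀ g, R.ι g ∈ S) (x : R.Universal) : x ∈ S := by
  have hcl : IsClosed ((S.map R.incl : NonUnitalStarSubalgebra ℂ R.Product) : Set R.Product) := by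
    have hemb : Topology.IsClosedEmbedding R.incl :=
      (NonUnitalStarSubalgebra.isClosed_topologicalClosure _).isClosedEmbedding_subtypeVal
    exact hemb.isClosedMap _ hS
  have hsub : R.subalg ≤ S.map R.incl := by
    refine NonUnitalStarSubalgebra.topologicalClosure_minimal _ ?_ hcl
    refine NonUnitalStarAlgebra.adjoin_le ?_
    rintro _ ⟨g, rfl⟩
    exact ⟨R.ι g, h g, rfl⟩
  obtain ⟨y, h1, h2⟩ := hsub x.2
  have : y = x := Subtype.ext h2
  exact this ▸ h1

/-- A set containing the generators which is closed under products and adjoints is total. -/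
theorem mem_closure_span (W : Set R.Universal) (hι : ∀ g, R.ι g ∈ W)
    (hmul : ∀ x ∈ W, ∀ y ∈ W, x * y ∈ W) (hstar : ∀ x ∈ W, star x ∈ W) (x : R.Universal) :
    x ∈ closure (Submodule.span ℂ W : Set R.Universal) := by
  let S : NonUnitalStarSubalgebra ℂ R.Universal :=
    { carrier := Submodule.span ℂ W
      add_mem' := add_mem
      zero_mem' := zero_mem _
      smul_mem' := fun c _ h => Submodule.smul_mem _ c h
      mul_mem' := fun {a b} ha hb => by
        have ha' : a ∈ Submodule.span ℂ W := ha
        have hb' : b ∈ Submodule.span ℂ W := hb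
        induction ha', hb' using Submodule.span_induction₂ with
        | mem_mem x y hx hy => exact Submodule.subset_span (hmul x hx y hy)
        | zero_left y hy => rw [zero_mul]; exact zero_mem _
        | zero_right y hy => rw [mul_zero]; exact zero_mem _
        | add_left x y z _ _ _ h1 h2 => rw [add_mul]; exact add_mem (h1 ‹_› ‹_›) (h2 ‹_› ‹_›)
        | add_right x y z _ _ _ h1 h2 => rw [mul_add]; exact add_mem (h1 ‹_› ‹_›) (h2 ‹_› ‹_›)
        | smul_left c x y _ _ h => rw [smul_mul_assoc]; exact Submodule.smul_mem _ c (h ‹_› ‹_›)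
        | smul_right c x y _ _ h => rw [mul_smul_comm]; exact Submodule.smul_mem _ c (h ‹_› ‹_›)
      star_mem' := fun {a} ha => by
        have ha' : a ∈ Submodule.span ℂ W := ha
        induction ha' using Submodule.span_induction with
        | mem x hx => exact Submodule.subset_span (hstar x hx)
        | zero => rw [star_zero]; exact zero_mem _
        | add x y _ _ h1 h2 => rw [star_add]; exact add_mem (h1 ‹_›) (h2 ‹_›)
        | smul c x _ h => rw [star_smul]; exact Submodule.smul_mem _ _ (h ‹_›) }
  exact R.mem_of_generators S.topologicalClosure
    (NonUnitalStarSubalgebra.isClosed_topologicalClosure _)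
    (fun g => NonUnitalStarSubalgebra.le_topologicalClosure _ (Submodule.subset_span (hι g))) x

end CStarRelations

end
-- Quotients of idealizers and calculus in a precategory.
noncomputable section

open scoped InnerProductSpace

/-- A closed *-subalgebra is an ideal of its idealizer, and one can pass to the quotient. -/
theorem exists_quotient_idealizer {B : Type u} [NonUnitalCStarAlgebra B] (I : Submodule ℂ B)
    (hc : IsClosed (I : Set B)) (hstar : ∀ x ∈ I, star x ∈ I) :
    ∃ (C : Type u) (_ : NonUnitalCStarAlgebra C) (N : NonUnitalStarSubalgebra ℂ B)
      (f : N →⋆ₙₐ[ℂ] C), (∀ x, x ∈ N ↔ ∀ y ∈ I, x * y ∈ I ∧ y * x ∈ I) ∧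
        ∀ x : N, f x = 0 ↔ (x : B) ∈ I := by
  let N : NonUnitalStarSubalgebra ℂ B :=
    { carrier := {x | ∀ y ∈ I, x * y ∈ I ∧ y * x ∈ I}
      add_mem' := fun h h' y hy => by
        rw [add_mul, mul_add]
        exact ⟨add_mem (h y hy).1 (h' y hy).1, add_mem (h y hy).2 (h' y hy).2⟩
      zero_mem' := fun y _ => by rw [zero_mul, mul_zero]; exact ⟨zero_mem _, zero_mem _⟩
      mul_mem' := fun h h' y hy => by
        rw [mul_assoc, ← mul_assoc y]
        exact ⟨(h _ (h' y hy).1).1, (h' _ (h y hy).2).2⟩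
      smul_mem' := fun c x h y hy => by
        rw [smul_mul_assoc, mul_smul_comm]
        exact ⟨I.smul_mem c (h y hy).1, I.smul_mem c (h y hy).2⟩
      star_mem' := fun {x} h y hy => by
        have := h _ (hstar y hy)
        refine ⟨?_, ?_⟩
        · rw [← star_star y, ← star_mul]; exact hstar _ this.2
        · rw [← star_star y, ← star_mul]; exact hstar _ this.1 }
  have hN : IsClosed (N : Set B) := by
    have : (N : Set B) = ⋂ y ∈ I, {x | x * y ∈ I} ∩ {x | y * x ∈ I} := by
      ext x; simp only [Set.mem_iInter]; rfl
    rw [this]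
    exact isClosed_biInter fun y _ =>
      (hc.preimage (continuous_mul_const y)).inter (hc.preimage (continuous_const_mul y))
  let _ : NonUnitalCStarAlgebra N :=
    NonUnitalStarSubalgebra.nonUnitalCStarAlgebra N (h_closed := hN)
  -- The ideal divided out is `I ∩ N`. Neither `I ⊂ N` nor closure of `I` under products is
  -- required.
  let Q : ClosedStarIdeal N :=
    { space :=
        { carrier := {x | (x : B) ∈ I}
          add_mem' := fun h h' => add_mem (S := Submodule ℂ B) (s := I) h h'
          zero_mem' := zero_mem I
          smul_mem' := fun c _ h => I.smul_mem c h }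
      isClosed := hc.preimage continuous_subtype_val
      mul_mem_left := fun b x hx => (b.2 _ hx).1
      mul_mem_right := fun b x hx => (b.2 _ hx).2
      star_mem := fun x hx => hstar _ hx }
  let f : N →⋆ₙₐ[ℂ] Q.Quot :=
    { toFun := Q.toQuot
      map_smul' := fun c x => map_smul Q.toQuot c x
      map_zero' := map_zero Q.toQuot
      map_add' := fun x y => map_add Q.toQuot x y
      map_mul' := fun x y => Q.mk_mul x y
      map_star' := fun x => Q.mk_star x }
  exact ⟨Q.Quot, inferInstance, N, f, fun x => Iff.rfl, fun x => Q.mk_eq_zero⟩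

namespace RightTensorCStarPrecategory

variable (T : RightTensorCStarPrecategory.{u})

/-- The ideal of all morphisms. -/
def topIdeal : T.Ideal where
  space _ _ := ⊤
  isClosed _ _ := isClosed_univ
  comp_mem_left _ _ _ := trivial
  comp_mem_right _ _ := trivial
  adj_mem _ := trivial

variable {T}

theorem comp_zero {l n m : ℕ} (a : T.Hom n m) : T.comp a (0 : T.Hom l n) = 0 := map_zero _

theorem zero_comp {l n m : ℕ} (b : T.Hom l n) : T.comp (0 : T.Hom n m) b = 0 :=
  LinearMap.map_zero₂ _ _

theorem norm_adj {n m : ℕ} (a : T.Hom n m) : ‖T.adj a‖ = ‖a‖ := by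
  have h : ∀ {n m : ℕ} (a : T.Hom n m), ‖a‖ ≤ ‖T.adj a‖ := fun a => by
    rcases (norm_nonneg a).eq_or_lt with h0 | h0
    · rw [← h0]; exact norm_nonneg _
    · have h1 := T.norm_comp_le (T.adj a) a
      rw [T.norm_adj_comp_self, sq] at h1
      exact le_of_mul_le_mul_right h1 h0
  refine le_antisymm ?_ (h a)
  have := h (T.adj a)
  rwa [T.adj_adj] at this

theorem eq_zero_of_adj_comp_self {n m : ℕ} {a : T.Hom n m} (h : T.comp (T.adj a) a = 0) :
    a = 0 := by
  have := T.norm_adj_comp_self a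
  rw [h, norm_zero] at this
  exact norm_eq_zero.1 (pow_eq_zero_iff two_ne_zero |>.1 this.symm)

theorem tensorPow_succ (k : ℕ) {n m : ℕ} (a : T.Hom n m) :
    tensorPow (k + 1) a = T.tensor (tensorPow k a) := rfl

theorem tensorPow_comp (k : ℕ) {l n m : ℕ} (a : T.Hom n m) (b : T.Hom l n) :
    tensorPow k (T.comp a b) = T.comp (tensorPow k a) (tensorPow k b) := by
  induction k with
  | zero => rfl
  | succ k ih => rw [tensorPow_succ, ih, T.tensor_comp]; rfl

theorem tensorPow_adj (k : ℕ) {n m : ℕ} (a : T.Hom n m) :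
    tensorPow k (T.adj a) = T.adj (tensorPow k a) := by
  induction k with
  | zero => rfl
  | succ k ih => rw [tensorPow_succ, ih, T.tensor_adj]; rfl

theorem tensor_heq {n n' m m' : ℕ} (hn : n = n') (hm : m = m') {a : T.Hom n m} {a' : T.Hom n' m'}
    (h : HEq a a') : HEq (T.tensor a) (T.tensor a') := by
  subst hn; subst hm; rw [eq_of_heq h]

theorem comp_heq {l n n' m m' : ℕ} (hn : n = n') (hm : m = m') {a : T.Hom n m} {a' : T.Hom n' m'}
    (h : HEq a a') {b : T.Hom l n} {b' : T.Hom l n'} (h' : HEq b b') :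
    HEq (T.comp a b) (T.comp a' b') := by
  subst hn; subst hm; rw [eq_of_heq h, eq_of_heq h']

/-- Heterogeneous equality appears because the objects `n + k + j` and `n + (k + j)` agree only by
associativity of addition. -/
theorem tensorPow_tensorPow (k j : ℕ) {n m : ℕ} (a : T.Hom n m) :
    HEq (tensorPow j (tensorPow k a)) (tensorPow (k + j) a) := by
  induction j with
  | zero => rfl
  | succ j ih => exact tensor_heq (Nat.add_assoc _ _ _) (Nat.add_assoc _ _ _) ih

/-! ### The Fock representation of a right tensor C*-precategory. -/

section Fock

variable (T)

/-- A starting object together with a positive functional on its endomorphisms. -/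
abbrev FockBase : Type u := Σ k : ℕ, PosFunctional (Diag T.topIdeal k)

/-- The vectors `x ⊗ ω` of the Fock space: morphisms `x` out of the base. -/
abbrev FockIndex : Type u := Σ b : T.FockBase × ℕ, T.Hom b.1.1 b.2

variable {T}

/-- Endomorphisms as elements of the C*-algebra of all endomorphisms. -/
def toDiag (k : ℕ) : T.Hom k k →ₗ[ℂ] Diag T.topIdeal k where
  toFun x := ⟨x, Submodule.mem_top⟩
  map_add' _ _ := rfl
  map_smul' _ _ := rfl

theorem star_toDiag {k : ℕ} (x : T.Hom k k) : star (toDiag k x) = toDiag k (T.adj x) := rfl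

theorem toDiag_mul {k : ℕ} (x y : T.Hom k k) :
    toDiag k x * toDiag k y = toDiag k (T.comp x y) := rfl

theorem norm_toDiag {k : ℕ} (x : T.Hom k k) : ‖toDiag k x‖ = ‖x‖ := rfl

/-- The GNS form of `ω`, extended from endomorphisms of the base object to all morphisms out of it.
Positivity is where `a* a ≥ 0` in `T(n,n)` enters. -/
def fockPair (w : T.FockBase) {j : ℕ} (x y : T.Hom w.1 j) : ℂ :=
  w.2.toCLM (toDiag w.1 (T.comp (T.adj x) y))

def fockPairₗ (w : T.FockBase) (j : ℕ) : T.Hom w.1 j →ₗ⋆[ℂ] T.Hom w.1 j →ₗ[ℂ] ℂ :=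
  LinearMap.mk₂'ₛₗ (starRingEnd ℂ) (RingHom.id ℂ) (fockPair w)
    (fun x x' y => by simp only [fockPair, map_add, LinearMap.add_apply])
    (fun c x y => by
      simp only [fockPair, LinearMap.map_smulₛₗ, LinearMap.smul_apply, map_smul])
    (fun x y y' => by simp only [fockPair, map_add])
    (fun c x y => by simp only [fockPair, map_smul, RingHom.id_apply])

theorem fockPair_self_nonneg (w : T.FockBase) {j : ℕ} (x : T.Hom w.1 j) :
    0 ≤ (fockPair w x x).re := by
  obtain ⟨b, hb⟩ := T.adj_comp_self_pos x
  have := w.2.nonneg (toDiag w.1 b)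
  rwa [star_toDiag, toDiag_mul, ← hb] at this

theorem star_fockPair (w : T.FockBase) {j : ℕ} (x y : T.Hom w.1 j) :
    star (fockPair w x y) = fockPair w y x := by
  unfold fockPair
  rw [← w.2.map_star, star_toDiag, T.adj_comp, T.adj_adj]

theorem fockPair_comp_left (w : T.FockBase) {j l : ℕ} (a : T.Hom j l) (x : T.Hom w.1 j)
    (y : T.Hom w.1 l) : fockPair w (T.comp a x) y = fockPair w x (T.comp (T.adj a) y) := by
  unfold fockPair
  rw [T.adj_comp, T.comp_assoc]

open Classical in
def fockKernelFun (i i' : T.FockIndex) : ℂ :=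
  if h : i.1 = i'.1 then fockPair i'.1.1 (h ▸ i.2) i'.2 else 0

theorem fockKernelFun_same (b : T.FockBase × ℕ) (x y : T.Hom b.1.1 b.2) :
    fockKernelFun ⟨b, x⟩ ⟨b, y⟩ = fockPair b.1 x y := dif_pos rfl

theorem fockKernelFun_ne {i i' : T.FockIndex} (h : i.1 ≠ i'.1) : fockKernelFun i i' = 0 := dif_neg h

variable (T) in
/-- The kernel of the Fock space. -/
def fockKernel : PosKernel T.FockIndex where
  k := fockKernelFun
  conj_symm := by
    rintro ⟨b, x⟩ ⟨b', y⟩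
    by_cases h : b = b'
    · subst h
      rw [fockKernelFun_same, fockKernelFun_same, star_fockPair]
    · rw [fockKernelFun_ne h, fockKernelFun_ne (Ne.symm h), star_zero]
  nonneg := by
    refine PosKernel.nonneg_of_fibres Sigma.fst _ (fun i j h => fockKernelFun_ne h) ?_
    intro b s c hs
    classical
    let X : T.FockIndex → T.Hom b.1.1 b.2 := fun i => if h : i.1 = b then h ▸ i.2 else 0
    have h1 : ∀ i ∈ s, ∀ j ∈ s, fockKernelFun i j = fockPairₗ b.1 b.2 (X i) (X j) := by
      rintro ⟨bi, x⟩ hi ⟨bj, y⟩ hj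
      obtain rfl : b = bi := (hs _ hi).symm
      obtain rfl : b = bj := (hs _ hj).symm
      have e1 : X ⟨b, x⟩ = x := dif_pos rfl
      have e2 : X ⟨b, y⟩ = y := dif_pos rfl
      rw [e1, e2, fockKernelFun_same]
      rfl
    have h2 : ∑ i ∈ s, ∑ j ∈ s, star (c i) * c j * fockKernelFun i j =
        fockPairₗ b.1 b.2 (∑ i ∈ s, c i • X i) (∑ i ∈ s, c i • X i) := by
      simp only [map_sum, LinearMap.sum_apply, LinearMap.map_smulₛₗ, LinearMap.smul_apply,
        smul_eq_mul, RingHom.id_apply]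
      rw [Finset.sum_comm]
      refine Finset.sum_congr rfl fun j hj => ?_
      rw [Finset.mul_sum]
      refine Finset.sum_congr rfl fun i hi => ?_
      rw [h1 i hi j hj, mul_comm (star (c i)), mul_assoc]
      rfl
    rw [h2]
    exact fockPair_self_nonneg _ _

variable (T) in
abbrev FockSpace : Type u := T.fockKernel.Space

/-- The vector of the Fock space given by a morphism out of the base. -/
def fockVec (w : T.FockBase) (p : ℕ) : T.Hom w.1 p →ₗ[ℂ] T.FockSpace where
  toFun x := T.fockKernel.vec ⟨(w, p), x⟩
  map_add' x y := T.fockKernel.eq_of_inner fun ⟨b, z⟩ => by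
    rw [inner_add_right, PosKernel.inner_vec, PosKernel.inner_vec, PosKernel.inner_vec]
    change fockKernelFun _ _ = fockKernelFun _ _ + fockKernelFun _ _
    by_cases h : b = (w, p)
    · subst h
      rw [fockKernelFun_same, fockKernelFun_same, fockKernelFun_same]
      exact map_add (fockPairₗ w p z) x y
    · rw [fockKernelFun_ne h, fockKernelFun_ne h, fockKernelFun_ne h, add_zero]
  map_smul' c x := T.fockKernel.eq_of_inner fun ⟨b, z⟩ => by
    rw [RingHom.id_apply, inner_smul_right, PosKernel.inner_vec, PosKernel.inner_vec]
    change fockKernelFun _ _ = _ * fockKernelFun _ _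
    by_cases h : b = (w, p)
    · subst h
      rw [fockKernelFun_same, fockKernelFun_same]
      exact map_smul (fockPairₗ w p z) c x
    · rw [fockKernelFun_ne h, fockKernelFun_ne h, mul_zero]

theorem vec_eq_fockVec (w : T.FockBase) (p : ℕ) (x : T.Hom w.1 p) :
    T.fockKernel.vec ⟨(w, p), x⟩ = fockVec w p x := rfl

theorem norm_fockVec_sq (w : T.FockBase) (p : ℕ) (x : T.Hom w.1 p) :
    ‖fockVec w p x‖ ^ 2 = (fockPair w x x).re := by
  rw [← vec_eq_fockVec, PosKernel.norm_vec_sq]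
  exact congrArg Complex.re (fockKernelFun_same _ _ _)

theorem kernel_zero_right (i : T.FockIndex) (b : T.FockBase × ℕ) :
    T.fockKernel.k i ⟨b, 0⟩ = 0 := by
  rw [← PosKernel.inner_vec, vec_eq_fockVec b.1 b.2 0, map_zero, inner_zero_right]

theorem kernel_zero_left (i : T.FockIndex) (b : T.FockBase × ℕ) :
    T.fockKernel.k ⟨b, 0⟩ i = 0 := by
  rw [← T.fockKernel.conj_symm, kernel_zero_right, star_zero]

theorem fockVec_heq (w : T.FockBase) {p p' : ℕ} (h : p = p') {x : T.Hom w.1 p} {x' : T.Hom w.1 p'}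
    (hx : HEq x x') : fockVec w p x = fockVec w p' x' := by
  subst h; rw [eq_of_heq hx]

theorem fock_ext {S S' : T.FockSpace →L[ℂ] T.FockSpace}
    (h : ∀ w p (x : T.Hom w.1 p), S (fockVec w p x) = S' (fockVec w p x)) : S = S' :=
  T.fockKernel.clm_ext fun i => h i.1.1 i.1.2 i.2

/-- The action of `a` on the index set by `x ↦ (a ⊗ 1^j) x`. -/
def fockAct {m n : ℕ} (a : T.Hom m n) (i : T.FockIndex) : T.FockIndex :=
  if h : m ≤ i.1.2 then
    ⟨(i.1.1, n + (i.1.2 - m)), T.comp (tensorPow (i.1.2 - m) a)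
      ((Nat.add_sub_of_le h).symm ▸ i.2 : T.Hom i.1.1.1 (m + (i.1.2 - m)))⟩
  else ⟨i.1, 0⟩

theorem fockAct_add {m n : ℕ} (a : T.Hom m n) (w : T.FockBase) (j : ℕ) (x : T.Hom w.1 (m + j)) :
    fockAct a ⟨(w, m + j), x⟩ = ⟨(w, n + j), T.comp (tensorPow j a) x⟩ := by
  have h : ∀ (j' : ℕ) (h : m + j = m + j'),
      (⟨(w, n + j'), T.comp (tensorPow j' a) (h ▸ x : T.Hom w.1 (m + j'))⟩ : T.FockIndex) =
        ⟨(w, n + j), T.comp (tensorPow j a) x⟩ := by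
    intro j' h
    obtain rfl : j = j' := by omega
    rfl
  exact (dif_pos (Nat.le_add_right m j)).trans (h _ _)

theorem fockAct_lt {m n : ℕ} (a : T.Hom m n) (w : T.FockBase) {p : ℕ} (hp : p < m)
    (x : T.Hom w.1 p) : fockAct a ⟨(w, p), x⟩ = ⟨(w, p), 0⟩ := dif_neg (not_le.2 hp)

/-- Both sides vanish unless the bases agree and `i`, `i'` sit equally far above `m` and `n`. In
that case the reason is `(a ⊗ 1^j)* = a* ⊗ 1^j`. -/
theorem kernel_fockAct {m n : ℕ} (a : T.Hom m n) (i i' : T.FockIndex) :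
    T.fockKernel.k (fockAct a i) i' = T.fockKernel.k i (fockAct (T.adj a) i') := by
  obtain ⟨⟨w, p⟩, x⟩ := i
  obtain ⟨⟨w', p'⟩, y⟩ := i'
  rcases lt_or_ge p m with hp | hp
  · rw [fockAct_lt a w hp, kernel_zero_left]
    rcases lt_or_ge p' n with hp' | hp'
    · rw [fockAct_lt _ w' hp', kernel_zero_right]
    · obtain ⟨j', rfl⟩ := Nat.exists_eq_add_of_le hp'
      rw [fockAct_add]
      exact (fockKernelFun_ne fun h => by
        have := congrArg Prod.snd h
        simp only at this; omega).symm
  · obtain ⟨j, rfl⟩ := Nat.exists_eq_add_of_le hp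
    rw [fockAct_add]
    rcases lt_or_ge p' n with hp' | hp'
    · rw [fockAct_lt _ w' hp', kernel_zero_right]
      exact fockKernelFun_ne fun h => by
        have := congrArg Prod.snd h
        simp only at this; omega
    · obtain ⟨j', rfl⟩ := Nat.exists_eq_add_of_le hp'
      rw [fockAct_add]
      by_cases h : w = w' ∧ j = j'
      · obtain ⟨rfl, rfl⟩ := h
        refine (fockKernelFun_same _ _ _).trans (Eq.trans ?_ (fockKernelFun_same _ _ _).symm)
        rw [tensorPow_adj]
        exact fockPair_comp_left _ _ _ _
      · refine (fockKernelFun_ne fun h' => h ?_).trans (fockKernelFun_ne fun h' => h ?_).symm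
        · exact ⟨congrArg Prod.fst h', by
            have := congrArg Prod.snd h'
            simp only at this; omega⟩
        · exact ⟨congrArg Prod.fst h', by
            have := congrArg Prod.snd h'
            simp only at this; omega⟩

/-- The indices themselves can differ: both may carry the zero morphism but lie in different
summands. The vectors still coincide. -/
theorem vec_fockAct_comp {l m n : ℕ} (a : T.Hom m n) (b : T.Hom l m) (i : T.FockIndex) :
    T.fockKernel.vec (fockAct (T.comp a b) i) = T.fockKernel.vec (fockAct a (fockAct b i)) := by
  obtain ⟨⟨w, p⟩, x⟩ := i
  rcases lt_or_ge p l with hp | hp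
  · rw [fockAct_lt _ w hp, fockAct_lt _ w hp]
    rcases lt_or_ge p m with hp' | hp'
    · rw [fockAct_lt _ w hp']
    · obtain ⟨j, rfl⟩ := Nat.exists_eq_add_of_le hp'
      rw [fockAct_add, comp_zero, vec_eq_fockVec, vec_eq_fockVec, map_zero, map_zero]
  · obtain ⟨j, rfl⟩ := Nat.exists_eq_add_of_le hp
    rw [fockAct_add, fockAct_add, fockAct_add, tensorPow_comp, T.comp_assoc]

/-- Endomorphisms of one object form a C*-algebra, whose action on the kernel is automatically
contractive. -/
theorem exists_fockOp_diag (m : ℕ) (d : Diag T.topIdeal m) :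
    ∃ S : T.FockSpace →L[ℂ] T.FockSpace, ‖S‖ ≤ ‖d‖ ∧
      ∀ i, S (T.fockKernel.vec i) = T.fockKernel.vec (fockAct d.1 i) := by
  have hβ : ∀ i j : T.FockIndex, ∃ β : Diag T.topIdeal m →ₗ[ℂ] ℂ,
      ∀ d, T.fockKernel.k i (fockAct d.1 j) = β d := by
    rintro i ⟨⟨w, p⟩, x⟩
    rcases lt_or_ge p m with hp | hp
    · exact ⟨0, fun d => by rw [fockAct_lt _ w hp, kernel_zero_right]; rfl⟩
    · obtain ⟨j, rfl⟩ := Nat.exists_eq_add_of_le hp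
      let incl : Diag T.topIdeal m →ₗ[ℂ] T.Hom m m := (T.topIdeal.space m m).subtype
      refine ⟨(innerSL ℂ (T.fockKernel.vec i)).toLinearMap ∘ₗ fockVec w (m + j) ∘ₗ
        T.comp.flip x ∘ₗ tensorPow j ∘ₗ incl, fun d => ?_⟩
      rw [fockAct_add, ← PosKernel.inner_vec, vec_eq_fockVec]
      rfl
  choose β hβ using hβ
  exact T.fockKernel.exists_op_of_rep (fun d : Diag T.topIdeal m => fockAct d.1) β hβ
    (fun i j d e => by
      rw [← PosKernel.inner_vec, ← PosKernel.inner_vec]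
      exact congrArg _ (vec_fockAct_comp d.1 e.1 j))
    (fun i j d => kernel_fockAct d.1 i j) d

/-- The bound for `a` follows from that for the endomorphism `a* a`, whose norm is `‖a‖²`. -/
theorem exists_fockOp {m n : ℕ} (a : T.Hom m n) :
    ∃ S : T.FockSpace →L[ℂ] T.FockSpace, ‖S‖ ≤ ‖a‖ ∧
      ∀ i, S (T.fockKernel.vec i) = T.fockKernel.vec (fockAct a i) := by
  obtain ⟨U, hU, hU'⟩ := exists_fockOp_diag m
    (⟨T.comp (T.adj a) a, trivial⟩ : Diag T.topIdeal m)
  obtain ⟨S, hS, hS'⟩ := T.fockKernel.exists_op_of_sq (fockAct a) _ (fun i j => by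
    rw [kernel_fockAct, ← PosKernel.inner_vec, ← vec_fockAct_comp, PosKernel.inner_vec]) hU'
  refine ⟨S, hS.trans ?_, hS'⟩
  rw [Real.sqrt_le_left (norm_nonneg _)]
  exact hU.trans (T.norm_adj_comp_self a).le

/-- The Fock representation of morphisms. -/
def fockOp {m n : ℕ} (a : T.Hom m n) : T.FockSpace →L[ℂ] T.FockSpace := (exists_fockOp a).choose

theorem norm_fockOp_le {m n : ℕ} (a : T.Hom m n) : ‖fockOp a‖ ≤ ‖a‖ :=
  (exists_fockOp a).choose_spec.1

theorem fockOp_vec {m n : ℕ} (a : T.Hom m n) (i : T.FockIndex) :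
    fockOp a (T.fockKernel.vec i) = T.fockKernel.vec (fockAct a i) :=
  (exists_fockOp a).choose_spec.2 i

theorem fockOp_add {m n : ℕ} (a : T.Hom m n) (w : T.FockBase) (j : ℕ) (x : T.Hom w.1 (m + j)) :
    fockOp a (fockVec w (m + j) x) = fockVec w (n + j) (T.comp (tensorPow j a) x) := by
  rw [← vec_eq_fockVec, fockOp_vec, fockAct_add, vec_eq_fockVec]

theorem fockOp_self {m n : ℕ} (a : T.Hom m n) (w : T.FockBase) (x : T.Hom w.1 m) :
    fockOp a (fockVec w m x) = fockVec w n (T.comp a x) := fockOp_add a w 0 x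

theorem fockOp_lt {m n : ℕ} (a : T.Hom m n) (w : T.FockBase) {p : ℕ} (hp : p < m)
    (x : T.Hom w.1 p) : fockOp a (fockVec w p x) = 0 := by
  rw [← vec_eq_fockVec, fockOp_vec, fockAct_lt a w hp, vec_eq_fockVec, map_zero]

theorem star_fockOp {m n : ℕ} (a : T.Hom m n) : star (fockOp a) = fockOp (T.adj a) :=
  T.fockKernel.clm_ext fun i => by
    rw [T.fockKernel.adjoint_vec (kernel_fockAct a) (fockOp_vec a), fockOp_vec]

theorem fockOp_comp {l m n : ℕ} (a : T.Hom m n) (b : T.Hom l m) :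
    fockOp (T.comp a b) = fockOp a * fockOp b :=
  T.fockKernel.clm_ext fun i => by
    rw [mul_apply_eq_comp, fockOp_vec, fockOp_vec, fockOp_vec, vec_fockAct_comp]

/-- The right tensor relation: on `T(k', l + j)` both sides act by `(a ⊗ 1^(k+j)) (b ⊗ 1^j)`. -/
theorem fockOp_mul_fockOp {m n k l : ℕ} (a : T.Hom m n) (b : T.Hom l (m + k)) :
    fockOp a * fockOp b = fockOp (T.comp (tensorPow k a) b) := by
  refine fock_ext fun w p x => ?_
  rw [mul_apply_eq_comp]
  rcases lt_or_ge p l with hp | hp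
  · rw [fockOp_lt _ _ hp, fockOp_lt _ _ hp, map_zero]
  · obtain ⟨j, rfl⟩ := Nat.exists_eq_add_of_le hp
    rw [fockOp_add, fockOp_add, tensorPow_comp, T.comp_assoc]
    set y := T.comp (tensorPow j b) x
    have h : m + k + j = m + (k + j) := Nat.add_assoc _ _ _
    obtain ⟨y', hy⟩ : ∃ y' : T.Hom w.1 (m + (k + j)), HEq y y' := by
      rw [← h]; exact ⟨y, HEq.rfl⟩
    rw [fockVec_heq w h hy, fockOp_add]
    refine fockVec_heq w (Nat.add_assoc _ _ _).symm ?_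
    exact comp_heq (Nat.add_assoc _ _ _).symm (Nat.add_assoc _ _ _).symm
      (tensorPow_tensorPow k j a).symm hy.symm

def fockOpₗ (m n : ℕ) : T.Hom m n →ₗ[ℂ] (T.FockSpace →L[ℂ] T.FockSpace) where
  toFun := fockOp
  map_add' a b := fock_ext fun w p x => by
    rw [add_apply]
    rcases lt_or_ge p m with hp | hp
    · rw [fockOp_lt _ _ hp, fockOp_lt _ _ hp, fockOp_lt _ _ hp, add_zero]
    · obtain ⟨j, rfl⟩ := Nat.exists_eq_add_of_le hp
      rw [fockOp_add, fockOp_add, fockOp_add, map_add, map_add, LinearMap.add_apply, map_add]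
  map_smul' c a := fock_ext fun w p x => by
    rw [RingHom.id_apply, smul_apply]
    rcases lt_or_ge p m with hp | hp
    · rw [fockOp_lt _ _ hp, fockOp_lt _ _ hp, smul_zero]
    · obtain ⟨j, rfl⟩ := Nat.exists_eq_add_of_le hp
      rw [fockOp_add, fockOp_add, map_smul, map_smul, LinearMap.smul_apply, map_smul]

variable (T) in
theorem exists_fockProj (q : ℕ) : ∃ P : T.FockSpace →L[ℂ] T.FockSpace, ‖P‖ ≤ 1 ∧
    ∀ i, P (T.fockKernel.vec i) =
      T.fockKernel.vec (if i.1.2 = q then i else ⟨i.1, 0⟩) := by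
  refine T.fockKernel.exists_op_of_idempotent _ fun i j => ?_
  split_ifs with h1 h2 h2
  · rfl
  · rfl
  · rw [kernel_zero_left]
    exact (fockKernelFun_ne fun h => h1 (by rw [h, h2])).symm
  · rw [kernel_zero_right, kernel_zero_right]

variable (T) in
/-- The projection of the Fock space onto the summand with index `q`. -/
def fockProj (q : ℕ) : T.FockSpace →L[ℂ] T.FockSpace := (T.exists_fockProj q).choose

theorem norm_fockProj_le (q : ℕ) : ‖T.fockProj q‖ ≤ 1 := (T.exists_fockProj q).choose_spec.1

theorem fockProj_vec (q : ℕ) (i : T.FockIndex) : T.fockProj q (T.fockKernel.vec i) =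
    T.fockKernel.vec (if i.1.2 = q then i else ⟨i.1, 0⟩) := (T.exists_fockProj q).choose_spec.2 i

theorem fockProj_self (w : T.FockBase) (q : ℕ) (x : T.Hom w.1 q) :
    T.fockProj q (fockVec w q x) = fockVec w q x := by
  have := fockProj_vec q ⟨(w, q), x⟩
  rwa [if_pos rfl] at this

theorem fockProj_ne (w : T.FockBase) {p q : ℕ} (h : p ≠ q) (x : T.Hom w.1 p) :
    T.fockProj q (fockVec w p x) = 0 := by
  have := fockProj_vec q ⟨(w, p), x⟩
  rw [if_neg h] at this
  exact this.trans (map_zero (fockVec w p))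

theorem star_fockProj (q : ℕ) : star (T.fockProj q) = T.fockProj q := by
  refine T.fockKernel.clm_ext fun i => ?_
  rw [T.fockKernel.adjoint_vec (fun i j => ?_) (fockProj_vec q), fockProj_vec]
  · split_ifs with h1 h2 h2
    · rfl
    · rw [kernel_zero_right]
      exact fockKernelFun_ne fun h => h2 (by rw [← h, h1])
    · rw [kernel_zero_left]
      exact (fockKernelFun_ne fun h => h1 (by rw [h, h2])).symm
    · rw [kernel_zero_left, kernel_zero_right]

end Fock

end RightTensorCStarPrecategory

end
noncomputable section

namespace RightTensorCStarPrecategory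

variable {T : RightTensorCStarPrecategory.{u}}

/-! ### Corner operators and the detection principle. -/

section Detect

/-- The operator on the Fock space that is given by `c` on the summand `q` and is zero elsewhere. -/
def corner {q p : ℕ} : T.Hom q p →ₗ[ℂ] (T.FockSpace →L[ℂ] T.FockSpace) :=
  LinearMap.mulRight ℂ (T.fockProj q) ∘ₗ fockOpₗ q p

theorem corner_apply {q p : ℕ} (c : T.Hom q p) : corner c = fockOp c * T.fockProj q := rfl

theorem corner_self {q p : ℕ} (c : T.Hom q p) (w : T.FockBase) (x : T.Hom w.1 q) :
    corner c (fockVec w q x) = fockVec w p (T.comp c x) := by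
  rw [corner_apply, mul_apply_eq_comp, fockProj_self, fockOp_self]

theorem corner_ne {q p r : ℕ} (h : r ≠ q) (c : T.Hom q p) (w : T.FockBase) (x : T.Hom w.1 r) :
    corner c (fockVec w r x) = 0 := by
  rw [corner_apply, mul_apply_eq_comp, fockProj_ne _ h, map_zero]

/-- `fockOp c` is the sum of all `c ⊗ 1^j` with `j ≥ 0`, and `fockOp (c ⊗ 1)` is the same sum
without `j = 0`. So annihilating the corners of `J` is the same as imposing coisometry on `J`. -/
theorem corner_eq_sub {q p : ℕ} (c : T.Hom q p) :
    corner c = fockOp c - fockOp (T.tensor c) := by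
  refine fock_ext fun w r x => ?_
  rw [sub_apply]
  rcases lt_trichotomy r q with h | rfl | h
  · rw [corner_ne h.ne, fockOp_lt _ _ h, fockOp_lt _ _ (h.trans (Nat.lt_succ_self q)), sub_zero]
  · rw [corner_self, fockOp_self, fockOp_lt _ _ (Nat.lt_succ_self r), sub_zero]
  · obtain ⟨j, rfl⟩ := Nat.exists_eq_add_of_le h
    have e : q + 1 + j = q + (1 + j) := Nat.add_assoc _ _ _
    obtain ⟨x', hx⟩ : ∃ x' : T.Hom w.1 (q + (1 + j)), HEq x x' := by
      rw [← e]; exact ⟨x, HEq.rfl⟩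
    rw [corner_ne h.ne', fockOp_add (T.tensor c), fockVec_heq w e hx, fockOp_add, eq_comm,
      sub_eq_zero]
    exact (fockVec_heq w (Nat.add_assoc _ _ _)
      (comp_heq e (Nat.add_assoc _ _ _) (tensorPow_tensorPow 1 j c) hx)).symm

theorem star_corner {q p : ℕ} (c : T.Hom q p) : star (corner c) = corner (T.adj c) := by
  rw [corner_apply, corner_apply, star_mul, star_fockProj, star_fockOp]
  refine fock_ext fun w r x => ?_
  rw [mul_apply_eq_comp, mul_apply_eq_comp]
  rcases lt_or_ge r p with h | h
  · rw [fockOp_lt _ _ h, fockProj_ne _ h.ne, map_zero, map_zero]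
  · obtain ⟨j, rfl⟩ := Nat.exists_eq_add_of_le h
    rw [fockOp_add]
    rcases j with _ | j
    · exact (fockProj_self w q _).trans ((congrArg _ (fockProj_self w p x)).trans
        (fockOp_self _ w x)).symm
    · rw [fockProj_ne _ (by omega), fockProj_ne _ (by omega), map_zero]

/-- The lower bound comes from letting `c` act on the vector `c*`, over the base object `p` with a
functional that norms `(c c*)* (c c*)`. -/
theorem norm_corner {q p : ℕ} (c : T.Hom q p) : ‖corner c‖ = ‖c‖ := by
  refine le_antisymm ?_ ?_
  · calc ‖corner c‖ ≤ ‖fockOp c‖ * ‖T.fockProj q‖ := norm_mul_le _ _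
      _ ≤ ‖c‖ * 1 := by
        gcongr
        · exact norm_fockOp_le c
        · exact norm_fockProj_le q
      _ = ‖c‖ := mul_one _
  · rcases (norm_nonneg c).eq_or_lt with h0 | h0
    · rw [← h0]; exact norm_nonneg _
    have hcc : ‖T.comp c (T.adj c)‖ = ‖c‖ ^ 2 := by
      have := T.norm_adj_comp_self (T.adj c)
      rwa [T.adj_adj, norm_adj] at this
    -- With this `ω`, the vector `c c*` has squared norm `‖c‖⁴`, while `c*` has squared norm `ω(c
    -- c*) ≤ ‖c‖²`.
    obtain ⟨ω, hω⟩ := exists_posFunctional (toDiag p (T.comp c (T.adj c)))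
    let w : T.FockBase := ⟨p, ω⟩
    have h1 : ‖fockVec w p (T.comp c (T.adj c))‖ ^ 2 = ‖c‖ ^ 4 := by
      rw [norm_fockVec_sq]
      refine hω.trans ?_
      rw [norm_toDiag, hcc]
      ring
    have h2 : ‖fockVec w q (T.adj c)‖ ^ 2 ≤ ‖c‖ ^ 2 := by
      rw [norm_fockVec_sq]
      refine (Complex.re_le_norm _).trans ((ω.norm_le _).trans ?_)
      rw [norm_toDiag, T.adj_adj, hcc]
    have h3 := (corner c).le_opNorm (fockVec w q (T.adj c))
    rw [corner_self] at h3
    have h4 : ‖c‖ ^ 4 ≤ ‖corner c‖ ^ 2 * ‖c‖ ^ 2 := by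
      rw [← h1]
      calc _ ≤ (‖corner c‖ * ‖fockVec w q (T.adj c)‖) ^ 2 := by gcongr
        _ = ‖corner c‖ ^ 2 * ‖fockVec w q (T.adj c)‖ ^ 2 := mul_pow _ _ _
        _ ≤ _ := by gcongr
    have h5 : ‖c‖ ^ 2 ≤ ‖corner c‖ ^ 2 := by
      refine le_of_mul_le_mul_right ?_ (pow_pos h0 2)
      rw [← pow_add]; exact h4
    exact le_of_sq_le_sq h5 (norm_nonneg _)

theorem corner_injective {q p : ℕ} : Function.Injective (corner (T := T) (q := q) (p := p)) := by
  refine (injective_iff_map_eq_zero _).2 fun c hc => ?_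
  rw [← norm_eq_zero, ← norm_corner, hc, norm_zero]

theorem fockOp_mul_corner_lt {m n q p : ℕ} (a : T.Hom m n) (c : T.Hom q p) (h : p < m) :
    fockOp a * corner c = 0 := by
  refine fock_ext fun w r x => ?_
  rw [mul_apply_eq_comp]
  by_cases hr : r = q
  · subst hr; rw [corner_self, fockOp_lt _ _ h]; rfl
  · rw [corner_ne hr, map_zero]; rfl

theorem fockOp_mul_corner {m n q j : ℕ} (a : T.Hom m n) (c : T.Hom q (m + j)) :
    fockOp a * corner c = corner (T.comp (tensorPow j a) c) := by
  refine fock_ext fun w r x => ?_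
  rw [mul_apply_eq_comp]
  by_cases hr : r = q
  · subst hr; rw [corner_self, corner_self, fockOp_add, T.comp_assoc]
  · rw [corner_ne hr, corner_ne hr, map_zero]

theorem corner_mul_fockProj_self {q p : ℕ} (c : T.Hom q p) : corner c * T.fockProj q = corner c := by
  refine fock_ext fun w r x => ?_
  rw [mul_apply_eq_comp]
  by_cases hr : r = q
  · subst hr; rw [fockProj_self]
  · rw [corner_ne hr, fockProj_ne _ hr, map_zero]

theorem corner_mul_fockProj_ne {q p r : ℕ} (h : r ≠ q) (c : T.Hom q p) :
    corner c * T.fockProj r = 0 := by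
  refine fock_ext fun w s x => ?_
  rw [mul_apply_eq_comp]
  by_cases hr : s = r
  · subst hr; rw [fockProj_self, corner_ne h]; rfl
  · rw [fockProj_ne _ hr, map_zero]; rfl

theorem fockProj_mul_corner_self {q p : ℕ} (c : T.Hom q p) : T.fockProj p * corner c = corner c := by
  refine star_injective ?_
  rw [star_mul, star_fockProj, star_corner, corner_mul_fockProj_self]

theorem fockProj_mul_corner_ne {q p r : ℕ} (h : r ≠ p) (c : T.Hom q p) :
    T.fockProj r * corner c = 0 := by
  refine star_injective ?_
  rw [star_mul, star_fockProj, star_corner, corner_mul_fockProj_ne h, star_zero]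

/-- Compression of operators to a corner. -/
def compress (p q : ℕ) :
    (T.FockSpace →L[ℂ] T.FockSpace) →L[ℂ] (T.FockSpace →L[ℂ] T.FockSpace) :=
  ContinuousLinearMap.mul ℂ _ (T.fockProj p) ∘L
    (ContinuousLinearMap.mul ℂ (T.FockSpace →L[ℂ] T.FockSpace)).flip (T.fockProj q)

theorem compress_apply (p q : ℕ) (S : T.FockSpace →L[ℂ] T.FockSpace) :
    compress p q S = T.fockProj p * (S * T.fockProj q) := rfl

theorem norm_compress_le (p q : ℕ) (S : T.FockSpace →L[ℂ] T.FockSpace) :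
    ‖compress p q S‖ ≤ ‖S‖ := by
  rw [compress_apply]
  calc _ ≤ ‖T.fockProj p‖ * (‖S‖ * ‖T.fockProj q‖) :=
        (norm_mul_le _ _).trans (by gcongr; exact norm_mul_le _ _)
    _ ≤ 1 * (‖S‖ * 1) := by gcongr <;> exact norm_fockProj_le _
    _ = ‖S‖ := by ring

theorem compress_corner_self {q p : ℕ} (c : T.Hom q p) : compress p q (corner c) = corner c := by
  rw [compress_apply, corner_mul_fockProj_self, fockProj_mul_corner_self]

theorem compress_corner_ne {q p q' p' : ℕ} (h : (q', p') ≠ (q, p)) (c : T.Hom q p) :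
    compress p' q' (corner c) = 0 := by
  rw [compress_apply]
  by_cases hq : q' = q
  · subst hq
    rw [corner_mul_fockProj_self, fockProj_mul_corner_ne (by rintro rfl; exact h rfl)]
  · rw [corner_mul_fockProj_ne hq, mul_zero]

theorem fockOp_mul_fockProj {q p : ℕ} (d : T.Hom q p) (j : ℕ) :
    fockOp d * T.fockProj (q + j) = corner (tensorPow j d) := by
  refine fock_ext fun w r x => ?_
  rw [mul_apply_eq_comp]
  by_cases hr : r = q + j
  · subst hr; rw [fockProj_self, fockOp_add, corner_self]
  · rw [fockProj_ne _ hr, corner_ne hr, map_zero]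

theorem fockOp_mul_fockProj_lt {q p : ℕ} (d : T.Hom q p) {j : ℕ} (hj : j < q) :
    fockOp d * T.fockProj j = 0 := by
  refine fock_ext fun w r x => ?_
  rw [mul_apply_eq_comp]
  by_cases hr : r = j
  · subst hr; rw [fockProj_self, fockOp_lt _ _ hj]; rfl
  · rw [fockProj_ne _ hr, map_zero]; rfl

theorem compress_fockOp {q p : ℕ} (d : T.Hom q p) (j : ℕ) :
    compress (p + j) (q + j) (fockOp d) = corner (tensorPow j d) := by
  rw [compress_apply, fockOp_mul_fockProj, fockProj_mul_corner_self]

theorem compress_fockOp_lt {q p : ℕ} (d : T.Hom q p) (p' : ℕ) {j : ℕ} (hj : j < q) :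
    compress p' j (fockOp d) = 0 := by
  rw [compress_apply, fockOp_mul_fockProj_lt d hj, mul_zero]

variable (J : T.Ideal)

def cornerSpan : Submodule ℂ (T.FockSpace →L[ℂ] T.FockSpace) :=
  Submodule.span ℂ {S | ∃ q p, ∃ c ∈ J.space q p, S = corner c}

/-- The closed span of the corner operators given by an ideal. -/
def cornerIdeal : Submodule ℂ (T.FockSpace →L[ℂ] T.FockSpace) := (cornerSpan J).topologicalClosure

variable {J}

theorem corner_mem {q p : ℕ} {c : T.Hom q p} (hc : c ∈ J.space q p) : corner c ∈ cornerIdeal J :=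
  Submodule.le_topologicalClosure _ (Submodule.subset_span ⟨q, p, c, hc, rfl⟩)

theorem map_cornerIdeal {F : Type*} [NormedAddCommGroup F] [NormedSpace ℂ F]
    (f : (T.FockSpace →L[ℂ] T.FockSpace) →L[ℂ] F) (N : Submodule ℂ F) (hN : IsClosed (N : Set F))
    (h : ∀ q p, ∀ c ∈ J.space q p, f (corner c) ∈ N) {S : T.FockSpace →L[ℂ] T.FockSpace}
    (hS : S ∈ cornerIdeal J) : f S ∈ N := by
  have : cornerIdeal J ≤ N.comap (f : (T.FockSpace →L[ℂ] T.FockSpace) →ₗ[ℂ] F) := by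
    refine Submodule.topologicalClosure_minimal _ ?_ (hN.preimage f.continuous)
    refine Submodule.span_le.2 ?_
    rintro _ ⟨q, p, c, hc, rfl⟩
    exact h q p c hc
  exact this hS

theorem isClosed_cornerIdeal : IsClosed (cornerIdeal J : Set (T.FockSpace →L[ℂ] T.FockSpace)) :=
  Submodule.isClosed_topologicalClosure _

theorem star_mem_cornerIdeal : ∀ S ∈ cornerIdeal J, star S ∈ cornerIdeal J := by
  intro S hS
  have hcl : IsClosed {S : T.FockSpace →L[ℂ] T.FockSpace | star S ∈ cornerIdeal J} :=
    isClosed_cornerIdeal.preimage continuous_star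
  refine closure_minimal (fun S hS => ?_) hcl (show S ∈ closure _ from hS)
  change star S ∈ cornerIdeal J
  induction hS using Submodule.span_induction with
  | mem S hS =>
    obtain ⟨q, p, c, hc, rfl⟩ := hS
    rw [star_corner]; exact corner_mem (J.adj_mem hc)
  | zero => rw [star_zero]; exact zero_mem _
  | add S S' _ _ h h' => rw [star_add]; exact add_mem h h'
  | smul z S _ h => rw [star_smul]; exact Submodule.smul_mem _ _ h

/-- This and its mirror image place all Fock operators in the idealizer of the closed span of
corners. The reason is that `(a ⊗ 1^j) c` stays in the ideal `J`. -/
theorem fockOp_mul_mem_cornerIdeal {m n : ℕ} (a : T.Hom m n) {S : T.FockSpace →L[ℂ] T.FockSpace}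
    (hS : S ∈ cornerIdeal J) : fockOp a * S ∈ cornerIdeal J := by
  refine map_cornerIdeal (ContinuousLinearMap.mul ℂ _ (fockOp a)) _ isClosed_cornerIdeal
    (fun q p c hc => ?_) hS
  change fockOp a * corner c ∈ _
  rcases lt_or_ge p m with h | h
  · rw [fockOp_mul_corner_lt _ _ h]; exact zero_mem _
  · obtain ⟨j, rfl⟩ := Nat.exists_eq_add_of_le h
    rw [fockOp_mul_corner]
    exact corner_mem (J.comp_mem_left _ hc)

theorem mul_fockOp_mem_cornerIdeal {m n : ℕ} (a : T.Hom m n) {S : T.FockSpace →L[ℂ] T.FockSpace}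
    (hS : S ∈ cornerIdeal J) : S * fockOp a ∈ cornerIdeal J := by
  have := star_mem_cornerIdeal _
    (fockOp_mul_mem_cornerIdeal (T.adj a) (star_mem_cornerIdeal _ hS))
  rwa [star_mul, star_star, star_fockOp, T.adj_adj] at this

/-- Matrix entries of limits still come from `J`, because `corner` is isometric and hence carries
the closed space `J(q,p)` to a closed one. -/
theorem exists_corner_eq_compress (p q : ℕ) {S : T.FockSpace →L[ℂ] T.FockSpace}
    (hS : S ∈ cornerIdeal J) : ∃ c ∈ J.space q p, corner c = compress p q S := by
  let f : T.Hom q p →ₗᵢ[ℂ] (T.FockSpace →L[ℂ] T.FockSpace) := ⟨corner, norm_corner⟩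
  refine map_cornerIdeal (compress p q) ((J.space q p).map corner) ?_ (fun q' p' c hc => ?_) hS
  · exact f.isometry.isClosedEmbedding.isClosedMap _ (J.isClosed q p)
  · by_cases h : (q, p) = (q', p')
    · obtain ⟨rfl, rfl⟩ := Prod.mk.inj h
      exact ⟨c, hc, (compress_corner_self c).symm⟩
    · rw [compress_corner_ne h]; exact zero_mem _

/-- A finite combination of corners has only finitely many nonzero entries, and compression is
contractive. -/
theorem tendsto_norm_compress (p q : ℕ) {S : T.FockSpace →L[ℂ] T.FockSpace}
    (hS : S ∈ cornerIdeal J) {ε : ℝ} (hε : 0 < ε) :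
    ∃ j, ‖compress (p + j) (q + j) S‖ < ε := by
  obtain ⟨S', hS', hd⟩ := Metric.mem_closure_iff.1 (show S ∈ closure _ from hS) ε hε
  have h0 : ∃ j₀, ∀ j ≥ j₀, compress (p + j) (q + j) S' = 0 := by
    clear hd
    change S' ∈ Submodule.span ℂ _ at hS'
    induction hS' using Submodule.span_induction with
    | mem S hS =>
      obtain ⟨q', p', c, hc, rfl⟩ := hS
      -- From this `j` on, the column `q + j` lies beyond the column `q'` of the corner.
      refine ⟨q' + 1, fun j hj => compress_corner_ne (fun h => ?_) c⟩
      have := (Prod.mk.inj h).1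
      omega
    | zero => exact ⟨0, fun j _ => map_zero _⟩
    | add S S' _ _ h h' =>
      obtain ⟨j, hj⟩ := h
      obtain ⟨j', hj'⟩ := h'
      exact ⟨max j j', fun i hi => by
        rw [map_add, hj i (le_of_max_le_left hi), hj' i (le_of_max_le_right hi), add_zero]⟩
    | smul z S _ h =>
      obtain ⟨j, hj⟩ := h
      exact ⟨j, fun i hi => by rw [map_smul, hj i hi, smul_zero]⟩
  obtain ⟨j, hj⟩ := h0
  refine ⟨j, ?_⟩
  have : compress (p + j) (q + j) S = compress (p + j) (q + j) (S - S') := by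
    rw [map_sub, hj j le_rfl, sub_zero]
  rw [this]
  refine (norm_compress_le _ _ _).trans_lt ?_
  rwa [← dist_eq_norm]

/-- On the C*-algebra `J(n,n)` the tensoring is an injective *-homomorphism, hence isometric.
Applying this to `c* c` settles general morphisms. -/
theorem norm_tensor_of_mem (hJ : ∀ n m, ∀ c ∈ J.space n m, T.tensor c = 0 → c = 0) {n m : ℕ}
    {c : T.Hom n m} (hc : c ∈ J.space n m) : ‖T.tensor c‖ = ‖c‖ := by
  let f : Diag J n →⋆ₙₐ[ℂ] Diag T.topIdeal (n + 1) :=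
    { toFun := fun x => toDiag (n + 1) (T.tensor x.1)
      map_smul' := fun z x => congrArg (toDiag (n + 1)) (map_smul T.tensor z x.1)
      map_zero' := congrArg (toDiag (n + 1)) (map_zero T.tensor)
      map_add' := fun x y => congrArg (toDiag (n + 1)) (map_add T.tensor x.1 y.1)
      map_mul' := fun x y => congrArg (toDiag (n + 1)) (T.tensor_comp x.1 y.1)
      map_star' := fun x => congrArg (toDiag (n + 1)) (T.tensor_adj x.1) }
  have hf : Function.Injective f := by
    refine (injective_iff_map_eq_zero f).2 fun x hx => ?_
    exact Subtype.ext (hJ n n x.1 x.2 (congrArg (fun y : Diag T.topIdeal (n + 1) => y.1) hx))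
  have h := NonUnitalStarAlgHom.norm_map f hf
    (⟨T.comp (T.adj c) c, J.comp_mem_left _ hc⟩ : Diag J n)
  change ‖T.tensor (T.comp (T.adj c) c)‖ = ‖T.comp (T.adj c) c‖ at h
  rw [T.tensor_comp, T.tensor_adj, T.norm_adj_comp_self, T.norm_adj_comp_self] at h
  exact (sq_eq_sq₀ (norm_nonneg _) (norm_nonneg _)).1 h

/-- The diagonal entries `d ⊗ 1^j` of `fockOp d` all lie in `J`, so they all have norm `‖d‖`; but
some entry is smaller than any given `ε`. -/
theorem eq_zero_of_fockOp_mem (hJ : ∀ n m, ∀ c ∈ J.space n m, T.tensor c = 0 → c = 0) {q p : ℕ}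
    {d : T.Hom q p} (hd : fockOp d ∈ cornerIdeal J) : d = 0 := by
  have hmem : ∀ j, tensorPow j d ∈ J.space (q + j) (p + j) := fun j => by
    obtain ⟨c, hc, h⟩ := exists_corner_eq_compress (p + j) (q + j) hd
    rw [compress_fockOp] at h
    rwa [← corner_injective h]
  have hnorm : ∀ j, ‖tensorPow j d‖ = ‖d‖ := fun j => by
    induction j with
    | zero => rfl
    | succ j ih => rw [tensorPow_succ, ← ih]; exact norm_tensor_of_mem hJ (hmem j)
  rw [← norm_eq_zero]
  refine le_antisymm (le_of_forall_pos_lt_add fun ε hε => ?_) (norm_nonneg d)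
  obtain ⟨j, hj⟩ := tendsto_norm_compress p q hd hε
  rw [compress_fockOp, norm_corner, hnorm] at hj
  rwa [zero_add]

/-- For `j < r` the operator `fockOp a` vanishes on the summand `q + j`, so the entry there is that
of `a'` alone. -/
theorem tensorPow_mem_of_sub_mem {p q r : ℕ} {a' : T.Hom q p} {a : T.Hom (q + r) (p + r)}
    (h : fockOp a' - fockOp a ∈ cornerIdeal J) {j : ℕ} (hj : j < r) :
    tensorPow j a' ∈ J.space (q + j) (p + j) := by
  obtain ⟨c, hc, h⟩ := exists_corner_eq_compress (p + j) (q + j) h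
  rw [map_sub, compress_fockOp, compress_fockOp_lt a _ (by omega), sub_zero] at h
  rwa [← corner_injective h]

/-- The corners of `a' ⊗ 1^j ∈ J` for `j < r` telescope to `fockOp a' - fockOp (a' ⊗ 1^r)`. So
`fockOp (a' ⊗ 1^r - a)` is again in the closed span of corners, and therefore zero. -/
theorem tensorPow_eq_of_sub_mem (hJ : ∀ n m, ∀ c ∈ J.space n m, T.tensor c = 0 → c = 0)
    {p q r : ℕ} {a' : T.Hom q p} {a : T.Hom (q + r) (p + r)}
    (h : fockOp a' - fockOp a ∈ cornerIdeal J) : tensorPow r a' = a := by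
  have h1 : ∀ j ≤ r, fockOp a' - fockOp (tensorPow j a') ∈ cornerIdeal J := fun j => by
    induction j with
    | zero => intro _; rw [show fockOp (tensorPow 0 a') = fockOp a' from rfl, sub_self]
              exact zero_mem _
    | succ j ih =>
      intro hj
      have h2 := corner_mem (tensorPow_mem_of_sub_mem h (j := j) hj)
      rw [corner_eq_sub] at h2
      have h3 := add_mem (ih (by omega)) h2
      rwa [sub_add_sub_cancel] at h3
  refine sub_eq_zero.1 (eq_zero_of_fockOp_mem hJ (?_ : fockOp _ ∈ cornerIdeal J))
  rw [show fockOp (tensorPow r a' - a) = fockOp (tensorPow r a') - fockOp a from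
    map_sub (fockOpₗ _ _) _ _]
  have := sub_mem h (h1 r le_rfl)
  rwa [sub_sub_sub_cancel_left] at this

set_option synthInstance.maxHeartbeats 200000 in
/-- If `⊗ 1` is injective on `J`, then there is a representation of `K`, coisometric on `J`, that
identifies morphisms only when it is forced to do so. -/
theorem exists_detecting_representation (K J : T.Ideal)
    (hJ : ∀ n m, ∀ c ∈ J.space n m, T.tensor c = 0 → c = 0) :
    ∃ (C : Type u) (_ : NonUnitalCStarAlgebra C) (ρ : Representation K C), ρ.IsCoisometricOn J ∧
      ∀ (p q r : ℕ) (a' : K.space q p) (a : K.space (q + r) (p + r)),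
        ρ.toFun p q a' = ρ.toFun (p + r) (q + r) a →
          tensorPow r (a' : T.Hom q p) = a ∧
            ∀ j < r, tensorPow j (a' : T.Hom q p) ∈ J.space (q + j) (p + j) := by
  obtain ⟨C, _, N, f, hN, hf⟩ := exists_quotient_idealizer (cornerIdeal J) isClosed_cornerIdeal
    star_mem_cornerIdeal
  have hop : ∀ {m n : ℕ} (a : T.Hom m n), fockOp a ∈ N := fun a =>
    (hN _).2 fun S hS => ⟨fockOp_mul_mem_cornerIdeal a hS, mul_fockOp_mem_cornerIdeal a hS⟩
  let op : ∀ m n, T.Hom m n → N := fun m n a => ⟨fockOp a, hop a⟩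
  let F : ∀ m n, T.Hom m n →ₗ[ℂ] C := fun m n =>
    { toFun := fun a => f (op m n a)
      map_add' := fun a b => (congrArg f (Subtype.ext (map_add (fockOpₗ m n) a b))).trans
        (map_add f (op m n a) (op m n b))
      map_smul' := fun z a => (congrArg f (Subtype.ext (map_smul (fockOpₗ m n) z a))).trans
        (map_smul f z (op m n a)) }
  have heq : ∀ x y : N, f x = f y → (x : T.FockSpace →L[ℂ] T.FockSpace) - y ∈ cornerIdeal J := by
    intro x y h
    exact (hf (x - y)).1 (by rw [map_sub, h, sub_self])
  refine ⟨C, _, ⟨fun n m => F m n ∘ₗ (K.space m n).subtype, fun n m a => ?_,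
    fun l n m b a => ?_, fun n m k l a b => ?_⟩, fun n m a ha hK hK' => ?_,
    fun p q r a' a h => ?_⟩
  · have h : op n m (T.adj a.1) = star (op m n a.1) := Subtype.ext (star_fockOp a.1).symm
    exact (congrArg f h).trans (map_star f _)
  · have h : op m l (T.comp b.1 a.1) = op n l b.1 * op m n a.1 :=
      Subtype.ext (fockOp_comp b.1 a.1)
    exact (congrArg f h).trans (map_mul f _ _)
  · have h : op m n a.1 * op l (m + k) b.1 = op l (n + k) (T.comp (tensorPow k a.1) b.1) :=
      Subtype.ext (fockOp_mul_fockOp a.1 b.1)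
    exact (map_mul f _ _).symm.trans (congrArg f h)
  · change f (op m n a) = f (op (m + 1) (n + 1) (T.tensor a))
    rw [← sub_eq_zero, ← map_sub]
    refine (hf _).2 ?_
    have := corner_mem ha
    rwa [corner_eq_sub] at this
  · have := heq _ _ h
    exact ⟨tensorPow_eq_of_sub_mem hJ this, fun j hj => tensorPow_mem_of_sub_mem this hj⟩

end Detect

end RightTensorCStarPrecategory

end
-- Part (A): faithfulness, transfer actions and spectral subspaces.
noncomputable section

namespace RightTensorCStarPrecategory

variable {T : RightTensorCStarPrecategory.{u}} {K J : T.Ideal}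

theorem eq_zero_of_comp_adj_comp_self {n m : ℕ} {d : T.Hom n m}
    (h : T.comp d (T.comp (T.adj d) d) = 0) : d = 0 := by
  refine eq_zero_of_adj_comp_self (eq_zero_of_adj_comp_self ?_)
  rw [T.adj_comp, T.adj_adj, T.comp_assoc, h, comp_zero]

/-- The annihilator is tested only on endomorphisms, so `d* d` is used: it lies in the kernel,
giving `d d* d = 0`. -/
theorem eq_zero_of_mem_annihilator {n m : ℕ} {d : T.Hom n m}
    (h : d ∈ annihilator (tensorKer (T := T)) n m) (hd : T.tensor d = 0) : d = 0 := by
  refine eq_zero_of_comp_adj_comp_self (h _ ?_)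
  change T.tensor _ = 0
  rw [T.tensor_comp, hd, comp_zero]

/-- Coisometry gives `i(c) = i(c ⊗ 1) = 0`. -/
theorem tensor_ne_zero_of_isFaithful (hJ : ∀ n m, J.space n m ≤ idealJ K n m)
    (hf : (universalRep K J).IsFaithful) :
    ∀ n m, ∀ c ∈ J.space n m, T.tensor c = 0 → c = 0 := by
  intro n m c hc h
  obtain ⟨h1, h2⟩ := hJ n m hc
  have h3 := universalRep_coisometric K J m n c hc h1 h2
  have h4 : (⟨T.tensor c, h2⟩ : K.space (n + 1) (m + 1)) = 0 := Subtype.ext h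
  rw [h4, map_zero] at h3
  exact congrArg Subtype.val (hf m n (h3.trans (map_zero _).symm))

theorem mem_annihilator_of_mem (hJ : ∀ n m, ∀ c ∈ J.space n m, T.tensor c = 0 → c = 0) {n m : ℕ}
    {a : T.Hom n m} (ha : a ∈ J.space n m) : a ∈ annihilator (tensorKer (T := T)) n m := by
  intro b hb
  refine hJ _ _ _ (J.comp_mem_right _ ha) ?_
  rw [T.tensor_comp, show T.tensor b = 0 from hb, comp_zero]

/-- `i(a)` has degree `k`, so it equals `i(a')` for some `a' ∈ K(0,k)`. Detection with `r = m + 1`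
gives `a = a' ⊗ 1^(m+1)`, and its last membership, `j = m`, puts `b = a' ⊗ 1^m` in `J`. -/
theorem exists_mem_tensor_eq_zero_add (hJ : ∀ n m, ∀ c ∈ J.space n m, T.tensor c = 0 → c = 0)
    (hs : ∀ k : ℕ, LinearMap.range ((universalRep K J).toFun k 0) = spectralSubspace K J k)
    (m k : ℕ) (a : K.space (0 + m + 1) (k + m + 1)) :
    ∃ b ∈ J.space (0 + m) (k + m), T.tensor b = a := by
  obtain ⟨C, _, ρ, hρ, hρ'⟩ := exists_detecting_representation K J hJ
  obtain ⟨Φ, hΦ⟩ := exists_lift ρ hρ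
  have h : (universalRep K J).toFun (k + m + 1) (0 + m + 1) a ∈ spectralSubspace K J k := by
    intro z
    rw [gauge_universalRep]
    congr 2
    push_cast
    ring
  rw [← hs] at h
  obtain ⟨a', ha'⟩ := h
  have h' := congrArg Φ ha'
  rw [hΦ, hΦ] at h'
  obtain ⟨h1, h2⟩ := hρ' k 0 (m + 1) a' a h'
  exact ⟨_, h2 m (Nat.lt_succ_self m), h1⟩

theorem exists_mem_tensor_eq (hJ : ∀ n m, ∀ c ∈ J.space n m, T.tensor c = 0 → c = 0)
    (hs : ∀ k : ℕ, LinearMap.range ((universalRep K J).toFun k 0) = spectralSubspace K J k)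
    (m n : ℕ) (a : K.space (m + 1) (n + 1)) : ∃ b ∈ J.space m n, T.tensor b = a := by
  have h : ∀ (m k : ℕ) (a : K.space (m + 1) (k + m + 1)),
      ∃ b ∈ J.space m (k + m), T.tensor b = a := by
    intro m k
    have := exists_mem_tensor_eq_zero_add hJ hs m k
    rwa [Nat.zero_add] at this
  rcases le_total m n with hmn | hmn
  · obtain ⟨k, rfl⟩ := Nat.exists_eq_add_of_le' hmn
    exact h m k a
  · obtain ⟨k, rfl⟩ := Nat.exists_eq_add_of_le' hmn
    obtain ⟨b, hb, hb'⟩ := h n k ⟨T.adj a.1, K.adj_mem a.2⟩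
    exact ⟨T.adj b, J.adj_mem hb, by rw [T.tensor_adj, hb', T.adj_adj]⟩

/-- Since `⊗ 1` maps `J` injectively onto all of `K(n+1,m+1)`, its inverse is the transfer action.
An `a` in `J(K) ∩ (ker ⊗ 1)^⊥` equals the `c ∈ J` with `c ⊗ 1 = a ⊗ 1`, because `a - c` is both in
the kernel and in its annihilator. -/
theorem eq_and_admitsTransferAction (hJK : ∀ n m, J.space n m ≤ idealJ K n m)
    (hf : (universalRep K J).IsFaithful)
    (hs : ∀ k : ℕ, LinearMap.range ((universalRep K J).toFun k 0) = spectralSubspace K J k) :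
    (∀ n m, J.space n m = idealJ K n m ⊓ annihilator (tensorKer (T := T)) n m) ∧
      AdmitsTransferAction K := by
  have hJ := tensor_ne_zero_of_isFaithful hJK hf
  have hex := exists_mem_tensor_eq hJ hs
  refine ⟨fun n m => le_antisymm (le_inf (hJK n m) fun a => mem_annihilator_of_mem hJ) ?_, ?_⟩
  · rintro a ⟨⟨h1, h2⟩, h3⟩
    obtain ⟨c, hc, hca⟩ := hex n m ⟨T.tensor a, h2⟩
    have h4 : a - c = 0 := by
      refine eq_zero_of_mem_annihilator (sub_mem h3 (mem_annihilator_of_mem hJ hc)) ?_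
      rw [map_sub, hca, sub_self]
    rwa [sub_eq_zero.1 h4]
  · choose L hL hL' using fun m n => hex m n
    refine ⟨⟨fun {n m} a => ⟨L n m a, (hJK n m (hL n m a)).1⟩, fun a => hL' _ _ a,
      fun {k n m} a b => sub_eq_zero.1 (hJ k m _ (sub_mem (hL _ _ _)
        (J.comp_mem_right _ (hL _ _ _))) ?_)⟩⟩
    rw [map_sub, T.tensor_comp, hL', hL', sub_self]

/-- The point is that `L(a)` annihilates the kernel of `⊗ 1`; this is the second law of a transfer
action, `L(a (b ⊗ 1)) = L(a) b`. -/
theorem exists_mem_eq_of_transferAction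
    (hJ : ∀ n m, J.space n m = idealJ K n m ⊓ annihilator (tensorKer (T := T)) n m)
    (L : TransferAction K) {n m : ℕ} (a : K.space (n + 1) (m + 1)) :
    (L.toFun a : T.Hom n m) ∈ J.space n m := by
  -- `L` is not assumed linear; `L(0) = L(0 (0 ⊗ 1)) = L(0) 0 = 0` comes from the second law.
  have h0 : ∀ {n m : ℕ}, (L.toFun (0 : K.space (n + 1) (m + 1)) : T.Hom n m) = 0 := by
    intro n m
    have h := L.toFun_comp_tensor (0 : K.space (n + 1) (m + 1)) (0 : K.space n n)
    have e : (⟨T.comp ((0 : K.space (n + 1) (m + 1)) : T.Hom (n + 1) (m + 1))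
        (T.tensor ((0 : K.space n n) : T.Hom n n)), K.comp_mem_right _ (zero_mem _)⟩ :
          K.space (n + 1) (m + 1)) = 0 := Subtype.ext (zero_comp _)
    rw [e] at h
    exact h.trans (comp_zero _)
  rw [hJ]
  refine ⟨⟨(L.toFun a).2, ?_⟩, fun b hb => ?_⟩
  · change T.tensor _ ∈ K.space _ _
    rw [L.tensor_toFun]; exact a.2
  · set d := T.comp (L.toFun a : T.Hom n m) b with hd
    have hdK : d ∈ K.space n m := K.comp_mem_right _ (L.toFun a).2
    refine eq_zero_of_comp_adj_comp_self ?_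
    -- The law is available only for factors in `K`, so `b` is first multiplied by `d* d`; this
    -- yields `d d* d = 0`, which suffices.
    have hb' : T.comp b (T.comp (T.adj d) d) ∈ K.space n n :=
      K.comp_mem_left _ (K.comp_mem_left _ hdK)
    have h := L.toFun_comp_tensor a ⟨_, hb'⟩
    have e : (⟨T.comp (a : T.Hom (n + 1) (m + 1)) (T.tensor (T.comp b (T.comp (T.adj d) d))),
        K.comp_mem_right _ a.2⟩ : K.space (n + 1) (m + 1)) = 0 := Subtype.ext (by
      change T.comp _ _ = 0
      rw [T.tensor_comp, show T.tensor b = 0 from hb, zero_comp, comp_zero])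
    rw [e, h0] at h
    rw [hd, T.comp_assoc, ← hd]
    exact h.symm

theorem Representation.norm_eq {B : Type u} [NonUnitalCStarAlgebra B] {π : Representation K B}
    (hπ : π.IsFaithful) (n m : ℕ) (a : K.space m n) : ‖π.toFun n m a‖ = ‖a‖ := by
  let ρ : Diag K m →⋆ₙₐ[ℂ] B :=
    { toFun := π.toFun m m
      map_smul' := fun c x => map_smul (π.toFun m m) c x
      map_zero' := map_zero (π.toFun m m)
      map_add' := fun x y => map_add (π.toFun m m) x y
      map_mul' := fun x y => π.map_comp m m m x y
      map_star' := fun x => π.map_adj m m x }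
  let c : Diag K m := ⟨T.comp (T.adj (a : T.Hom m n)) a, K.comp_mem_left _ a.2⟩
  have h1 : ρ c = star (π.toFun n m a) * π.toFun n m a := by
    rw [← π.map_adj, ← π.map_comp]
    rfl
  have h2 : ‖c‖ = ‖a‖ ^ 2 := T.norm_adj_comp_self (a : T.Hom m n)
  refine (sq_eq_sq₀ (norm_nonneg _) (norm_nonneg _)).1 ?_
  rw [← h2, sq, ← CStarRing.norm_star_mul_self, ← h1]
  have hρ : Function.Injective ρ := hπ m m
  exact NonUnitalStarAlgHom.norm_map ρ hρ c

/-- The case `r = 0` of detection, comparing with the zero morphism. -/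
theorem isFaithful_universalRep (hJ : ∀ n m, ∀ c ∈ J.space n m, T.tensor c = 0 → c = 0) :
    (universalRep K J).IsFaithful := by
  obtain ⟨C, _, ρ, hρ, hρ'⟩ := exists_detecting_representation K J hJ
  obtain ⟨Φ, hΦ⟩ := exists_lift ρ hρ
  intro p q
  refine (injective_iff_map_eq_zero _).2 fun a ha => ?_
  have h : ρ.toFun p q a = ρ.toFun (p + 0) (q + 0) 0 := by
    rw [← hΦ, ha, map_zero, map_zero]
  exact Subtype.ext (hρ' p q 0 a 0 h).1

/-- Under `h1` and `h2` the images of `K(0,k)` and `K(k,0)` already span a dense subspace, so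
averaging applies. Faithfulness makes the range of `K(0,k)` closed. -/
theorem spectralSubspace_eq_range (hf : (universalRep K J).IsFaithful)
    (h1 : ∀ k m, LinearMap.range ((universalRep K J).toFun (k + m) m) ≤
      LinearMap.range ((universalRep K J).toFun k 0))
    (h2 : ∀ k m, LinearMap.range ((universalRep K J).toFun m (k + m)) ≤
      LinearMap.range ((universalRep K J).toFun 0 k)) (k : ℕ) :
    LinearMap.range ((universalRep K J).toFun k 0) = spectralSubspace K J k := by
  refine le_antisymm ?_ fun x hx => ?_
  · rintro _ ⟨a, rfl⟩ z
    rw [gauge_universalRep]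
    congr 2
  let N : ℤ → Submodule ℂ (universalAlgebra K J)
    | Int.ofNat k => LinearMap.range ((universalRep K J).toFun k 0)
    | Int.negSucc k => LinearMap.range ((universalRep K J).toFun 0 (k + 1))
  refine mem_of_spectral (k := (k : ℤ)) (N := N)
    (fun z => (gauge K J z : universalAlgebra K J →ₗ[ℂ] universalAlgebra K J))
    (fun z x => NonUnitalStarAlgHom.norm_apply_le (gauge K J z) x) ?_ (fun y => ?_) ?_ hx
  · rintro (d | d) _ ⟨a, rfl⟩ z
    · refine (gauge_universalRep _ _ _ _ _ _).trans ?_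
      congr 2
    · refine (gauge_universalRep _ _ _ _ _ _).trans ?_
      congr 2
  · let W : Set (universalAlgebra K J) := {x | ∃ n m a, x = (universalRep K J).toFun n m a}
    have hstar : ∀ x ∈ W, star x ∈ W := by
      rintro _ ⟨n, m, a, rfl⟩
      exact ⟨m, n, _, ((universalRep K J).map_adj n m a).symm⟩
    have hmul' : ∀ n m k l (a : K.space m n) (b : K.space l (m + k)),
        (universalRep K J).toFun n m a * (universalRep K J).toFun (m + k) l b ∈ W :=
      fun n m k l a b => ⟨_, _, _, (universalRep K J).map_tensor n m k l a b⟩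
    have hmem := (relations K J).mem_closure_span W (fun g => ⟨_, _, _, rfl⟩) ?_ hstar y
    · refine closure_mono (Submodule.span_le.2 ?_) hmem
      rintro _ ⟨n, m, a, rfl⟩
      rcases le_total m n with h | h
      · obtain ⟨k, rfl⟩ := Nat.exists_eq_add_of_le' h
        exact Submodule.mem_iSup_of_mem (Int.ofNat k) (h1 k m ⟨a, rfl⟩)
      · obtain ⟨k, rfl⟩ := Nat.exists_eq_add_of_le' h
        have h3 := h2 k n ⟨a, rfl⟩
        rcases k with _ | k
        · exact Submodule.mem_iSup_of_mem (Int.ofNat 0) h3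
        · exact Submodule.mem_iSup_of_mem (Int.negSucc k) h3
    · rintro _ ⟨n, m, a, rfl⟩ _ ⟨m', l, b, rfl⟩
      rcases le_total m m' with h | h
      · obtain ⟨k, rfl⟩ := Nat.exists_eq_add_of_le h
        exact hmul' n m k l a b
      · obtain ⟨k, rfl⟩ := Nat.exists_eq_add_of_le h
        -- The product formula covers `a b` when the source of `a` is at most the target of `b`;
        -- adjoints exchange the two cases.
        rw [← star_star (_ * _), star_mul]
        refine hstar _ ?_
        rw [← (universalRep K J).map_adj, ← (universalRep K J).map_adj]
        exact hmul' _ _ _ _ _ _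
  · let f : K.space 0 k →ₗᵢ[ℂ] universalAlgebra K J :=
      ⟨(universalRep K J).toFun k 0, Representation.norm_eq hf k 0⟩
    have : CompleteSpace (K.space 0 k) := (K.isClosed 0 k).completeSpace_coe
    exact f.isometry.isClosedEmbedding.isClosed_range

/-- Faithfulness and spectral subspaces of the universal representation. -/
theorem isFaithful_and_spectralSubspace_iff (hJK : ∀ n m, J.space n m ≤ idealJ K n m) :
    ((universalRep K J).IsFaithful ∧
      ∀ k : ℕ, LinearMap.range ((universalRep K J).toFun k 0) = spectralSubspace K J k) ↔
    ((∀ n m, J.space n m = idealJ K n m ⊓ annihilator (tensorKer (T := T)) n m) ∧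
      AdmitsTransferAction K) := by
  refine ⟨fun h => eq_and_admitsTransferAction hJK h.1 h.2, ?_⟩
  rintro ⟨hJ, ⟨L⟩⟩
  have hf : (universalRep K J).IsFaithful := isFaithful_universalRep fun n m c hc h => by
    rw [hJ] at hc
    exact eq_zero_of_mem_annihilator hc.2 h
  -- `L(a) ∈ J` and `L(a) ⊗ 1 = a`, so coisometry lowers both indices by one without changing the
  -- image.
  have hco : ∀ n m (a : K.space (m + 1) (n + 1)),
      (universalRep K J).toFun n m (L.toFun a) = (universalRep K J).toFun (n + 1) (m + 1) a := by
    intro n m a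
    have h1 := exists_mem_eq_of_transferAction hJ L a
    refine (universalRep_coisometric K J n m _ h1 (L.toFun a).2 (hJK _ _ h1).2).trans ?_
    congr 1
    exact Subtype.ext (L.tensor_toFun a)
  refine ⟨hf, spectralSubspace_eq_range hf (fun k m => ?_) fun k m => ?_⟩
  · induction m with
    | zero => exact le_rfl
    | succ m ih =>
      refine le_trans ?_ ih
      rintro _ ⟨a, rfl⟩
      exact ⟨_, hco (k + m) m a⟩
  · induction m with
    | zero => exact le_rfl
    | succ m ih =>
      refine le_trans ?_ ih
      rintro _ ⟨a, rfl⟩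
      exact ⟨_, hco m (k + m) a⟩

end RightTensorCStarPrecategory

end
noncomputable section

open scoped InnerProductSpace

/-! ### Contractivity of representations on modules with a positive form. -/

section FormKernel

variable {A : Type u} [NonUnitalCStarAlgebra A] {V : Type u} [AddCommGroup V] [Module ℂ V]

/-- The kernel given by an algebra valued positive form and a positive functional. -/
def formKernel (Q : V →ₗ⋆[ℂ] V →ₗ[ℂ] A) (hs : ∀ x y, star (Q x y) = Q y x)
    (hp : ∀ x, ∃ b, Q x x = star b * b) (ω : PosFunctional A) : PosKernel V where
  k x y := ω.toCLM (Q x y)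
  conj_symm x y := by rw [← ω.map_star, hs]
  nonneg ξ := by
    have h : (ξ.sum fun x c => ξ.sum fun y d => star c * d * ω.toCLM (Q x y)) =
        ω.toCLM (Q (ξ.sum fun x c => c • x) (ξ.sum fun x c => c • x)) := by
      simp only [Finsupp.sum, map_sum, LinearMap.sum_apply, LinearMap.map_smulₛₗ,
        LinearMap.smul_apply, map_smul, smul_eq_mul]
      rw [Finset.sum_comm]
      refine Finset.sum_congr rfl fun y _ => ?_
      rw [Finset.mul_sum]
      refine Finset.sum_congr rfl fun x _ => ?_
      rw [mul_comm (star _), mul_assoc]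
      rfl
    obtain ⟨b, hb⟩ := hp (ξ.sum fun x c => c • x)
    rw [h, hb]
    exact ω.nonneg b

/-- *-representations of C*-algebras on modules with a positive form are contractive. -/
theorem re_form_le_of_rep (Q : V →ₗ⋆[ℂ] V →ₗ[ℂ] A) (hs : ∀ x y, star (Q x y) = Q y x)
    (hp : ∀ x, ∃ b, Q x x = star b * b) (ω : PosFunctional A) {D : Type*}
    [NonUnitalCStarAlgebra D] (σ : D →ₗ[ℂ] V →ₗ[ℂ] V) (hmul : ∀ d e x, σ (d * e) x = σ d (σ e x))
    (hstar : ∀ d x y, Q (σ d x) y = Q x (σ (star d) y)) (d : D) (x : V) :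
    ‖ω.toCLM (Q x (σ d x))‖ ≤ ‖d‖ * (ω.toCLM (Q x x)).re ∧
    (ω.toCLM (Q (σ d x) (σ d x))).re ≤ ‖d‖ ^ 2 * (ω.toCLM (Q x x)).re := by
  obtain ⟨S, hS, hS'⟩ := (formKernel Q hs hp ω).exists_op_of_rep (fun d x => σ d x)
    (fun x y => ω.toCLM.toLinearMap ∘ₗ Q x ∘ₗ σ.flip y) (fun _ _ _ => rfl)
    (fun x y d e => congrArg (fun z => ω.toCLM (Q x z)) (hmul d e y))
    (fun x y d => congrArg ω.toCLM (hstar d x y)) d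
  have h1 : ‖S ((formKernel Q hs hp ω).vec x)‖ ≤ ‖d‖ * ‖(formKernel Q hs hp ω).vec x‖ :=
    (S.le_opNorm _).trans (by gcongr)
  constructor
  · have h2 : ω.toCLM (Q x (σ d x)) = ⟪(formKernel Q hs hp ω).vec x,
        S ((formKernel Q hs hp ω).vec x)⟫_ℂ := by
      rw [hS', PosKernel.inner_vec]; rfl
    have h3 : ‖(formKernel Q hs hp ω).vec x‖ ^ 2 = (ω.toCLM (Q x x)).re :=
      PosKernel.norm_vec_sq _ _
    rw [h2, ← h3]
    calc _ ≤ ‖(formKernel Q hs hp ω).vec x‖ * ‖S ((formKernel Q hs hp ω).vec x)‖ :=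
          norm_inner_le_norm _ _
      _ ≤ ‖(formKernel Q hs hp ω).vec x‖ * (‖d‖ * ‖(formKernel Q hs hp ω).vec x‖) := by gcongr
      _ = _ := by ring
  · have h4 := pow_le_pow_left₀ (norm_nonneg _) h1 2
    rw [mul_pow, hS', PosKernel.norm_vec_sq, PosKernel.norm_vec_sq] at h4
    exact h4

end FormKernel

/-! ### Norms on correspondences and Hilbert bimodules, and the dual bimodule. -/

namespace CStarCorrespondence

variable {A : Type u} [NonUnitalCStarAlgebra A] {E : CStarCorrespondence A}

theorem eq_zero_of_inner_self {x : E.X} (h : E.inner x x = 0) : x = 0 := by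
  have := E.norm_sq x
  rw [h, norm_zero] at this
  exact norm_eq_zero.1 (pow_eq_zero_iff two_ne_zero |>.1 this)

theorem ext_inner {x y : E.X} (h : ∀ z, E.inner z x = E.inner z y) : x = y := by
  refine sub_eq_zero.1 (eq_zero_of_inner_self ?_)
  rw [map_sub, h, sub_self]

theorem φ_mul_apply (a b : A) (x : E.X) : E.φ (a * b) x = E.φ a (E.φ b x) := by
  rw [map_mul]; rfl

/-- The left action as a bilinear map. -/
def φₗ (E : CStarCorrespondence A) : A →ₗ[ℂ] E.X →ₗ[ℂ] E.X where
  toFun a := (E.φ a : E.X →ₗ[ℂ] E.X)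
  map_add' a b := by rw [map_add]; rfl
  map_smul' c a := by rw [map_smul]; rfl

/-- Contractivity of the left action is not an axiom. It is seen through a positive functional that
norms `⟨φ(a) x, φ(a) x⟩`. -/
theorem norm_φ_apply_le (a : A) (x : E.X) : ‖E.φ a x‖ ≤ ‖a‖ * ‖x‖ := by
  obtain ⟨b, hb⟩ := E.inner_self_pos (E.φ a x)
  obtain ⟨ω, hω⟩ := exists_posFunctional b
  have h := (re_form_le_of_rep E.inner E.star_inner E.inner_self_pos ω E.φₗ φ_mul_apply
    E.inner_φ a x).2
  change (ω.toCLM (E.inner (E.φ a x) (E.φ a x))).re ≤ _ at h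
  rw [hb, hω] at h
  have h1 : ‖E.φ a x‖ ^ 2 = ‖b‖ ^ 2 := by
    rw [E.norm_sq, hb, CStarRing.norm_star_mul_self, sq]
  refine le_of_sq_le_sq ?_ (by positivity)
  rw [h1, mul_pow, E.norm_sq x]
  refine h.trans ?_
  gcongr
  exact (Complex.re_le_norm _).trans (ω.norm_le _)

theorem norm_φ_le (a : A) : ‖E.φ a‖ ≤ ‖a‖ :=
  ContinuousLinearMap.opNorm_le_bound _ (norm_nonneg a) (norm_φ_apply_le a)

theorem φ_star_eq_zero {a : A} (h : E.φ a = 0) : E.φ (star a) = 0 := by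
  refine ContinuousLinearMap.ext fun x => ext_inner fun z => ?_
  rw [← E.inner_φ, h]
  simp

namespace LeftInner

variable (L : E.LeftInner)

theorem right (a : A) (x y : E.X) : L.toFun x (E.φ a y) = L.toFun x y * star a := by
  rw [← L.star_toFun, L.left, star_mul, L.star_toFun]

theorem φ_toFun (x y : E.X) : E.φ (L.toFun x y) = E.theta x y :=
  ContinuousLinearMap.ext fun z => (L.imprimitivity x y z).symm

theorem mul_toFun_eq_zero {d : A} (h : E.φ d = 0) (x y : E.X) : d * L.toFun x y = 0 := by
  rw [← L.left, h]
  simp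

theorem toFun_mul_eq_zero {d : A} (h : E.φ d = 0) (x y : E.X) : L.toFun x y * d = 0 := by
  refine star_injective ?_
  rw [star_mul, L.star_toFun, L.mul_toFun_eq_zero (φ_star_eq_zero h), star_zero]

/-- Both sides act on `X` in the same way by imprimitivity, so their difference `d` lies in `ker φ`.
Left inner products annihilate `ker φ`, whence `d d* = 0`. -/
theorem toFun_ract (x y : E.X) (a : A) :
    L.toFun (E.ract x a) y = L.toFun x (E.ract y (star a)) := by
  have h1 : E.φ (L.toFun (E.ract x a) y - L.toFun x (E.ract y (star a))) = 0 := by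
    refine ContinuousLinearMap.ext fun z => ?_
    rw [map_sub, sub_apply, ← L.imprimitivity, ← L.imprimitivity, E.inner_ract_left, star_star,
      E.ract_mul, sub_self]
    rfl
  refine sub_eq_zero.1 ((CStarRing.mul_star_self_eq_zero_iff _).1 ?_)
  rw [star_sub, L.star_toFun, L.star_toFun, mul_sub, L.mul_toFun_eq_zero h1,
    L.mul_toFun_eq_zero h1, sub_zero]

/-- The form `(x, y) ↦ L(y, x)`. -/
def form : E.X →ₗ⋆[ℂ] E.X →ₗ[ℂ] A :=
  LinearMap.mk₂'ₛₗ (starRingEnd ℂ) (RingHom.id ℂ) (fun x y => L.toFun y x)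
    (fun x x' y => map_add _ _ _) (fun c x y => LinearMap.map_smulₛₗ _ _ _)
    (fun x y y' => by rw [map_add, LinearMap.add_apply])
    (fun c x y => by rw [map_smul, LinearMap.smul_apply, RingHom.id_apply])

/-- Both estimates use `x⟨x,x⟩ = L(x,x) x`. The right action is a *-representation of `Aᵐᵒᵖ` for the
left form, hence contractive, giving `‖L(x,x)‖² ≤ ‖x‖² ‖L(x,x)‖`. Conversely `‖x‖³ = ‖x⟨x,x⟩‖ ≤
‖L(x,x)‖ ‖x‖`. -/
theorem norm_toFun_self (x : E.X) : ‖L.toFun x x‖ = ‖x‖ ^ 2 := by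
  apply le_antisymm
  · rcases (norm_nonneg (L.toFun x x)).eq_or_lt with h0 | h0
    · rw [← h0]; positivity
    obtain ⟨ω, hω⟩ := exists_posFunctional (L.toFun x x)
    let σ : Aᵐᵒᵖ →ₗ[ℂ] E.X →ₗ[ℂ] E.X :=
      E.ract.flip ∘ₗ (MulOpposite.opLinearEquiv ℂ : A ≃ₗ[ℂ] Aᵐᵒᵖ).symm.toLinearMap
    have h := (re_form_le_of_rep L.form (fun x y => L.star_toFun y x) L.self_pos ω σ
      (fun d e x => E.ract_mul x e.unop d.unop)
      (fun d x y => by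
        change L.toFun y (E.ract x d.unop) = L.toFun (E.ract y (star d.unop)) x
        rw [L.toFun_ract, star_star])
      (MulOpposite.op (E.inner x x)) x).1
    change ‖ω.toCLM (L.toFun (E.ract x (E.inner x x)) x)‖ ≤ _ * (ω.toCLM (L.toFun x x)).re at h
    rw [L.imprimitivity, L.left, MulOpposite.norm_op, ← E.norm_sq] at h
    rw [L.star_toFun] at hω
    have h1 : ‖L.toFun x x‖ ^ 2 ≤ ‖x‖ ^ 2 * ‖L.toFun x x‖ := by
      rw [← hω]
      refine ((Complex.re_le_norm _).trans h).trans ?_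
      gcongr
      exact (Complex.re_le_norm _).trans (ω.norm_le _)
    rw [sq] at h1
    exact le_of_mul_le_mul_right h1 h0
  · rcases (norm_nonneg x).eq_or_lt with h0 | h0
    · rw [← h0]; simp
    -- The left side is `‖h³‖` with `h = ⟨x,x⟩` self-adjoint; its value is squeezed out of `‖h⁴‖ =
    -- ‖h‖⁴`.
    have h1 : ‖E.ract x (E.inner x x)‖ ^ 2 = ‖x‖ ^ 6 := by
      set h := E.inner x x with hh
      have hs : star h = h := E.star_inner x x
      have h2 : ‖h * h‖ = ‖h‖ * ‖h‖ := by
        have := CStarRing.norm_star_mul_self (x := h)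
        rwa [hs] at this
      have h4 : ‖h * h * (h * h)‖ = ‖h‖ ^ 4 := by
        have : ‖star (h * h) * (h * h)‖ = ‖h‖ ^ 4 := by
          rw [CStarRing.norm_star_mul_self, h2]; ring
        rwa [star_mul, hs] at this
      have h3 : ‖h * h * h‖ = ‖h‖ ^ 3 := by
        apply le_antisymm
        · calc ‖h * h * h‖ ≤ ‖h‖ * ‖h‖ * ‖h‖ :=
                (norm_mul_le _ _).trans (by gcongr; exact norm_mul_le _ _)
            _ = _ := by ring
        · have hpos : 0 < ‖h‖ := by rw [hh, ← E.norm_sq]; positivity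
          refine le_of_mul_le_mul_right ?_ hpos
          rw [← pow_succ, ← h4, ← mul_assoc]
          exact norm_mul_le _ _
      rw [E.norm_sq, E.inner_ract, E.inner_ract_left, ← hh, hs, h3, hh, ← E.norm_sq]
      ring
    have h2 : ‖E.ract x (E.inner x x)‖ = ‖x‖ ^ 2 * ‖x‖ := by
      refine (sq_eq_sq₀ (norm_nonneg _) (by positivity)).1 ?_
      rw [h1]; ring
    have h3 := norm_φ_apply_le (E := E) (L.toFun x x) x
    rw [← L.imprimitivity, h2] at h3
    exact le_of_mul_le_mul_right h3 h0

variable (E) in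
/-- The conjugate of the space of a correspondence. -/
def Conj : Type u := E.X

instance : NormedAddCommGroup (Conj E) := inferInstanceAs (NormedAddCommGroup E.X)
instance : CompleteSpace (Conj E) := inferInstanceAs (CompleteSpace E.X)

instance : Module ℂ (Conj E) where
  smul c x := (star c • (show E.X from x) : E.X)
  one_smul x := by change star (1 : ℂ) • (show E.X from x) = x; rw [star_one, one_smul]
  mul_smul c d x := by
    change star (c * d) • (show E.X from x) = star c • star d • (show E.X from x)
    rw [star_mul', mul_smul]
  smul_zero c := by change star c • (0 : E.X) = (0 : E.X); exact smul_zero _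
  smul_add c x y := by
    change star c • ((show E.X from x) + (show E.X from y)) =
      star c • (show E.X from x) + star c • (show E.X from y)
    exact smul_add _ _ _
  add_smul c d x := by
    change star (c + d) • (show E.X from x) = star c • (show E.X from x) + star d • (show E.X from x)
    rw [star_add, add_smul]
  zero_smul x := by change star (0 : ℂ) • (show E.X from x) = 0; rw [star_zero, zero_smul]

instance : NormedSpace ℂ (Conj E) where
  norm_smul_le c x := by
    change ‖star c • (show E.X from x)‖ ≤ _
    rw [norm_smul, norm_star]
    exact le_rfl

variable (E) in
def conj : E.X →ₗ⋆[ℂ] Conj E where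
  toFun x := x
  map_add' _ _ := rfl
  map_smul' c x := by
    change c • x = star (star c) • x
    rw [star_star]

variable (E) in
def unconj : Conj E →ₗ⋆[ℂ] E.X where
  toFun x := x
  map_add' _ _ := rfl
  map_smul' _ _ := rfl

theorem unconj_conj (x : E.X) : unconj E (conj E x) = x := rfl

/-- The dual Hilbert bimodule. -/
def dual : CStarCorrespondence A where
  X := Conj E
  ract := LinearMap.mk₂ ℂ (fun x a => conj E (E.φ (star a) (unconj E x)))
    (fun x y a => by simp only [map_add])
    (fun c x a => by simp only [LinearMap.map_smulₛₗ, map_smul, RingHomCompTriple.comp_apply]; simp)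
    (fun x a b => by simp only [star_add, map_add, add_apply])
    (fun c x a => by simp only [star_smul, map_smul, smul_apply, LinearMap.map_smulₛₗ]; simp)
  inner := LinearMap.mk₂'ₛₗ (starRingEnd ℂ) (RingHom.id ℂ)
    (fun x y => L.toFun (unconj E x) (unconj E y))
    (fun x y a => by simp only [map_add, LinearMap.add_apply])
    (fun c x a => by simp only [LinearMap.map_smulₛₗ, map_smul, LinearMap.smul_apply])
    (fun x a b => by simp only [map_add])
    (fun c x a => by simp only [LinearMap.map_smulₛₗ]; simp)
  ract_mul x a b := by
    simp only [LinearMap.mk₂_apply, star_mul, φ_mul_apply, unconj_conj]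
  inner_ract x y a := by
    simp only [LinearMap.mk₂_apply, LinearMap.mk₂'ₛₗ_apply, unconj_conj, L.right, star_star]
  star_inner x y := L.star_toFun _ _
  inner_self_pos x := L.self_pos _
  norm_sq x := (L.norm_toFun_self (unconj E x)).symm
  φ :=
    { toFun := fun a => LinearMap.mkContinuous
        { toFun := fun x => conj E (E.ract (unconj E x) (star a))
          map_add' := fun x y => by simp only [map_add, LinearMap.add_apply]
          map_smul' := fun c x => by
            simp only [LinearMap.map_smulₛₗ, map_smul, LinearMap.smul_apply]; simp } ‖a‖ (fun x => by
          refine (E.norm_ract_le (unconj E x) (star a)).trans ?_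
          rw [norm_star, mul_comm]; rfl)
      map_smul' := fun c a => ContinuousLinearMap.ext fun x => by
        change conj E (E.ract _ _) = c • conj E (E.ract _ _)
        rw [star_smul, map_smul, LinearMap.map_smulₛₗ]; simp
      map_zero' := ContinuousLinearMap.ext fun x => by
        change conj E (E.ract _ _) = 0
        rw [star_zero, map_zero, map_zero]
      map_add' := fun a b => ContinuousLinearMap.ext fun x => by
        change conj E (E.ract _ _) = conj E (E.ract _ _) + conj E (E.ract _ _)
        rw [star_add, map_add, map_add]
      map_mul' := fun a b => ContinuousLinearMap.ext fun x => by
        change conj E (E.ract _ _) = conj E (E.ract (E.ract _ _) _)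
        rw [star_mul, E.ract_mul] }
  inner_φ a x y := (L.toFun_ract _ _ _)

/-- Cauchy–Schwarz in the dual, where the left inner product is the right one. -/
theorem norm_toFun_le (x y : E.X) : ‖L.toFun x y‖ ≤ ‖x‖ * ‖y‖ := L.dual.norm_inner_le x y

/-- The closed ideal generated by the left inner products. -/
def ideal : Submodule ℂ A :=
  (Submodule.span ℂ {a | ∃ x y, a = L.toFun x y}).topologicalClosure

end LeftInner

end CStarCorrespondence

end
-- The ideal of left inner products.
noncomputable section

namespace CStarCorrespondence

variable {A : Type u} [NonUnitalCStarAlgebra A] {E : CStarCorrespondence A}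

theorem isClosed_kerPerp : IsClosed (E.kerPerp : Set A) := by
  have : (E.kerPerp : Set A) = ⋂ b ∈ {b | E.φ b = 0}, {a | a * b = 0} := by
    ext a; simp only [Set.mem_iInter]; rfl
  rw [this]
  exact isClosed_biInter fun b _ => isClosed_eq (continuous_mul_const b) continuous_const

theorem continuous_φ : Continuous E.φ :=
  AddMonoidHomClass.continuous_of_bound E.φ 1 fun a => by rw [one_mul]; exact norm_φ_le a

theorem isClosed_J : IsClosed (E.J : Set A) :=
  (Submodule.isClosed_topologicalClosure _).preimage (continuous_φ (E := E))

/-- `a - b` annihilates the kernel, which contains `(a - b)*`. -/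
theorem eq_of_mem_kerPerp {a b : A} (ha : a ∈ E.kerPerp) (hb : b ∈ E.kerPerp)
    (h : E.φ a = E.φ b) : a = b := by
  have h1 : E.φ (a - b) = 0 := by rw [map_sub, h, sub_self]
  exact sub_eq_zero.1 ((CStarRing.mul_star_self_eq_zero_iff _).1
    (sub_mem ha hb _ (φ_star_eq_zero h1)))

namespace LeftInner

variable (L : E.LeftInner)

theorem toFun_mem_ideal (x y : E.X) : L.toFun x y ∈ L.ideal :=
  Submodule.le_topologicalClosure _ (Submodule.subset_span ⟨x, y, rfl⟩)

theorem ideal_le {N : Submodule ℂ A} (hN : IsClosed (N : Set A)) (h : ∀ x y, L.toFun x y ∈ N) :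
    L.ideal ≤ N := by
  refine Submodule.topologicalClosure_minimal _ (Submodule.span_le.2 ?_) hN
  rintro _ ⟨x, y, rfl⟩
  exact h x y

theorem isClosed_ideal : IsClosed (L.ideal : Set A) := Submodule.isClosed_topologicalClosure _

theorem mul_mem_ideal (a : A) {b : A} (hb : b ∈ L.ideal) : a * b ∈ L.ideal :=
  L.ideal_le (N := L.ideal.comap (LinearMap.mulLeft ℂ a))
    (L.isClosed_ideal.preimage (continuous_const_mul a))
    (fun x y => by
      change a * L.toFun x y ∈ L.ideal
      rw [← L.left]; exact L.toFun_mem_ideal _ _) hb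

theorem ideal_le_kerPerp : L.ideal ≤ E.kerPerp :=
  L.ideal_le isClosed_kerPerp fun x y _ hb => L.toFun_mul_eq_zero hb x y

theorem ideal_le_J : L.ideal ≤ E.J :=
  L.ideal_le isClosed_J fun x y => by
    change E.φ _ ∈ E.compacts
    rw [L.φ_toFun]; exact E.theta_mem x y

/-- `b^n L(x,y) = L(φ(b)^n x, y)`, so these products grow at the rate of `‖φ(b)‖` rather than of
`‖b‖`. The unitization only serves to allow `n = 0`. -/
theorem exists_norm_pow_mul_le (b : A) {c : A}
    (hc : c ∈ Submodule.span ℂ {a | ∃ x y, a = L.toFun x y}) :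
    ∃ C, 0 ≤ C ∧ ∀ n : ℕ, ‖(b : Unitization ℂ A) ^ n * c‖ ≤ C * ‖E.φ b‖ ^ n := by
  induction hc using Submodule.span_induction with
  | mem c hc =>
    obtain ⟨x, y, rfl⟩ := hc
    refine ⟨‖x‖ * ‖y‖, by positivity, fun n => ?_⟩
    have h : ∀ n : ℕ, ∃ x', (b : Unitization ℂ A) ^ n * (L.toFun x y : A) = (L.toFun x' y : A) ∧
        ‖x'‖ ≤ ‖E.φ b‖ ^ n * ‖x‖ := by
      intro n
      induction n with
      | zero => exact ⟨x, by rw [pow_zero, one_mul], by simp⟩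
      | succ n ih =>
        obtain ⟨x', h1, h2⟩ := ih
        refine ⟨E.φ b x', ?_, ?_⟩
        · rw [pow_succ', mul_assoc, h1, ← Unitization.inr_mul, L.left]
        · calc ‖E.φ b x'‖ ≤ ‖E.φ b‖ * ‖x'‖ := (E.φ b).le_opNorm _
            _ ≤ ‖E.φ b‖ * (‖E.φ b‖ ^ n * ‖x‖) := by gcongr
            _ = _ := by ring
    obtain ⟨x', h1, h2⟩ := h n
    rw [h1, Unitization.norm_inr]
    calc _ ≤ ‖x'‖ * ‖y‖ := L.norm_toFun_le x' y
      _ ≤ ‖E.φ b‖ ^ n * ‖x‖ * ‖y‖ := by gcongr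
      _ = _ := by ring
  | zero => exact ⟨0, le_rfl, fun n => by simp⟩
  | add c c' _ _ h h' =>
    obtain ⟨C, hC, h⟩ := h
    obtain ⟨C', hC', h'⟩ := h'
    refine ⟨C + C', add_nonneg hC hC', fun n => ?_⟩
    rw [Unitization.inr_add, mul_add, add_mul]
    exact (norm_add_le _ _).trans (add_le_add (h n) (h' n))
  | smul z c _ h =>
    obtain ⟨C, hC, h⟩ := h
    refine ⟨‖z‖ * C, by positivity, fun n => ?_⟩
    rw [Unitization.inr_smul, mul_smul_comm, norm_smul, mul_assoc]
    gcongr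
    exact h n

/-- The bounded operators on `X` are only a Banach algebra here, so injectivity of `φ` does not give
isometry directly. Instead growth rates are compared: `‖b^n b‖ = ‖b‖^(n+1)` for suitable `n`, while
with `b` close to a finite sum of left inner products `b^n b` grows too slowly if `‖φ(b)‖ < ‖b‖`. -/
theorem norm_le_norm_φ_of_isSelfAdjoint {b : A} (hb : b ∈ L.ideal) (hs : IsSelfAdjoint b) :
    ‖b‖ ≤ ‖E.φ b‖ := by
  rcases (norm_nonneg b).eq_or_lt with h0 | h0
  · rw [← h0]; exact norm_nonneg _
  by_contra! hlt
  obtain ⟨c, hc, hbc⟩ := Metric.mem_closure_iff.1 (show b ∈ closure _ from hb) _ (half_pos h0)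
  obtain ⟨C, hC, h⟩ := L.exists_norm_pow_mul_le b hc
  have hr1 : ‖E.φ b‖ / ‖b‖ < 1 := (div_lt_one h0).2 hlt
  have hr0 : 0 ≤ ‖E.φ b‖ / ‖b‖ := by positivity
  -- Chosen so that `C (‖φ(b)‖/‖b‖)^n < ‖b‖/2`; `C + 1` avoids dividing by zero. The exponent `n +
  -- 1` is a power of two, where norms of powers of self-adjoint elements are multiplicative.
  obtain ⟨m, hm⟩ := exists_pow_lt_of_lt_one (show 0 < ‖b‖ / 2 / (C + 1) by positivity) hr1
  obtain ⟨n, hn'⟩ : ∃ n, n + 1 = 2 ^ m := ⟨2 ^ m - 1, Nat.sub_add_cancel Nat.one_le_two_pow⟩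
  have hmn : m ≤ n := Nat.le_of_lt_succ (Nat.lt_two_pow_self.trans_eq hn'.symm)
  have hsU : IsSelfAdjoint (b : Unitization ℂ A) := hs.map (Unitization.inrNonUnitalStarAlgHom ℂ A)
  have h1 : ‖(b : Unitization ℂ A) ^ n * b‖ = ‖b‖ ^ (n + 1) := by
    rw [← pow_succ, hn']
    have := hsU.nnnorm_pow_two_pow m
    have := congrArg NNReal.toReal this
    simpa [Unitization.norm_inr] using this
  have h2 : ‖(b : Unitization ℂ A) ^ n * (b - c : A)‖ ≤ ‖b‖ ^ n * (‖b‖ / 2) := by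
    refine (norm_mul_le _ _).trans ?_
    rw [Unitization.norm_inr, ← dist_eq_norm]
    refine mul_le_mul ?_ hbc.le dist_nonneg (by positivity)
    refine (norm_pow_le _ n).trans ?_
    rw [Unitization.norm_inr]
  have h3 : ‖b‖ ^ (n + 1) ≤ ‖b‖ ^ n * (‖b‖ / 2) + C * ‖E.φ b‖ ^ n := by
    rw [← h1]
    have : (b : Unitization ℂ A) ^ n * b =
        (b : Unitization ℂ A) ^ n * (b - c : A) + (b : Unitization ℂ A) ^ n * c := by
      rw [← mul_add, ← Unitization.inr_add, sub_add_cancel]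
    rw [this]
    exact (norm_add_le _ _).trans (add_le_add h2 (h n))
  have h4 : ‖b‖ ^ n * (‖b‖ / 2) ≤ ‖b‖ ^ n * (C * (‖E.φ b‖ / ‖b‖) ^ n) := by
    have : ‖b‖ ^ n * (C * (‖E.φ b‖ / ‖b‖) ^ n) = C * ‖E.φ b‖ ^ n := by
      rw [div_pow]; field_simp
    rw [this]
    rw [pow_succ] at h3
    linarith
  have h5 := le_of_mul_le_mul_left h4 (by positivity)
  have h6 : (‖E.φ b‖ / ‖b‖) ^ n < ‖b‖ / 2 / (C + 1) :=
    (pow_le_pow_of_le_one hr0 hr1.le hmn).trans_lt hm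
  rw [lt_div_iff₀ (by positivity)] at h6
  nlinarith [pow_nonneg hr0 n]

/-- The self-adjoint case for `b* b` gives `‖b‖² ≤ ‖φ(b*)‖ ‖φ(b)‖ ≤ ‖b‖ ‖φ(b)‖`. -/
theorem norm_φ_eq {b : A} (hb : b ∈ L.ideal) : ‖E.φ b‖ = ‖b‖ := by
  refine le_antisymm (norm_φ_le b) ?_
  rcases (norm_nonneg b).eq_or_lt with h0 | h0
  · rw [← h0]; exact norm_nonneg _
  have h := L.norm_le_norm_φ_of_isSelfAdjoint (L.mul_mem_ideal (star b) hb) (IsSelfAdjoint.star_mul_self b)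
  rw [CStarRing.norm_star_mul_self, map_mul] at h
  refine le_of_mul_le_mul_left (h.trans ((norm_mul_le _ _).trans ?_)) h0
  gcongr
  exact (norm_φ_le _).trans (norm_star b).le

/-- The image of the ideal is closed by isometry and contains every `Θ_{x,y} = φ(L(x,y))`. -/
theorem exists_φ_eq {k : E.X →L[ℂ] E.X} (hk : k ∈ E.compacts) : ∃ b ∈ L.ideal, E.φ b = k := by
  let f : L.ideal →ₗᵢ[ℂ] (E.X →L[ℂ] E.X) :=
    ⟨(E.φ : A →ₗ[ℂ] (E.X →L[ℂ] E.X)) ∘ₗ L.ideal.subtype, fun b => L.norm_φ_eq b.2⟩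
  have : CompleteSpace L.ideal := L.isClosed_ideal.completeSpace_coe
  have hf : IsClosed (LinearMap.range f.toLinearMap : Set (E.X →L[ℂ] E.X)) :=
    f.isometry.isClosedEmbedding.isClosed_range
  have h : E.compacts ≤ LinearMap.range f.toLinearMap := by
    refine Submodule.topologicalClosure_minimal _ (Submodule.span_le.2 ?_) hf
    rintro _ ⟨x, y, rfl⟩
    exact ⟨⟨_, L.toFun_mem_ideal x y⟩, L.φ_toFun x y⟩
  obtain ⟨b, hb⟩ := h hk
  exact ⟨b, b.2, hb⟩

/-- If `φ(a)` is compact, it is `φ(b)` with `b` in the ideal, and `φ` is injective on `(ker φ)^⊥`.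
-/
theorem ideal_eq : E.kerPerp ⊓ E.J = L.ideal := by
  refine le_antisymm ?_ (le_inf L.ideal_le_kerPerp L.ideal_le_J)
  rintro a ⟨h1, h2⟩
  obtain ⟨b, hb, h⟩ := L.exists_φ_eq h2
  rwa [← eq_of_mem_kerPerp (L.ideal_le_kerPerp hb) h1 h]

/-- Representations that are compatible with the left inner product are coisometric on the ideal of
left inner products. -/
theorem isCoisometricOn_ideal {B : Type u} [NonUnitalCStarAlgebra B] (ρ : E.Representation B)
    (h : ∀ x y, ρ.t x * star (ρ.t y) = ρ.π (L.toFun x y)) : ρ.IsCoisometricOn L.ideal := by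
  -- `f` inverts `φ` on the ideal, and `π ∘ f` serves as `π₁₁`.
  choose f hf hf' using fun k : E.compacts => L.exists_φ_eq k.2
  have huniq : ∀ k : E.compacts, ∀ b ∈ L.ideal, E.φ b = k → f k = b := fun k b hb hbk =>
    eq_of_mem_kerPerp (L.ideal_le_kerPerp (hf k)) (L.ideal_le_kerPerp hb) ((hf' k).trans hbk.symm)
  refine ⟨{ toFun := fun k => ρ.π (f k)
            map_add' := fun k l => ?_
            map_smul' := fun c k => ?_ }, fun k => ?_, fun x y => ?_, fun a ha hk => ?_⟩
  · rw [huniq (k + l) (f k + f l) (add_mem (hf k) (hf l)) (by rw [map_add, hf', hf']; rfl), map_add]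
  · rw [huniq (c • k) (c • f k) (Submodule.smul_mem _ c (hf k)) (by rw [map_smul, hf']; rfl),
      map_smul, RingHom.id_apply]
  · refine (NonUnitalStarAlgHom.norm_apply_le ρ.π (f k)).trans ?_
    rw [← L.norm_φ_eq (hf k), hf']
    exact le_rfl
  · rw [h]
    exact congrArg ρ.π (huniq _ _ (L.toFun_mem_ideal x y) (L.φ_toFun x y))
  · exact congrArg ρ.π (huniq _ _ ha rfl)

theorem t_mul_star_t {B : Type u} [NonUnitalCStarAlgebra B] {ρ : E.Representation B}
    (h : ρ.IsCoisometricOn L.ideal) (x y : E.X) :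
    ρ.t x * star (ρ.t y) = ρ.π (L.toFun x y) := by
  obtain ⟨ψ, -, h1, h2⟩ := h
  have h3 : E.φ (L.toFun x y) ∈ E.compacts := by rw [L.φ_toFun]; exact E.theta_mem x y
  rw [← h1, ← h2 _ (L.toFun_mem_ideal x y) h3]
  congr 1
  exact Subtype.ext (L.φ_toFun x y).symm

end LeftInner

end CStarCorrespondence

end
-- Words in covariant representations, and tensor powers.
noncomputable section

namespace CStarCorrespondence

variable {A : Type u} [NonUnitalCStarAlgebra A] {E : CStarCorrespondence A}

namespace Representation

variable {B : Type u} [NonUnitalCStarAlgebra B] (ρ : E.Representation B)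

/-- The products `t(x 0) ... t(x n)`. -/
def products : ℕ → Set B
  | 0 => Set.range ρ.t
  | n + 1 => {b | ∃ p ∈ products n, ∃ x, b = p * ρ.t x}

theorem products_eq_range (n : ℕ) : ρ.products n = Set.range (ρ.prodT n) := by
  induction n with
  | zero =>
    ext b
    constructor
    · rintro ⟨x, rfl⟩; exact ⟨fun _ => x, rfl⟩
    · rintro ⟨x, rfl⟩; exact ⟨x 0, rfl⟩
  | succ n ih =>
    ext b
    constructor
    · rintro ⟨p, hp, x, rfl⟩
      rw [ih] at hp
      obtain ⟨w, rfl⟩ := hp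
      exact ⟨Fin.snoc (α := fun _ => E.X) w x, by
        rw [prodT, Fin.init_snoc, Fin.snoc_last]⟩
    · rintro ⟨x, rfl⟩
      exact ⟨_, ih ▸ ⟨_, rfl⟩, _, rfl⟩

variable {ρ}

theorem π_mul_products (a : A) {n : ℕ} {p : B} (hp : p ∈ ρ.products n) :
    ρ.π a * p ∈ ρ.products n := by
  induction n generalizing p with
  | zero => obtain ⟨x, rfl⟩ := hp; exact ⟨_, ρ.t_φ a x⟩
  | succ n ih =>
    obtain ⟨p, hp, x, rfl⟩ := hp
    exact ⟨_, ih hp, x, (mul_assoc _ _ _).symm⟩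

theorem products_mul_π (a : A) {n : ℕ} {p : B} (hp : p ∈ ρ.products n) :
    p * ρ.π a ∈ ρ.products n := by
  cases n with
  | zero => obtain ⟨x, rfl⟩ := hp; exact ⟨_, ρ.t_ract x a⟩
  | succ n =>
    obtain ⟨p, hp, x, rfl⟩ := hp
    exact ⟨p, hp, E.ract x a, by rw [ρ.t_ract, mul_assoc]⟩

theorem t_mul_products (x : E.X) {n : ℕ} {p : B} (hp : p ∈ ρ.products n) :
    ρ.t x * p ∈ ρ.products (n + 1) := by
  induction n generalizing p with
  | zero => obtain ⟨y, rfl⟩ := hp; exact ⟨_, ⟨x, rfl⟩, y, rfl⟩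
  | succ n ih =>
    obtain ⟨p, hp, y, rfl⟩ := hp
    exact ⟨_, ih hp, y, (mul_assoc _ _ _).symm⟩

theorem star_t_mul_products (x : E.X) {n : ℕ} {p : B} (hp : p ∈ ρ.products (n + 1)) :
    star (ρ.t x) * p ∈ ρ.products n := by
  induction n generalizing p with
  | zero =>
    obtain ⟨_, ⟨y, rfl⟩, z, rfl⟩ := hp
    rw [← mul_assoc, ρ.star_t_mul_t, ← ρ.t_φ]
    exact ⟨_, rfl⟩
  | succ n ih =>
    obtain ⟨p, hp, y, rfl⟩ := hp
    exact ⟨_, ih hp, y, (mul_assoc _ _ _).symm⟩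

theorem products_mul_star_t {L : E.LeftInner}
    (h : ∀ x y, ρ.t x * star (ρ.t y) = ρ.π (L.toFun x y)) (x : E.X) {n : ℕ} {p : B}
    (hp : p ∈ ρ.products (n + 1)) : p * star (ρ.t x) ∈ ρ.products n := by
  obtain ⟨p, hp, y, rfl⟩ := hp
  rw [mul_assoc, h]
  exact products_mul_π _ hp

variable (ρ) in
/-- The set of all values of `π`, products of values of `t` and their adjoints. -/
def words : Set B :=
  {b | (∃ a, b = ρ.π a) ∨ (∃ n, b ∈ ρ.products n) ∨ ∃ n, star b ∈ ρ.products n}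

theorem star_mem_words {b : B} (hb : b ∈ ρ.words) : star b ∈ ρ.words := by
  rcases hb with ⟨a, rfl⟩ | hb | hb
  · exact Or.inl ⟨star a, (map_star _ _).symm⟩
  · exact Or.inr (Or.inr (by rwa [star_star]))
  · exact Or.inr (Or.inl hb)

theorem π_mul_words (a : A) {b : B} (hb : b ∈ ρ.words) : ρ.π a * b ∈ ρ.words := by
  rcases hb with ⟨c, rfl⟩ | ⟨n, hb⟩ | ⟨n, hb⟩
  · exact Or.inl ⟨a * c, (map_mul _ _ _).symm⟩
  · exact Or.inr (Or.inl ⟨n, π_mul_products a hb⟩)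
  · refine Or.inr (Or.inr ⟨n, ?_⟩)
    rw [star_mul, ← map_star]
    exact products_mul_π _ hb

theorem t_mul_words {L : E.LeftInner} (h : ∀ x y, ρ.t x * star (ρ.t y) = ρ.π (L.toFun x y))
    (x : E.X) {b : B} (hb : b ∈ ρ.words) : ρ.t x * b ∈ ρ.words := by
  rcases hb with ⟨c, rfl⟩ | ⟨n, hb⟩ | ⟨n, hb⟩
  · exact Or.inr (Or.inl ⟨0, _, ρ.t_ract x c⟩)
  · exact Or.inr (Or.inl ⟨n + 1, t_mul_products x hb⟩)
  · rw [← star_star (ρ.t x * b), star_mul]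
    refine star_mem_words ?_
    rcases n with _ | n
    · obtain ⟨y, hy⟩ := hb
      rw [← hy, h]
      exact Or.inl ⟨_, rfl⟩
    · exact Or.inr (Or.inl ⟨n, products_mul_star_t h x hb⟩)

theorem star_t_mul_words (x : E.X) {b : B} (hb : b ∈ ρ.words) : star (ρ.t x) * b ∈ ρ.words := by
  rcases hb with ⟨c, rfl⟩ | ⟨n, hb⟩ | ⟨n, hb⟩
  · refine Or.inr (Or.inr ⟨0, E.φ (star c) x, ?_⟩)
    rw [ρ.t_φ, star_mul, star_star, map_star]
  · rcases n with _ | n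
    · obtain ⟨y, rfl⟩ := hb
      exact Or.inl ⟨_, ρ.star_t_mul_t x y⟩
    · exact Or.inr (Or.inl ⟨n, star_t_mul_products x hb⟩)
  · refine Or.inr (Or.inr ⟨n + 1, _, hb, x, ?_⟩)
    rw [star_mul, star_star]

/-- Neighbouring factors `t* t` and `t t*` both collapse into values of `π`, so a product of words
is a word of a single sign. Hence the words are total in the generated algebra. -/
theorem mul_mem_words {L : E.LeftInner} (h : ∀ x y, ρ.t x * star (ρ.t y) = ρ.π (L.toFun x y))
    {b c : B} (hb : b ∈ ρ.words) (hc : c ∈ ρ.words) : b * c ∈ ρ.words := by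
  have h1 : ∀ n, ∀ p ∈ ρ.products n, ∀ c ∈ ρ.words, p * c ∈ ρ.words := by
    intro n
    induction n with
    | zero => rintro _ ⟨x, rfl⟩ c hc; exact t_mul_words h x hc
    | succ n ih =>
      rintro _ ⟨p, hp, x, rfl⟩ c hc
      rw [mul_assoc]
      exact ih p hp _ (t_mul_words h x hc)
  have h2 : ∀ n, ∀ p ∈ ρ.products n, ∀ c ∈ ρ.words, star p * c ∈ ρ.words := by
    intro n
    induction n with
    | zero => rintro _ ⟨x, rfl⟩ c hc; exact star_t_mul_words x hc
    | succ n ih =>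
      rintro _ ⟨p, hp, x, rfl⟩ c hc
      rw [star_mul, mul_assoc]
      exact star_t_mul_words x (ih p hp c hc)
  rcases hb with ⟨a, rfl⟩ | ⟨n, hb⟩ | ⟨n, hb⟩
  · exact π_mul_words a hc
  · exact h1 n b hb c hc
  · have := h2 n _ hb c hc
    rwa [star_star] at this

theorem star_prodT_mul_prodT (n : ℕ) (x y : Fin (n + 1) → E.X) :
    star (ρ.prodT n x) * ρ.prodT n y = ρ.π (E.tensorForm n x y) := by
  induction n with
  | zero => exact ρ.star_t_mul_t _ _
  | succ n ih =>
    simp only [prodT, tensorForm, star_mul]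
    rw [mul_assoc, ← mul_assoc (star (ρ.prodT n _)), ih, ← ρ.t_φ, ρ.star_t_mul_t]

/-- The linear extension of `x ↦ t(x 0) ... t(x n)` to the tensor power. -/
theorem exists_tensorPower_isometry (hπ : Function.Injective ρ.π) (n : ℕ) :
    ∃ τ : E.TensorPower n →ₗᵢ[ℂ] B, (∀ x : Fin (n + 1) → E.X, τ (E.tmul x) = ρ.prodT n x) ∧
      Set.range τ = ((Submodule.span ℂ (ρ.products n)).topologicalClosure : Set B) := by
  let f₀ : E.PreTensorPower n →ₗ[ℂ] B := Finsupp.lift B ℂ (Fin (n + 1) → E.X) (ρ.prodT n)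
  have hf : ∀ ξ : (Fin (n + 1) → E.X) →₀ ℂ, f₀ ξ = ξ.sum fun x c => c • ρ.prodT n x := fun ξ =>
    Finsupp.lift_apply _ _ _ _ _
  have hnorm : ∀ ξ : E.PreTensorPower n, ‖f₀ ξ‖ = ‖ξ‖ := by
    intro ξ
    refine (sq_eq_sq₀ (norm_nonneg _) (norm_nonneg _)).1 ?_
    -- The inner products agree by `star_prodT_mul_prodT`, and the injective `π` preserves norms.
    have h1 : star (f₀ ξ) * f₀ ξ = ρ.π (E.preInner n ξ ξ) := by
      refine (congrArg (fun b => star b * b) (hf ξ)).trans ?_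
      simp only [preInner, Finsupp.sum, star_sum, Finset.sum_mul_sum, map_sum, map_smul,
        ← star_prodT_mul_prodT, star_smul, smul_mul_smul_comm]
    rw [sq, ← CStarRing.norm_star_mul_self, h1, NonUnitalStarAlgHom.norm_map ρ.π hπ]
    exact (Real.sq_sqrt (norm_nonneg _)).symm
  let f : E.PreTensorPower n →ₗᵢ[ℂ] B := ⟨f₀, hnorm⟩
  let g : E.TensorPower n →L[ℂ] B := f.toContinuousLinearMap.extend
    (UniformSpace.Completion.toComplL (𝕜 := ℂ) (E := E.PreTensorPower n))
  have hg : ∀ ξ : E.PreTensorPower n, g ξ = f₀ ξ := fun ξ =>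
    ContinuousLinearMap.extend_eq f.toContinuousLinearMap
      (e := UniformSpace.Completion.toComplL (𝕜 := ℂ) (E := E.PreTensorPower n))
      UniformSpace.Completion.denseRange_coe (UniformSpace.Completion.isUniformInducing_coe _) ξ
  have hgn : ∀ ξ, ‖g ξ‖ = ‖ξ‖ := by
    intro ξ
    induction ξ using UniformSpace.Completion.induction_on with
    | hp => exact isClosed_eq (by fun_prop) (by fun_prop)
    | ih ξ => rw [hg, UniformSpace.Completion.norm_coe, hnorm]
  have hτ : ∀ x : Fin (n + 1) → E.X, g (E.tmul x) = ρ.prodT n x := by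
    intro x
    refine (hg _).trans ((hf _).trans ?_)
    exact (Finsupp.sum_single_index (zero_smul ℂ (ρ.prodT n x))).trans (one_smul _ _)
  refine ⟨⟨g.toLinearMap, hgn⟩, hτ, Set.Subset.antisymm ?_ ?_⟩
  · rintro _ ⟨ξ, rfl⟩
    change g ξ ∈ _
    induction ξ using UniformSpace.Completion.induction_on with
    | hp => exact (Submodule.isClosed_topologicalClosure _).preimage g.continuous
    | ih ξ =>
      rw [hg]
      refine Submodule.le_topologicalClosure _ ((hf ξ).symm ▸ ?_)
      refine Submodule.sum_mem _ fun x _ => Submodule.smul_mem _ _ (Submodule.subset_span ?_)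
      rw [products_eq_range]
      exact ⟨x, rfl⟩
  · let τ : E.TensorPower n →ₗᵢ[ℂ] B := ⟨g.toLinearMap, hgn⟩
    have hcl : IsClosed (LinearMap.range τ.toLinearMap : Set B) :=
      τ.isometry.isClosedEmbedding.isClosed_range
    refine Submodule.topologicalClosure_minimal _ (Submodule.span_le.2 ?_) hcl
    rw [products_eq_range]
    rintro _ ⟨x, rfl⟩
    exact ⟨_, hτ x⟩

end Representation

/-! ### Spectral subspaces of the relative Cuntz–Pimsner algebra. -/

section Spectral

variable {J : Submodule ℂ A}

theorem gauge_products (z : Circle) {n : ℕ} {p : E.CuntzPimsner J}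
    (hp : p ∈ (E.toCuntzPimsner J).products n) :
    E.gauge J z p = (z : ℂ) ^ (n + 1) • p := by
  induction n generalizing p with
  | zero =>
    obtain ⟨x, rfl⟩ := hp
    rw [E.gauge_t, zero_add, pow_one]
  | succ n ih =>
    obtain ⟨p, hp, x, rfl⟩ := hp
    rw [map_mul, ih hp, E.gauge_t, smul_mul_smul_comm, ← pow_succ]

theorem isClosed_spectralSubspace (k : ℤ) :
    IsClosed (E.spectralSubspace J k : Set (E.CuntzPimsner J)) := by
  have : (E.spectralSubspace J k : Set (E.CuntzPimsner J)) =
      ⋂ z : Circle, {b | E.gauge J z b = (z : ℂ) ^ k • b} := by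
    ext b; simp only [Set.mem_iInter]; rfl
  rw [this]
  refine isClosed_iInter fun z => isClosed_eq ?_ (continuous_const_smul _)
  exact AddMonoidHomClass.continuous_of_bound (E.gauge J z) 1
    (by simpa only [one_mul] using NonUnitalStarAlgHom.norm_apply_le (E.gauge J z))

/-- Every word is homogeneous and words are total, so averaging leaves only the words of the given
degree. -/
theorem spectralSubspace_eq (hπ : Function.Injective (E.toCuntzPimsner J).π) {L : E.LeftInner}
    (h : ∀ x y, (E.toCuntzPimsner J).t x * star ((E.toCuntzPimsner J).t y) =
      (E.toCuntzPimsner J).π (L.toFun x y)) :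
    Set.range (E.toCuntzPimsner J).π = E.spectralSubspace J 0 ∧
    ∀ n : ℕ, (Submodule.span ℂ ((E.toCuntzPimsner J).products n)).topologicalClosure =
      E.spectralSubspace J (n + 1) := by
  set ρ := E.toCuntzPimsner J with hρ
  -- Averaging needs closedness only in the degree considered, so negative degrees are left as plain
  -- spans.
  let N : ℤ → Submodule ℂ (E.CuntzPimsner J)
    | Int.ofNat 0 => LinearMap.range (ρ.π : A →ₗ[ℂ] E.CuntzPimsner J)
    | Int.ofNat (n + 1) => (Submodule.span ℂ (ρ.products n)).topologicalClosure
    | Int.negSucc n => Submodule.span ℂ {b | star b ∈ ρ.products n}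
  have hNle : ∀ d, N d ≤ E.spectralSubspace J d := by
    rintro ((_ | n) | n)
    · rintro _ ⟨a, rfl⟩ z
      exact (E.gauge_π J z a).trans (one_smul ℂ _).symm
    · refine Submodule.topologicalClosure_minimal _ (Submodule.span_le.2 ?_)
        (isClosed_spectralSubspace _)
      intro p hp z
      refine (gauge_products z hp).trans ?_
      rw [← zpow_natCast]
      rfl
    · refine Submodule.span_le.2 fun b hb z => ?_
      have h1 := congrArg star (gauge_products z hb)
      rw [← map_star, star_star, star_smul, star_star] at h1
      rw [h1]
      congr 1
      have h2 : star (z : ℂ) = (z : ℂ)⁻¹ := by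
        rw [← Circle.coe_inv, Circle.coe_inv_eq_conj]; rfl
      rw [star_pow, h2, zpow_negSucc, inv_pow]
  have hNc : ∀ d, 0 ≤ d → IsClosed (N d : Set (E.CuntzPimsner J)) := by
    rintro ((_ | n) | n) hd
    · let f : A →ₗᵢ[ℂ] E.CuntzPimsner J := ⟨ρ.π, fun a => NonUnitalStarAlgHom.norm_map ρ.π hπ a⟩
      exact f.isometry.isClosedEmbedding.isClosed_range
    · exact Submodule.isClosed_topologicalClosure _
    · exact absurd hd (not_le.2 (Int.negSucc_lt_zero n))
  have hdense : ∀ x, x ∈ closure ((⨆ d, N d : Submodule ℂ (E.CuntzPimsner J)) :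
      Set (E.CuntzPimsner J)) := by
    intro x
    have hx := (E.cuntzPimsnerRelations J).mem_closure_span ρ.words ?_
      (fun b hb c hc => Representation.mul_mem_words h hb hc)
      (fun b hb => Representation.star_mem_words hb) x
    · refine closure_mono (Submodule.span_le.2 ?_) hx
      rintro b (⟨a, rfl⟩ | ⟨n, hb⟩ | ⟨n, hb⟩)
      · exact Submodule.mem_iSup_of_mem (Int.ofNat 0) ⟨a, rfl⟩
      · exact Submodule.mem_iSup_of_mem (Int.ofNat (n + 1))
          (Submodule.le_topologicalClosure _ (Submodule.subset_span hb))
      · exact Submodule.mem_iSup_of_mem (Int.negSucc n) (Submodule.subset_span hb)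
    · rintro (a | x)
      · exact Or.inl ⟨a, rfl⟩
      · exact Or.inr (Or.inl ⟨0, x, rfl⟩)
  have hle : ∀ d, 0 ≤ d → E.spectralSubspace J d ≤ N d := fun d hd x hx =>
    mem_of_spectral (fun z => (E.gauge J z : E.CuntzPimsner J →ₗ[ℂ] E.CuntzPimsner J))
      (fun z x => NonUnitalStarAlgHom.norm_apply_le (E.gauge J z) x) N (fun d x hx => hNle d hx)
      hdense (hNc d hd) hx
  refine ⟨?_, fun n => le_antisymm (hNle (Int.ofNat (n + 1))) (hle (Int.ofNat (n + 1)) (Int.natCast_nonneg _))⟩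
  exact congrArg (fun S : Submodule ℂ (E.CuntzPimsner J) => (S : Set (E.CuntzPimsner J)))
    (le_antisymm (hNle (Int.ofNat 0)) (hle (Int.ofNat 0) le_rfl))

end Spectral

/-! ### Comparison with the crossed product. -/

section CrossedProduct

theorem toCrossedProduct_t_mul_star_t (L : E.LeftInner) (x y : E.X) :
    (toCrossedProduct L).t x * star ((toCrossedProduct L).t y) =
      (toCrossedProduct L).π (L.toFun x y) :=
  (crossedProductRelations L).ext_proj fun p => by
    rw [map_mul, map_star]
    refine Eq.trans ?_ ((E.fiberRep_holds _ p x y).trans (E.proj_universalπ _ p _).symm)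
    rw [← E.proj_universalt _ p x, ← E.proj_universalt _ p y]
    rfl

/-- Coisometry on `L.ideal` and covariance for `L` imply each other, so the universal properties
give mutually inverse maps. -/
theorem exists_equiv_crossedProduct (L : E.LeftInner) :
    ∃ Φ : E.CuntzPimsner L.ideal ≃⋆ₐ[ℂ] CrossedProduct L,
      (∀ a, Φ ((E.toCuntzPimsner L.ideal).π a) = (toCrossedProduct L).π a) ∧
      ∀ x, Φ ((E.toCuntzPimsner L.ideal).t x) = (toCrossedProduct L).t x := by
  obtain ⟨Φ, h1, h2⟩ := E.exists_lift (fun _ _ ρ => ρ.IsCoisometricOn L.ideal)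
    (toCrossedProduct L) (L.isCoisometricOn_ideal _ (toCrossedProduct_t_mul_star_t L))
  obtain ⟨Ψ, h3, h4⟩ := E.exists_lift
    (fun _ _ ρ => ∀ x y, ρ.t x * star (ρ.t y) = ρ.π (L.toFun x y))
    (E.toCuntzPimsner L.ideal) (L.t_mul_star_t (E.toCuntzPimsner_coisometric L.ideal))
  have e1 : Ψ.comp Φ = NonUnitalStarAlgHom.id ℂ _ := by
    refine (E.cuntzPimsnerRelations L.ideal).hom_ext _ _ ?_
    rintro (a | x)
    · exact (congrArg Ψ (h1 a)).trans (h3 a)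
    · exact (congrArg Ψ (h2 x)).trans (h4 x)
  have e2 : Φ.comp Ψ = NonUnitalStarAlgHom.id ℂ _ := by
    refine (crossedProductRelations L).hom_ext _ _ ?_
    rintro (a | x)
    · exact (congrArg Φ (h3 a)).trans (h1 a)
    · exact (congrArg Φ (h4 x)).trans (h2 x)
  exact ⟨StarAlgEquiv.ofNonUnitalStarAlgHom Φ Ψ e1 e2, h1, h2⟩

end CrossedProduct

end CStarCorrespondence

end
noncomputable section

namespace CStarCorrespondence

variable {A : Type u} [NonUnitalCStarAlgebra A]

/-! ### Positivity of the inner products of words. -/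

section Word

variable (E : CStarCorrespondence A)

/-- The form `⟨x₁ ⊗ ... ⊗ xₙ, a y₁ ⊗ ... ⊗ yₙ⟩`, zero for words of different lengths. -/
def wordForm : List E.X → List E.X → A →ₗ[ℂ] A
  | [], [] => LinearMap.id
  | x :: w, y :: v => wordForm w v ∘ₗ E.inner x ∘ₗ E.φₗ.flip y
  | [], _ :: _ => 0
  | _ :: _, [] => 0

variable {E}

theorem wordForm_cons (x y : E.X) (w v : List E.X) (a : A) :
    E.wordForm (x :: w) (y :: v) a = E.wordForm w v (E.inner x (E.φ a y)) := rfl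

theorem wordForm_eq_zero {w v : List E.X} (h : w.length ≠ v.length) : E.wordForm w v = 0 := by
  induction w generalizing v with
  | nil =>
    cases v with
    | nil => exact absurd rfl h
    | cons y v => rfl
  | cons x w ih =>
    cases v with
    | nil => rfl
    | cons y v =>
      rw [wordForm, ih (fun h' => h (by rw [List.length_cons, List.length_cons, h'])),
        LinearMap.zero_comp]

theorem star_wordForm (w v : List E.X) (a : A) :
    star (E.wordForm w v a) = E.wordForm v w (star a) := by
  induction w generalizing v a with
  | nil =>
    cases v with
    | nil => rfl
    | cons y v => exact star_zero _
  | cons x w ih =>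
    cases v with
    | nil => exact star_zero _
    | cons y v => rw [wordForm_cons, wordForm_cons, ih, E.star_inner, E.inner_φ]

/-- Matrices of the form `b* b` are preserved by `(a_ij) ↦ (⟨y_i, a_ij y_j⟩)`; this is the complete
positivity that permits induction on the word length. -/
theorem exists_factor_inner {ι κ : Type*} [Fintype ι] [Fintype κ] (y : ι → E.X) (b : κ → ι → A) :
    ∃ b' : ι → ι → A, ∀ i j,
      E.inner (y i) (E.φ (∑ l, star (b l i) * b l j) (y j)) = ∑ l, star (b' l i) * b' l j := by
  let _ : PartialOrder A := CStarAlgebra.spectralOrder A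
  have _ : StarOrderedRing A := CStarAlgebra.spectralOrderedRing A
  have h : ∀ i j, E.inner (y i) (E.φ (∑ l, star (b l i) * b l j) (y j)) =
      ∑ l, E.inner (E.φ (b l i) (y i)) (E.φ (b l j) (y j)) := by
    intro i j
    rw [map_sum, sum_apply, map_sum]
    refine Finset.sum_congr rfl fun l _ => ?_
    rw [E.inner_φ, φ_mul_apply]
  refine exists_factor_of_nonneg _ (fun i j => ?_) fun c => ?_
  · rw [h, h, star_sum]
    simp only [E.star_inner]
  · simp only [h, Finset.mul_sum, Finset.sum_mul]
    have : ∑ i, ∑ j, ∑ l, star (c i) * E.inner (E.φ (b l i) (y i)) (E.φ (b l j) (y j)) * c j =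
        ∑ l, E.inner (∑ i, E.ract (E.φ (b l i) (y i)) (c i))
          (∑ i, E.ract (E.φ (b l i) (y i)) (c i)) := by
      simp only [E.inner_sum_sum, E.inner_ract, E.inner_ract_left]
      rw [Finset.sum_comm' (t' := Finset.univ) (s' := fun _ => Finset.univ) (by simp)]
      conv_rhs => rw [Finset.sum_comm]
      rw [Finset.sum_comm]
      refine Finset.sum_congr rfl fun i _ => ?_
      rw [Finset.sum_comm]
    rw [this]
    refine Finset.sum_nonneg fun l _ => ?_
    obtain ⟨d, hd⟩ := E.inner_self_pos (∑ i, E.ract (E.φ (b l i) (y i)) (c i))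
    rw [hd]; exact star_mul_self_nonneg _

theorem exists_factor_wordForm {ι : Type*} [Fintype ι] (n : ℕ) (w : ι → List E.X)
    (hw : ∀ i, (w i).length = n) (b : ι → ι → A) :
    ∃ b' : ι → ι → A, ∀ i j,
      E.wordForm (w i) (w j) (∑ l, star (b l i) * b l j) = ∑ l, star (b' l i) * b' l j := by
  induction n generalizing w b with
  | zero =>
    refine ⟨b, fun i j => ?_⟩
    rw [List.length_eq_zero_iff.1 (hw i), List.length_eq_zero_iff.1 (hw j)]
    rfl
  | succ n ih =>
    choose y v hv using fun i => List.exists_cons_of_length_eq_add_one (hw i)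
    obtain ⟨b', hb'⟩ := exists_factor_inner y b
    obtain ⟨b'', hb''⟩ := ih v (fun i => by
      have := hw i
      rw [hv, List.length_cons] at this
      omega) b'
    exact ⟨b'', fun i j => by rw [hv, hv, wordForm_cons, hb', hb'']⟩

theorem nonneg_of_factor (ω : PosFunctional A) {ι κ : Type*} [Fintype ι] [Fintype κ]
    (b : κ → ι → A) (c : ι → ℂ) :
    0 ≤ (∑ i, ∑ j, star (c i) * c j * ω.toCLM (∑ l, star (b l i) * b l j)).re := by
  have h : ∑ i, ∑ j, star (c i) * c j * ω.toCLM (∑ l, star (b l i) * b l j) =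
      ∑ l, ω.toCLM (star (∑ i, c i • b l i) * ∑ i, c i • b l i) := by
    have h1 : ∀ l, ω.toCLM (star (∑ i, c i • b l i) * ∑ i, c i • b l i) =
        ∑ i, ∑ j, star (c i) * c j * ω.toCLM (star (b l i) * b l j) := fun l => by
      rw [star_sum, Finset.sum_mul_sum]
      simp only [map_sum, star_smul, smul_mul_smul_comm, map_smul, smul_eq_mul]
    simp only [h1]
    simp only [map_sum, Finset.mul_sum]
    conv_rhs => rw [Finset.sum_comm]
    refine Finset.sum_congr rfl fun i _ => ?_
    rw [Finset.sum_comm]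
  rw [h, Complex.re_sum]
  exact Finset.sum_nonneg fun l _ => ω.nonneg _

/-- The Gram matrix of the first letters has the form `b* b`, and each further letter preserves this
form. -/
theorem wordForm_nonneg (ω : PosFunctional A) {ι : Type*} [Fintype ι] {n : ℕ} (x : ι → E.X)
    (w : ι → List E.X) (hw : ∀ i, (w i).length = n) (c : ι → ℂ) :
    0 ≤ (∑ i, ∑ j, star (c i) * c j *
      ω.toCLM (E.wordForm (w i) (w j) (E.inner (x i) (x j)))).re := by
  obtain ⟨b, hb⟩ := E.tensorForm_factor 0 (fun i _ => x i)
  obtain ⟨b', hb'⟩ := exists_factor_wordForm n w hw b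
  have h : ∀ i j, E.wordForm (w i) (w j) (E.inner (x i) (x j)) = ∑ l, star (b' l i) * b' l j :=
    fun i j => by rw [← hb', ← hb]; rfl
  simp only [h]
  exact nonneg_of_factor ω b' c

end Word

variable {E : CStarCorrespondence A}

/-- A representation is determined by a *-homomorphism `π` and operators `S x` satisfying
`(S x)* S y = π ⟨x, y⟩` and `S (a x) = π(a) S x`. -/
theorem exists_representation {B : Type u} [NonUnitalCStarAlgebra B] (π : A →⋆ₙₐ[ℂ] B)
    (S : E.X → B) (h : ∀ x y, star (S x) * S y = π (E.inner x y))
    (hφ : ∀ a x, S (E.φ a x) = π a * S x) :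
    ∃ ρ : E.Representation B, ρ.π = π ∧ ∀ x, ρ.t x = S x := by
  -- Linearity is automatic: each defect `d` of `S` satisfies `d* d = 0`, because the products
  -- `S(x)* S(y)` depend sesquilinearly on `x` and `y`.
  have hadd : ∀ x y, S (x + y) = S x + S y := fun x y => by
    refine sub_eq_zero.1 ((CStarRing.star_mul_self_eq_zero_iff _).1 ?_)
    simp only [star_sub, star_add, mul_sub, sub_mul, mul_add, add_mul, h, map_add,
      LinearMap.add_apply]
    abel
  have hsmul : ∀ (c : ℂ) x, S (c • x) = c • S x := fun c x => by
    refine sub_eq_zero.1 ((CStarRing.star_mul_self_eq_zero_iff _).1 ?_)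
    simp only [star_sub, star_smul, mul_sub, sub_mul, smul_mul_assoc, mul_smul_comm, h, map_smul,
      LinearMap.map_smulₛₗ, LinearMap.smul_apply]
    simp only [starRingEnd_apply, smul_comm c (star c), sub_self, smul_zero]
  have hract : ∀ x a, S (E.ract x a) = S x * π a := fun x a => by
    refine sub_eq_zero.1 ((CStarRing.star_mul_self_eq_zero_iff _).1 ?_)
    have h' : ∀ y z b, star (S y) * (S z * b) = π (E.inner y z) * b := fun y z b => by
      rw [← mul_assoc, h]
    simp only [star_sub, star_mul, mul_sub, sub_mul, mul_assoc, h, h', E.inner_ract,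
      E.inner_ract_left, map_mul, map_star, sub_self]
  exact ⟨⟨π, ⟨⟨S, hadd⟩, hsmul⟩, hract, h, hφ⟩, rfl, fun _ => rfl⟩

/-! ### The two-sided Fock space of a Hilbert bimodule. -/

namespace LeftInner

variable (L : E.LeftInner)

/-- The canonical map of the bimodule to its dual. -/
def toDual (x : E.X) : L.dual.X := conj E x

def fromDual (x : L.dual.X) : E.X := unconj E x

/-- Elementary tensors of degree zero, positive degree, and negative degree. -/
inductive BiWord : Type u
  | base (a : A)
  | pos (x : E.X) (w : List E.X)
  | neg (x : L.dual.X) (w : List L.dual.X)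

variable {L}

namespace BiWord

def degree : L.BiWord → ℤ
  | base _ => 0
  | pos _ w => w.length + 1
  | neg _ w => -(w.length + 1)

/-- The algebra valued inner product of elementary tensors. -/
def pairing : L.BiWord → L.BiWord → A
  | base a, base b => star a * b
  | pos x w, pos y v => E.wordForm w v (E.inner x y)
  | neg x w, neg y v => L.dual.wordForm w v (L.dual.inner x y)
  | _, _ => 0

def act (a : A) : L.BiWord → L.BiWord
  | base b => base (a * b)
  | pos x w => pos (E.φ a x) w
  | neg x w => neg (L.dual.φ a x) w

/-- On a negative word `x` is contracted with the first dual letter by the left inner product, and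
the resulting element of `A` is absorbed by the next letter. -/
def create (x : E.X) : L.BiWord → L.BiWord
  | base a => pos (E.ract x a) []
  | pos y w => pos x (y :: w)
  | neg y [] => base (L.dual.inner (L.toDual x) y)
  | neg y (z :: v) => neg (L.dual.φ (L.dual.inner (L.toDual x) y) z) v

def annihilate (x : E.X) : L.BiWord → L.BiWord
  | base a => neg (L.dual.ract (L.toDual x) a) []
  | neg y w => neg (L.toDual x) (y :: w)
  | pos y [] => base (E.inner x y)
  | pos y (z :: v) => pos (E.φ (E.inner x y) z) v

theorem star_pairing (i j : L.BiWord) : star (pairing i j) = pairing j i := by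
  cases i <;> cases j <;> simp only [pairing, star_zero, star_mul, star_star, star_wordForm,
    CStarCorrespondence.star_inner]

theorem pairing_eq_zero {i j : L.BiWord} (h : i.degree ≠ j.degree) : pairing i j = 0 := by
  cases i <;> cases j <;> try rfl
  · exact absurd rfl h
  · rename_i x w y v
    rw [pairing, wordForm_eq_zero (fun h' => h (by rw [degree, degree, h'])), LinearMap.zero_apply]
  · rename_i x w y v
    rw [pairing, wordForm_eq_zero (fun h' => h (by rw [degree, degree, h'])), LinearMap.zero_apply]

theorem pairing_create (x : E.X) (i j : L.BiWord) :
    pairing (create x i) j = pairing i (annihilate x j) := by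
  rcases i with a | ⟨y, w⟩ | ⟨y, _ | ⟨y', w⟩⟩ <;> rcases j with b | ⟨z, _ | ⟨z', v⟩⟩ | ⟨z, v⟩ <;>
    try rfl
  · exact E.inner_ract_left x z a
  · simp only [create, annihilate, pairing]
    rw [CStarCorrespondence.star_inner]
    exact (L.dual.inner_ract _ _ _).symm
  · simp only [create, annihilate, pairing, wordForm_cons]
    rw [L.dual.inner_φ, CStarCorrespondence.star_inner]

theorem pairing_act (a : A) (i j : L.BiWord) : pairing (act a i) j = pairing i (act (star a) j) := by
  cases i <;> cases j <;> simp only [pairing, act, star_mul, mul_assoc, inner_φ]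

theorem act_mul (a b : A) (i : L.BiWord) : act (a * b) i = act a (act b i) := by
  cases i <;> simp only [act, mul_assoc, φ_mul_apply]

theorem exists_linear_pairing (i j : L.BiWord) :
    ∃ β : A →ₗ[ℂ] A, ∀ a, pairing i (act a j) = β a := by
  rcases i with b | ⟨x, w⟩ | ⟨x, w⟩ <;> rcases j with c | ⟨y, v⟩ | ⟨y, v⟩
  · exact ⟨LinearMap.mulLeft ℂ (star b) ∘ₗ LinearMap.mulRight ℂ c, fun _ => rfl⟩
  · exact ⟨0, fun _ => rfl⟩
  · exact ⟨0, fun _ => rfl⟩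
  · exact ⟨0, fun _ => rfl⟩
  · exact ⟨E.wordForm w v ∘ₗ E.inner x ∘ₗ E.φₗ.flip y, fun _ => rfl⟩
  · exact ⟨0, fun _ => rfl⟩
  · exact ⟨0, fun _ => rfl⟩
  · exact ⟨0, fun _ => rfl⟩
  · exact ⟨L.dual.wordForm w v ∘ₗ L.dual.inner x ∘ₗ L.dual.φₗ.flip y, fun _ => rfl⟩

theorem act_create (a : A) (x : E.X) (i : L.BiWord) :
    act a (create x i) = create (E.φ a x) i := by
  have h : ∀ y, a * L.dual.inner (L.toDual x) y = L.dual.inner (L.toDual (E.φ a x)) y :=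
    fun y => (L.left a x (L.fromDual y)).symm
  rcases i with b | ⟨y, w⟩ | ⟨y, _ | ⟨z, v⟩⟩
  · simp only [create, act, E.φ_ract]
  · rfl
  · simp only [create, act, h]
  · simp only [create, act, ← φ_mul_apply, h]

/-- The balancing relation `x ⊗ a y = x a ⊗ y` fails for formal words and holds only after pairing,
that is modulo null vectors. -/
theorem pairing_pos_cons (k : L.BiWord) (x y : E.X) (a : A) (w : List E.X) :
    pairing k (pos x (E.φ a y :: w)) = pairing k (pos (E.ract x a) (y :: w)) := by
  rcases k with b | ⟨z, _ | ⟨z', v⟩⟩ | ⟨z, v⟩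
  · rfl
  · rfl
  · rw [pairing, pairing, wordForm_cons, wordForm_cons, E.inner_ract, φ_mul_apply]
  · rfl

theorem pairing_neg_cons (k : L.BiWord) (x y : L.dual.X) (a : A) (w : List L.dual.X) :
    pairing k (neg x (L.dual.φ a y :: w)) = pairing k (neg (L.dual.ract x a) (y :: w)) := by
  rcases k with b | ⟨z, v⟩ | ⟨z, _ | ⟨z', v⟩⟩
  · rfl
  · rfl
  · rfl
  · rw [pairing, pairing, wordForm_cons, wordForm_cons, L.dual.inner_ract, φ_mul_apply]

/-- This becomes `t(x)* t(y) = π(⟨x,y⟩)`. On negative words it is imprimitivity read in the dual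
bimodule. -/
theorem pairing_annihilate_create (k : L.BiWord) (x y : E.X) (i : L.BiWord) :
    pairing k (annihilate x (create y i)) = pairing k (act (E.inner x y) i) := by
  have h : ∀ z, L.dual.ract (L.toDual x) (L.dual.inner (L.toDual y) z) = L.dual.φ (E.inner x y) z := by
    intro z
    change L.toDual (E.φ (star (L.toFun y (L.fromDual z))) x) =
      L.toDual (E.ract (L.fromDual z) (star (E.inner x y)))
    rw [L.star_toFun, E.star_inner, L.imprimitivity]
  rcases i with b | ⟨z, w⟩ | ⟨z, _ | ⟨z', v⟩⟩
  · simp only [create, annihilate, act, E.inner_ract]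
  · rfl
  · simp only [create, annihilate, act, h]
  · simp only [create, annihilate, act]
    rw [pairing_neg_cons, h]

/-- This becomes covariance, `t(x) t(y)* = π(L(x,y))`. On positive words it is `x⟨y,z⟩ = L(x,y) z`.
-/
theorem pairing_create_annihilate (k : L.BiWord) (x y : E.X) (i : L.BiWord) :
    pairing k (create x (annihilate y i)) = pairing k (act (L.toFun x y) i) := by
  rcases i with b | ⟨z, _ | ⟨z', v⟩⟩ | ⟨z, w⟩
  · simp only [create, annihilate, act]
    rw [L.dual.inner_ract]
    rfl
  · simp only [create, annihilate, act, L.imprimitivity]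
  · simp only [create, annihilate, act, pairing_pos_cons, L.imprimitivity]
  · rfl

end BiWord

open BiWord

/-- The kernel of the two-sided Fock space. -/
def biKernel (L : E.LeftInner) (ω : PosFunctional A) : PosKernel L.BiWord where
  k i j := ω.toCLM (pairing i j)
  conj_symm i j := by rw [← ω.map_star, star_pairing]
  nonneg := by
    refine PosKernel.nonneg_of_fibres degree _ (fun i j h => by rw [pairing_eq_zero h, map_zero]) ?_
    intro d s c hs
    have key : ∑ i ∈ s, ∑ j ∈ s, star (c i) * c j * ω.toCLM (pairing i j) =
        ∑ i : s, ∑ j : s, star (c i) * c j * ω.toCLM (pairing i.1 j.1) := by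
      rw [← Finset.sum_coe_sort s]
      exact Finset.sum_congr rfl fun i _ =>
        (Finset.sum_coe_sort s fun j => star (c i) * c j * ω.toCLM (pairing i.1 j)).symm
    rw [key]
    rcases lt_trichotomy d 0 with hd | hd | hd
    · have h : ∀ i : s, ∃ (x : L.dual.X) (w : List L.dual.X), i.1 = neg x w ∧
          w.length = (-d - 1).toNat := by
        rintro ⟨a | ⟨x, w⟩ | ⟨x, w⟩, hi⟩ <;> have h := hs _ hi <;> simp only [degree] at h
        · omega
        · omega
        · exact ⟨x, w, rfl, by omega⟩
      choose x w h1 h2 using h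
      simp only [h1, pairing]
      exact wordForm_nonneg ω x w h2 fun i : s => c (neg (x i) (w i))
    · have h : ∀ i : s, ∃ a : A, i.1 = base a := by
        rintro ⟨a | ⟨x, w⟩ | ⟨x, w⟩, hi⟩ <;> have h := hs _ hi <;> simp only [degree] at h
        · exact ⟨a, rfl⟩
        · omega
        · omega
      choose a h1 using h
      simp only [h1, pairing]
      have := nonneg_of_factor ω (fun _ : Unit => a) fun i : s => c (base (a i))
      simpa using this
    · have h : ∀ i : s, ∃ (x : E.X) (w : List E.X), i.1 = pos x w ∧ w.length = (d - 1).toNat := by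
        rintro ⟨a | ⟨x, w⟩ | ⟨x, w⟩, hi⟩ <;> have h := hs _ hi <;> simp only [degree] at h
        · omega
        · exact ⟨x, w, rfl, by omega⟩
        · omega
      choose x w h1 h2 using h
      simp only [h1, pairing]
      exact wordForm_nonneg ω x w h2 fun i : s => c (pos (x i) (w i))

theorem vec_eq_of_pairing {ω : PosFunctional A} {i j : L.BiWord} (h : ∀ k, pairing k i = pairing k j) :
    (L.biKernel ω).vec i = (L.biKernel ω).vec j :=
  PosKernel.eq_of_inner _ fun k => by
    rw [PosKernel.inner_vec, PosKernel.inner_vec]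
    exact congrArg ω.toCLM (h k)

/-- For each nonzero `a` there is a covariant representation of the Hilbert bimodule that does not
vanish at `a`. -/
theorem exists_covariant_representation (L : E.LeftInner) {a : A} (ha : a ≠ 0) :
    ∃ (B : Type u) (_ : NonUnitalCStarAlgebra B) (ρ : E.Representation B),
      (∀ x y, ρ.t x * star (ρ.t y) = ρ.π (L.toFun x y)) ∧ ρ.π a ≠ 0 := by
  -- `π(a)` sends the degree-zero vector `a*` to `a a*`, whose squared norm for this `ω` is `‖a a*‖²
  -- ≠ 0`.
  obtain ⟨ω, hω⟩ := exists_posFunctional (a * star a)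
  set κ := L.biKernel ω with hκ
  choose β hβ using fun i j : L.BiWord => exists_linear_pairing i j
  have hact := κ.exists_op_of_rep (fun a : A => act a) (fun i j => ω.toCLM.toLinearMap ∘ₗ β i j)
    (fun i j d => congrArg ω.toCLM (hβ i j d))
    (fun i j d e => by rw [act_mul])
    (fun i j d => congrArg ω.toCLM (pairing_act d i j))
  choose P _ hP using hact
  have hvec : ∀ i, ∃ f : A →ₗ[ℂ] κ.Space, ∀ a, κ.vec (act a i) = f a := fun i =>
    ⟨{ toFun := fun a => κ.vec (act a i)
       map_add' := fun a b => κ.eq_of_inner fun k => by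
         rw [inner_add_right, PosKernel.inner_vec, PosKernel.inner_vec, PosKernel.inner_vec]
         change ω.toCLM _ = ω.toCLM _ + ω.toCLM _
         rw [hβ, hβ, hβ, map_add, map_add]
       map_smul' := fun z a => κ.eq_of_inner fun k => by
         rw [RingHom.id_apply, inner_smul_right, PosKernel.inner_vec, PosKernel.inner_vec]
         change ω.toCLM _ = z * ω.toCLM _
         rw [hβ, hβ, map_smul, map_smul, smul_eq_mul] }, fun _ => rfl⟩
  choose f hf using hvec
  let π : A →⋆ₙₐ[ℂ] (κ.Space →L[ℂ] κ.Space) :=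
    { toFun := P
      map_smul' := fun z a => κ.clm_ext fun i => by
        rw [MonoidHom.id_apply, smul_apply, hP, hP, hf, hf, map_smul]
      map_zero' := κ.clm_ext fun i => by rw [hP, hf, map_zero]; rfl
      map_add' := fun a b => κ.clm_ext fun i => by
        rw [add_apply, hP, hP, hP, hf, hf, hf, map_add]
      map_mul' := fun a b => κ.clm_ext fun i => by
        rw [mul_apply_eq_comp, hP, hP, hP, act_mul]
      map_star' := fun a => κ.clm_ext fun i => by
        rw [κ.adjoint_vec (fun i j => congrArg ω.toCLM (pairing_act a i j)) (hP a), hP] }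
  have hcreate := fun x : E.X => κ.exists_op_of_sq (create x) (act (E.inner x x)) (fun i j => by
    change ω.toCLM _ = ω.toCLM _
    rw [pairing_create, pairing_annihilate_create]) (hP _)
  choose S _ hS using hcreate
  have hS' : ∀ x i, star (S x) (κ.vec i) = κ.vec (annihilate x i) := fun x i =>
    κ.adjoint_vec (fun i j => congrArg ω.toCLM (pairing_create x i j)) (hS x) i
  obtain ⟨ρ, hρ, hρ'⟩ := exists_representation π S
    (fun x y => κ.clm_ext fun i => by
      rw [mul_apply_eq_comp, hS, hS']
      exact (vec_eq_of_pairing fun k => pairing_annihilate_create k x y i).trans (hP _ i).symm)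
    (fun b x => κ.clm_ext fun i => by
      rw [mul_apply_eq_comp, hS, hS]
      exact (congrArg κ.vec (act_create b x i).symm).trans (hP b _).symm)
  refine ⟨κ.Space →L[ℂ] κ.Space, inferInstance, ρ, fun x y => κ.clm_ext fun i => ?_, fun h => ?_⟩
  · rw [hρ', hρ', mul_apply_eq_comp, hS', hS, hρ]
    exact (vec_eq_of_pairing fun k => pairing_create_annihilate k x y i).trans (hP _ i).symm
  · rw [hρ] at h
    have h1 : κ.vec (base (a * star a)) = 0 := by
      refine (hP a (base (star a))).symm.trans ?_
      change π a _ = 0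
      rw [h]; rfl
    have h2 := κ.norm_vec_sq (base (a * star a))
    rw [h1, norm_zero] at h2
    have h3 : (0 : ℝ) ^ 2 = ‖a * star a‖ ^ 2 := h2.trans hω
    have h4 : a * star a = 0 :=
      norm_eq_zero.1 (pow_eq_zero_iff two_ne_zero |>.1 (h3.symm.trans (zero_pow two_ne_zero)))
    exact ha ((CStarRing.mul_star_self_eq_zero_iff a).1 h4)

theorem injective_toCuntzPimsner_π (L : E.LeftInner) :
    Function.Injective (E.toCuntzPimsner L.ideal).π := by
  refine (injective_iff_map_eq_zero _).2 fun a h => ?_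
  by_contra ha
  obtain ⟨B, _, ρ, hρ, hρa⟩ := L.exists_covariant_representation ha
  obtain ⟨Φ, hΦ, -⟩ := E.exists_lift (fun _ _ ρ => ρ.IsCoisometricOn L.ideal) ρ
    (L.isCoisometricOn_ideal ρ hρ)
  exact hρa ((hΦ a).symm.trans ((congrArg Φ h).trans (map_zero Φ)))

end LeftInner

end CStarCorrespondence

end
noncomputable section

/-! ### Detection in graded C*-algebras. -/

section Graded

variable {B : Type u} [NonUnitalCStarAlgebra B]

/-- The right tensor C*-precategory of a graded C*-algebra: morphisms from `n` to `m` are the elements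
of degree `m - n`, and `⊗ 1` is the identity. -/
def gradedPrecategory (S : ℤ → Submodule ℂ B) (hmul : ∀ k l, ∀ x ∈ S k, ∀ y ∈ S l, x * y ∈ S (k + l))
    (hstar : ∀ k, ∀ x ∈ S k, star x ∈ S (-k)) (hcl : ∀ k, IsClosed (S k : Set B))
    (hpos : ∀ k, ∀ x ∈ S k, ∃ b ∈ S 0, star x * x = star b * b) :
    RightTensorCStarPrecategory.{u} where
  Hom n m := S (m - n)
  complete n m := (hcl _).completeSpace_coe
  comp {l n m} := LinearMap.mk₂ ℂ
    (fun a b => ⟨a.1 * b.1, by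
      have := hmul _ _ _ a.2 _ b.2
      rwa [sub_add_sub_cancel] at this⟩)
    (fun a a' b => Subtype.ext (add_mul _ _ _)) (fun c a b => Subtype.ext (smul_mul_assoc _ _ _))
    (fun a b b' => Subtype.ext (mul_add _ _ _)) (fun c a b => Subtype.ext (mul_smul_comm _ _ _))
  comp_assoc a b c := Subtype.ext (mul_assoc _ _ _)
  norm_comp_le a b := norm_mul_le a.1 b.1
  adj {n m} :=
    { toFun := fun a => ⟨star a.1, by
        have := hstar _ _ a.2
        rwa [neg_sub] at this⟩
      map_add' := fun a b => Subtype.ext (star_add _ _)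
      map_smul' := fun c a => Subtype.ext (star_smul _ _) }
  adj_adj a := Subtype.ext (star_star _)
  adj_comp a b := Subtype.ext (star_mul _ _)
  norm_adj_comp_self a := (CStarRing.norm_star_mul_self (x := a.1)).trans (sq _).symm
  adj_comp_self_pos {n m} a := by
    obtain ⟨b, hb, h⟩ := hpos _ _ a.2
    exact ⟨⟨b, by rwa [sub_self]⟩, Subtype.ext h⟩
  tensor {n m} :=
    { toFun := fun a => ⟨a.1, by
        have := a.2
        push_cast
        rwa [add_sub_add_right_eq_sub]⟩
      map_add' := fun a b => rfl
      map_smul' := fun c a => rfl }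
  tensor_comp a b := rfl
  tensor_adj a := rfl

variable {S : ℤ → Submodule ℂ B} {hmul : ∀ k l, ∀ x ∈ S k, ∀ y ∈ S l, x * y ∈ S (k + l)}
    {hstar : ∀ k, ∀ x ∈ S k, star x ∈ S (-k)} {hcl : ∀ k, IsClosed (S k : Set B)}
    {hpos : ∀ k, ∀ x ∈ S k, ∃ b ∈ S 0, star x * x = star b * b}

/-- The ideal of the precategory of a graded C*-algebra induced from degree zero. -/
def gradedIdeal (I : Submodule ℂ B) (hI : IsClosed (I : Set B)) (hIs : ∀ x ∈ I, star x ∈ I) :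
    (gradedPrecategory S hmul hstar hcl hpos).Ideal where
  space n m :=
    { carrier := {x | ∀ a ∈ S (-m), ∀ b ∈ S n, a * x.1 * b ∈ I}
      add_mem' := fun {x y} hx hy a ha b hb => by
        change a * (x.1 + y.1) * b ∈ I
        rw [mul_add, add_mul]
        exact add_mem (hx a ha b hb) (hy a ha b hb)
      zero_mem' := fun a ha b hb => by
        change a * 0 * b ∈ I
        rw [mul_zero, zero_mul]
        exact zero_mem I
      smul_mem' := fun c x hx a ha b hb => by
        change a * (c • x.1) * b ∈ I
        rw [mul_smul_comm, smul_mul_assoc]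
        exact I.smul_mem c (hx a ha b hb) }
  isClosed n m := by
    have : IsClosed {x : S (m - n) | ∀ a ∈ S (-m), ∀ b ∈ S n, a * x.1 * b ∈ I} := by
      simp only [Set.ofPred_forall]
      exact isClosed_biInter fun a _ => isClosed_biInter fun b _ => hI.preimage
        (((continuous_const_mul a).comp continuous_subtype_val).mul continuous_const)
    exact this
  comp_mem_left {l n m} a b hb u hu v hv := by
    change u * (a.1 * b.1) * v ∈ I
    rw [← mul_assoc u]
    refine hb _ ?_ v hv
    have := hmul _ _ u hu _ a.2
    rwa [show -(m : ℤ) + (m - n) = -n by ring] at this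
  comp_mem_right {l n m} a b ha u hu v hv := by
    change u * (a.1 * b.1) * v ∈ I
    rw [← mul_assoc u, mul_assoc _ b.1]
    refine ha u hu _ ?_
    have := hmul _ _ _ b.2 v hv
    rwa [sub_add_cancel] at this
  adj_mem {n m} a ha u hu v hv := by
    change u * star a.1 * v ∈ I
    rw [← star_star (u * star a.1 * v)]
    refine hIs _ ?_
    rw [star_mul, star_mul, star_star, ← mul_assoc]
    refine ha _ (hstar _ v hv) _ ?_
    have := hstar _ u hu
    rwa [neg_neg] at this

/-- `Ψ₀` and `Ψ₁` come from the components of the detecting representation on endomorphisms of `0`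
and of `1`, and `Θ` from that on morphisms from `0` to `1`. They give two copies of the degree-zero
part that agree exactly on elements compressed into `I`. -/
theorem exists_graded_detection
    (hmul : ∀ k l, ∀ x ∈ S k, ∀ y ∈ S l, x * y ∈ S (k + l))
    (hstar : ∀ k, ∀ x ∈ S k, star x ∈ S (-k)) (hcl : ∀ k, IsClosed (S k : Set B))
    (hpos : ∀ k, ∀ x ∈ S k, ∃ b ∈ S 0, star x * x = star b * b)
    (I : Submodule ℂ B) (hI : IsClosed (I : Set B)) (hIs : ∀ x ∈ I, star x ∈ I) :
    ∃ (C : Type u) (_ : NonUnitalCStarAlgebra C) (Ψ₀ Ψ₁ : S 0 →ₗ[ℂ] C) (Θ : S 1 →ₗ[ℂ] C),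
      (∀ x y z : S 0, (z : B) = x * y → Ψ₀ z = Ψ₀ x * Ψ₀ y) ∧
      (∀ x y : S 0, (y : B) = star (x : B) → Ψ₀ y = star (Ψ₀ x)) ∧
      (∀ (x y : S 1) (z : S 0), (z : B) = star (x : B) * y → Ψ₀ z = star (Θ x) * Θ y) ∧
      (∀ (x : S 0) (y z : S 1), (z : B) = x * y → Θ z = Ψ₀ x * Θ y) ∧
      (∀ (x y : S 1) (z : S 0), (z : B) = x * star (y : B) → Ψ₁ z = Θ x * star (Θ y)) ∧
      (∀ x, ‖Ψ₁ x‖ ≤ ‖x‖) ∧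
      ∀ x : S 0, Ψ₀ x = Ψ₁ x ↔ ∀ a ∈ S 0, ∀ b ∈ S 0, a * x * b ∈ I := by
  let T := gradedPrecategory S hmul hstar hcl hpos
  let J : T.Ideal := gradedIdeal I hI hIs
  -- Since `⊗ 1` keeps the underlying element, it is injective on every ideal.
  obtain ⟨C, _, ρ, hρ, hd⟩ := RightTensorCStarPrecategory.exists_detecting_representation
    T.topIdeal J (fun n m c _ h =>
      @Subtype.ext B (· ∈ S (m - n)) c 0
        (congrArg (@Subtype.val B (· ∈ S ((m + 1 : ℕ) - (n + 1 : ℕ)))) h))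
  let ι : ∀ (n m : ℕ) (k : ℤ), k = m - n → S k →ₗ[ℂ] T.topIdeal.space n m := fun n m k h =>
    { toFun := fun x => ⟨⟨x.1, h ▸ x.2⟩, Submodule.mem_top⟩
      map_add' := fun _ _ => rfl
      map_smul' := fun _ _ => rfl }
  refine ⟨C, _, ρ.toFun 0 0 ∘ₗ ι 0 0 0 rfl, ρ.toFun 1 1 ∘ₗ ι 1 1 0 rfl, ρ.toFun 1 0 ∘ₗ ι 0 1 1 rfl,
    fun x y z h => ?_, fun x y h => ?_, fun x y z h => ?_, fun x y z h => ?_, fun x y z h => ?_,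
    fun x => ?_, fun x => ⟨fun h => ?_, fun h => ?_⟩⟩
  · refine Eq.trans (congrArg (ρ.toFun 0 0) ?_)
      (ρ.map_comp 0 0 0 (ι 0 0 0 rfl x) (ι 0 0 0 rfl y))
    exact Subtype.ext (Subtype.ext h)
  · refine Eq.trans (congrArg (ρ.toFun 0 0) ?_) (ρ.map_adj 0 0 (ι 0 0 0 rfl x))
    exact Subtype.ext (Subtype.ext h)
  · have h1 := ρ.map_comp 0 1 0 ⟨T.adj (ι 0 1 1 rfl x).1, Submodule.mem_top⟩ (ι 0 1 1 rfl y)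
    have h2 := ρ.map_adj 1 0 (ι 0 1 1 rfl x)
    rw [h2] at h1
    refine Eq.trans (congrArg (ρ.toFun 0 0) ?_) h1
    exact Subtype.ext (Subtype.ext h)
  · refine Eq.trans (congrArg (ρ.toFun 1 0) ?_)
      (ρ.map_tensor 0 0 1 0 (ι 0 0 0 rfl x) (ι 0 1 1 rfl y)).symm
    exact Subtype.ext (Subtype.ext h)
  · have h1 := ρ.map_comp 1 0 1 (ι 0 1 1 rfl x) ⟨T.adj (ι 0 1 1 rfl y).1, Submodule.mem_top⟩
    have h2 := ρ.map_adj 1 0 (ι 0 1 1 rfl y)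
    rw [h2] at h1
    refine Eq.trans (congrArg (ρ.toFun 1 1) ?_) h1
    exact Subtype.ext (Subtype.ext h)
  · exact ρ.norm_le 1 1 (ι 1 1 0 rfl x)
  -- Detection with `r = 1` and its only index `j = 0`.
  · exact (hd 0 0 1 (ι 0 0 0 rfl x) (ι 1 1 0 rfl x) h).2 0 one_pos
  · exact hρ 0 0 (ι 0 0 0 rfl x).1 h Submodule.mem_top Submodule.mem_top

end Graded

/-! ### Part (B): fixed points of the gauge action and Hilbert bimodules. -/

namespace CStarCorrespondence

variable {A : Type u} [NonUnitalCStarAlgebra A]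

/-- Positivity is reflected by injective *-homomorphisms. -/
theorem exists_star_mul_self_of_map {B : Type u} [NonUnitalCStarAlgebra B] {π : A →⋆ₙₐ[ℂ] B}
    (hπ : Function.Injective π) {h : A} {c : B} (hc : π h = star c * c) :
    ∃ b, h = star b * b := by
  have hs : IsSelfAdjoint h := hπ (by rw [map_star, hc, star_mul, star_star])
  obtain ⟨p, q, s, h1, h2, h3⟩ := exists_pos_neg h hs
  set N := star s * s with hN
  have hNs : star N = N := by rw [hN, star_mul, star_star]
  -- `h = p - N` with `N p = 0` gives `N h N = -N³`. The images of `N h N` and `N³` are both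
  -- positive with sum zero, so both vanish.
  have h4 : star (c * π N) * (c * π N) + star (π (s * N)) * π (s * N) = 0 := by
    have e1 : star (c * π N) * (c * π N) = π (N * h * N) := by
      rw [star_mul, ← map_star, hNs, map_mul π (N * h) N, map_mul π N h, hc]
      simp only [mul_assoc]
    have e2 : star (π (s * N)) * π (s * N) = π (N * N * N) := by
      rw [← map_star, ← map_mul, star_mul, hNs]
      simp only [hN, mul_assoc]
    rw [e1, e2, ← map_add, h1, mul_sub, h3, zero_sub, neg_mul, neg_add_cancel, map_zero]
  have h5 : star (π (s * N)) * π (s * N) = 0 := by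
    let _ : PartialOrder B := CStarAlgebra.spectralOrder B
    have _ : StarOrderedRing B := CStarAlgebra.spectralOrderedRing B
    refine le_antisymm ?_ (star_mul_self_nonneg _)
    rw [← h4]
    exact le_add_of_nonneg_left (star_mul_self_nonneg _)
  have h6 : s * N = 0 :=
    hπ (((CStarRing.star_mul_self_eq_zero_iff _).1 h5).trans (map_zero π).symm)
  have h7 : N = 0 := by
    refine (CStarRing.star_mul_self_eq_zero_iff _).1 ?_
    rw [hNs]
    nth_rewrite 1 [hN]
    rw [mul_assoc, h6, mul_zero]
  exact ⟨q, by rw [h1, h7, sub_zero, h2]⟩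

variable {E : CStarCorrespondence A} {J : Submodule ℂ A}

theorem mul_mem_spectralSubspace (k l : ℤ) (x : E.CuntzPimsner J) (hx : x ∈ E.spectralSubspace J k)
    (y : E.CuntzPimsner J) (hy : y ∈ E.spectralSubspace J l) :
    x * y ∈ E.spectralSubspace J (k + l) := fun z => by
  rw [map_mul, hx z, hy z, smul_mul_smul_comm, zpow_add₀ z.coe_ne_zero]

theorem star_mem_spectralSubspace (k : ℤ) (x : E.CuntzPimsner J)
    (hx : x ∈ E.spectralSubspace J k) : star x ∈ E.spectralSubspace J (-k) := fun z => by
  have h : star (z : ℂ) = (z : ℂ)⁻¹ := by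
    rw [← Circle.coe_inv, Circle.coe_inv_eq_conj]; rfl
  rw [map_star, hx z, star_smul, star_zpow₀, h, inv_zpow']

theorem t_mem_spectralSubspace (x : E.X) : (E.toCuntzPimsner J).t x ∈ E.spectralSubspace J 1 :=
  fun z => by rw [E.gauge_t, zpow_one]

theorem t_mul_star_t_mem (x y : E.X) :
    (E.toCuntzPimsner J).t x * star ((E.toCuntzPimsner J).t y) ∈ E.spectralSubspace J 0 :=
  mul_mem_spectralSubspace 1 (-1) _ (t_mem_spectralSubspace x) _
    (star_mem_spectralSubspace 1 _ (t_mem_spectralSubspace y))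

theorem Representation.norm_t {B : Type u} [NonUnitalCStarAlgebra B] {ρ : E.Representation B}
    (hπ : Function.Injective ρ.π) (x : E.X) : ‖ρ.t x‖ = ‖x‖ := by
  refine (sq_eq_sq₀ (norm_nonneg _) (norm_nonneg _)).1 ?_
  rw [E.norm_sq, sq, ← CStarRing.norm_star_mul_self, ρ.star_t_mul_t]
  exact NonUnitalStarAlgHom.norm_map ρ.π hπ _

/-- If the products `t(x) t(y)*` belong to the range of `π` then they define a left inner product. -/
theorem Representation.exists_leftInner {B : Type u} [NonUnitalCStarAlgebra B]
    {ρ : E.Representation B} (hπ : Function.Injective ρ.π)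
    (h : ∀ x y, ρ.t x * star (ρ.t y) ∈ Set.range ρ.π) :
    ∃ L : E.LeftInner, ∀ x y, ρ.t x * star (ρ.t y) = ρ.π (L.toFun x y) := by
  choose f hf using h
  have hnorm : ∀ x, ‖f x x‖ = ‖x‖ ^ 2 := fun x => by
    rw [← NonUnitalStarAlgHom.norm_map ρ.π hπ, hf, CStarRing.norm_self_mul_star,
      Representation.norm_t hπ, sq]
  let F : E.X →ₗ[ℂ] E.X →ₗ⋆[ℂ] A := LinearMap.mk₂'ₛₗ (RingHom.id ℂ) (starRingEnd ℂ) f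
    (fun x x' y => hπ (by rw [map_add, hf, hf, hf, map_add, add_mul]))
    (fun c x y => hπ (by
      rw [RingHom.id_apply, map_smul, hf, hf, map_smul, smul_mul_assoc]))
    (fun x y y' => hπ (by rw [map_add, hf, hf, hf, map_add, star_add, mul_add]))
    (fun c x y => hπ (by
      rw [map_smul, hf, hf, map_smul, star_smul, mul_smul_comm, starRingEnd_apply]))
  refine ⟨⟨F, fun a x y => hπ ?_, fun x y => hπ ?_, fun x => ?_, fun x hx => ?_,
    fun u hu => ?_, fun x y z => ?_⟩, fun x y => (hf x y).symm⟩
  · change ρ.π (f _ _) = ρ.π (a * f _ _)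
    rw [map_mul, hf, hf, ρ.t_φ, mul_assoc]
  · change ρ.π (star (f _ _)) = ρ.π (f _ _)
    rw [map_star, hf, hf, star_mul, star_star]
  · refine exists_star_mul_self_of_map hπ (c := star (ρ.t x)) ?_
    rw [star_star]
    exact hf x x
  · have h1 := hnorm x
    rw [show f x x = 0 from hx, norm_zero] at h1
    exact norm_eq_zero.1 (pow_eq_zero_iff two_ne_zero |>.1 h1.symm)
  -- The left inner product induces the original norm by `hnorm`, so completeness is that of `X`.
  · have hc : CauchySeq u := by
      refine Metric.cauchySeq_iff.2 fun ε hε => ?_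
      obtain ⟨N, hN⟩ := hu (ε ^ 2) (by positivity)
      refine ⟨N, fun m hm n hn => lt_of_pow_lt_pow_left₀ 2 hε.le ?_⟩
      rw [dist_eq_norm, ← hnorm]
      exact hN m hm n hn
    obtain ⟨x, hx⟩ := cauchySeq_tendsto_of_complete hc
    refine ⟨x, ?_⟩
    have h1 : Filter.Tendsto (fun n => ‖u n - x‖ ^ 2) Filter.atTop (nhds 0) := by
      have := (tendsto_iff_norm_sub_tendsto_zero.1 hx).pow 2
      rwa [zero_pow two_ne_zero] at this
    exact h1.congr fun n => (hnorm _).symm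
  · have ht : Function.Injective ρ.t := (injective_iff_map_eq_zero _).2 fun x hx => by
      rw [← norm_eq_zero, ← Representation.norm_t hπ, hx, norm_zero]
    refine ht ?_
    rw [ρ.t_ract, ρ.t_φ, ← ρ.star_t_mul_t, ← mul_assoc]
    exact congrArg (· * ρ.t z) (hf x y).symm

/-- For `a ∈ J` and `φ(b) = 0`, coisometry at `ab ∈ J` gives `π(ab) = π₁₁(φ(ab)) = 0`. -/
theorem le_kerPerp (hl : ∀ a, ∀ b ∈ J, b * a ∈ J)
    (hπ : Function.Injective (E.toCuntzPimsner J).π) : J ≤ E.kerPerp := by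
  intro a ha b hb
  obtain ⟨ψ, -, -, h⟩ := E.toCuntzPimsner_coisometric J
  have h0 : E.φ (a * b) = 0 := by rw [map_mul, hb, mul_zero]
  have h1 : E.φ (a * b) ∈ E.compacts := by rw [h0]; exact zero_mem _
  refine hπ ?_
  rw [← h _ (hl b a ha) h1, map_zero]
  have : (⟨E.φ (a * b), h1⟩ : E.compacts) = 0 := Subtype.ext h0
  rw [this, map_zero]

/-- Relations in `O(J,X)` hold in every representation coisometric on `J`. The one built by
detection in the graded algebra `O(J,X)` satisfies `t(x)t(y)* = π(L(x,y))` only if `b L(x,y) c ∈ J`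
for all `b`, `c`, and that forces `L(x,y) ∈ J`. -/
theorem toFun_mem_of_range_eq (hJ : IsClosed (J : Set A)) (hl : ∀ a, ∀ b ∈ J, a * b ∈ J)
    (hr : ∀ a, ∀ b ∈ J, b * a ∈ J) (hπ : Function.Injective (E.toCuntzPimsner J).π)
    (hs : Set.range (E.toCuntzPimsner J).π = E.spectralSubspace J 0) {L : E.LeftInner}
    (hL : ∀ x y, (E.toCuntzPimsner J).t x * star ((E.toCuntzPimsner J).t y) =
      (E.toCuntzPimsner J).π (L.toFun x y)) (x y : E.X) : L.toFun x y ∈ J := by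
  set ρ := E.toCuntzPimsner J with hρ
  let πi : A →ₗᵢ[ℂ] E.CuntzPimsner J :=
    ⟨(ρ.π : A →ₗ[ℂ] E.CuntzPimsner J), fun a => NonUnitalStarAlgHom.norm_map ρ.π hπ a⟩
  let I : Submodule ℂ (E.CuntzPimsner J) := J.map πi.toLinearMap
  have hI : IsClosed (I : Set (E.CuntzPimsner J)) := πi.isometry.isClosedEmbedding.isClosedMap _ hJ
  have hIs : ∀ b ∈ I, star b ∈ I := by
    rintro _ ⟨a, ha, rfl⟩
    exact ⟨star a, star_mem_of_closed_ideal J hJ hl hr ha, map_star ρ.π a⟩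
  have hmem : ∀ a, ρ.π a ∈ E.spectralSubspace J 0 := fun a => by
    have : ρ.π a ∈ Set.range ρ.π := ⟨a, rfl⟩
    rwa [hs] at this
  have hrange : ∀ b ∈ E.spectralSubspace J 0, ∃ a, ρ.π a = b := fun b hb => by
    have : b ∈ (E.spectralSubspace J 0 : Set (E.CuntzPimsner J)) := hb
    rwa [← hs] at this
  -- `x* x` has degree zero and so comes from `A`; its positivity is pulled back along the injective
  -- `π`.
  have hpos : ∀ k, ∀ x ∈ E.spectralSubspace J k, ∃ b ∈ E.spectralSubspace J 0,
      star x * x = star b * b := by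
    intro k x hx
    have h1 := mul_mem_spectralSubspace _ _ _ (star_mem_spectralSubspace k x hx) _ hx
    rw [neg_add_cancel] at h1
    obtain ⟨h, hh⟩ := hrange _ h1
    obtain ⟨b, rfl⟩ := exists_star_mul_self_of_map hπ hh
    exact ⟨ρ.π b, hmem b, by rw [← hh, map_mul, map_star]⟩
  obtain ⟨C, _, Ψ₀, Ψ₁, Θ, p1, p2, p3, p4, p5, p6, p7⟩ := exists_graded_detection
    mul_mem_spectralSubspace star_mem_spectralSubspace isClosed_spectralSubspace hpos I hI hIs
  let π' : A →⋆ₙₐ[ℂ] C :=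
    { toFun := fun a => Ψ₀ ⟨ρ.π a, hmem a⟩
      map_smul' := fun c a => (congrArg Ψ₀ (Subtype.ext (map_smul ρ.π c a))).trans (map_smul Ψ₀ c _)
      map_zero' := (congrArg Ψ₀ (Subtype.ext (map_zero ρ.π))).trans (map_zero Ψ₀)
      map_add' := fun a b => (congrArg Ψ₀ (Subtype.ext (map_add ρ.π a b))).trans (map_add Ψ₀ _ _)
      map_mul' := fun a b => p1 _ _ _ (map_mul ρ.π a b)
      map_star' := fun a => p2 _ _ (map_star ρ.π a) }
  obtain ⟨ρ', hρ', hρ''⟩ := exists_representation (E := E) π'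
    (fun x => Θ ⟨ρ.t x, t_mem_spectralSubspace x⟩)
    (fun x y => (p3 _ _ _ (ρ.star_t_mul_t x y).symm).symm)
    (fun a x => p4 ⟨ρ.π a, hmem a⟩ _ _ (ρ.t_φ a x))
  -- The new `π₁₁` is `Ψ₁` after the universal one. For `a ∈ J` it matches `Ψ₀(π(a))` because `J` is
  -- a two-sided ideal.
  have hco : ρ'.IsCoisometricOn J := by
    obtain ⟨ψ, h1, h2, h3⟩ := E.toCuntzPimsner_coisometric J
    have hψ : Continuous ψ := AddMonoidHomClass.continuous_of_bound ψ 1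
      fun k => (h1 k).trans (one_mul _).ge
    have hψmem : ∀ k, ψ k ∈ E.spectralSubspace J 0 := by
      have hspan : ∀ k (hk : k ∈ Submodule.span ℂ {T | ∃ x y, T = E.theta x y}),
          ψ ⟨k, Submodule.le_topologicalClosure _ hk⟩ ∈ E.spectralSubspace J 0 := by
        intro k hk
        induction hk using Submodule.span_induction with
        | mem k hk =>
          obtain ⟨x, y, rfl⟩ := hk
          rw [h2]
          exact t_mul_star_t_mem x y
        | zero =>
          have : ψ ⟨0, Submodule.zero_mem _⟩ = 0 := map_zero ψ
          rw [this]; exact zero_mem _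
        | add k l hk hl ihk ihl =>
          have := add_mem ihk ihl
          rw [← map_add] at this; exact this
        | smul c k hk ih =>
          have := Submodule.smul_mem _ c ih
          rw [← map_smul] at this; exact this
      intro k
      have hcl : IsClosed {k : E.compacts | ψ k ∈ E.spectralSubspace J 0} :=
        (isClosed_spectralSubspace 0).preimage hψ
      have hk : k ∈ closure {k : E.compacts |
          k.1 ∈ Submodule.span ℂ {T | ∃ x y, T = E.theta x y}} := by
        rw [closure_subtype]
        refine closure_mono ?_ k.2
        intro l hl
        exact ⟨⟨l, Submodule.le_topologicalClosure _ hl⟩, hl, rfl⟩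
      exact closure_minimal (fun l hl => hspan l.1 hl) hcl hk
    refine ⟨{ toFun := fun k => Ψ₁ ⟨ψ k, hψmem k⟩
              map_add' := fun k l =>
                (congrArg Ψ₁ (Subtype.ext (map_add ψ k l))).trans (map_add Ψ₁ _ _)
              map_smul' := fun c k =>
                (congrArg Ψ₁ (Subtype.ext (map_smul ψ c k))).trans (map_smul Ψ₁ c _) },
      fun k => (p6 _).trans (h1 k), fun x y => ?_, fun a ha hk => ?_⟩
    · rw [hρ'', hρ'']
      exact p5 _ _ _ (h2 x y)
    · rw [hρ']
      have e1 : (⟨ψ ⟨E.φ a, hk⟩, hψmem _⟩ : E.spectralSubspace J 0) = ⟨ρ.π a, hmem a⟩ :=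
        Subtype.ext (h3 a ha hk)
      refine (congrArg Ψ₁ e1).trans ((p7 _).2 fun b hb c hc => ?_).symm
      obtain ⟨b, rfl⟩ := hrange b hb
      obtain ⟨c, rfl⟩ := hrange c hc
      exact ⟨b * a * c, hr c _ (hl b a ha), by
        change ρ.π (b * a * c) = _
        rw [map_mul, map_mul]⟩
  obtain ⟨Φ, hΦ1, hΦ2⟩ := E.exists_lift (fun _ _ ρ => ρ.IsCoisometricOn J) ρ' hco
  -- `Φ` computes `π(L(x,y)) = t(x)t(y)*` in two ways: as `Ψ₀` of it, and as `Θ(t(x)) Θ(t(y))*`,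
  -- which is `Ψ₁` of it.
  have h1 : Ψ₀ ⟨ρ.π (L.toFun x y), hmem _⟩ = Ψ₁ ⟨ρ.π (L.toFun x y), hmem _⟩ := by
    have e1 : Φ (ρ.π (L.toFun x y)) = Ψ₀ ⟨ρ.π (L.toFun x y), hmem _⟩ := by
      refine (hΦ1 _).trans ?_
      rw [hρ']; rfl
    rw [← e1]
    have e3 : Φ (ρ.π (L.toFun x y)) = Φ (ρ.t x) * star (Φ (ρ.t y)) := by
      rw [← map_star, ← map_mul, hL]
    have e2 : ∀ x, Φ (ρ.t x) = Θ ⟨ρ.t x, t_mem_spectralSubspace x⟩ := fun x =>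
      (hΦ2 x).trans (hρ'' x)
    rw [e3, e2, e2]
    exact (p5 _ _ _ (hL x y).symm).symm
  refine mem_of_forall_mul_mul_mem J hJ fun b c => ?_
  obtain ⟨a, ha, h2⟩ := (p7 _).1 h1 _ (hmem b) _ (hmem c)
  have h3 : a = b * L.toFun x y * c := hπ (by
    refine Eq.trans h2 ?_
    rw [map_mul, map_mul])
  rwa [← h3]

/-- The universal representation identifies `A` with the fixed points of the gauge action if and only
if the correspondence is a Hilbert bimodule and `J` is the ideal `(ker φ)^⊥ ∩ J(X)`. -/
theorem injective_and_range_eq_iff (hJ : IsClosed (J : Set A)) (hl : ∀ a, ∀ b ∈ J, a * b ∈ J)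
    (hr : ∀ a, ∀ b ∈ J, b * a ∈ J) (hJX : J ≤ E.J) :
    (Function.Injective (E.toCuntzPimsner J).π ∧
      Set.range (E.toCuntzPimsner J).π = E.spectralSubspace J 0) ↔
    (E.IsHilbertBimodule ∧ J = E.kerPerp ⊓ E.J) := by
  constructor
  · rintro ⟨hπ, hs⟩
    obtain ⟨L, hL⟩ := Representation.exists_leftInner hπ fun x y => by
      rw [hs]; exact t_mul_star_t_mem x y
    refine ⟨⟨L⟩, le_antisymm (le_inf (le_kerPerp hr hπ) hJX) ?_⟩
    rw [L.ideal_eq]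
    exact L.ideal_le hJ (toFun_mem_of_range_eq hJ hl hr hπ hs hL)
  · rintro ⟨⟨L⟩, rfl⟩
    rw [L.ideal_eq]
    exact ⟨L.injective_toCuntzPimsner_π, (spectralSubspace_eq L.injective_toCuntzPimsner_π
      (L.t_mul_star_t (E.toCuntzPimsner_coisometric _))).1⟩

theorem crossedProduct_and_tensorPower (L : E.LeftInner) :
    (∃ Φ : E.CuntzPimsner L.ideal ≃⋆ₐ[ℂ] CrossedProduct L,
      (∀ a, Φ ((E.toCuntzPimsner L.ideal).π a) = (toCrossedProduct L).π a) ∧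
      ∀ x, Φ ((E.toCuntzPimsner L.ideal).t x) = (toCrossedProduct L).t x) ∧
    ∀ n : ℕ, ∃ τ : E.TensorPower n →ₗᵢ[ℂ] E.CuntzPimsner L.ideal,
      (∀ x : Fin (n + 1) → E.X, τ (E.tmul x) = (E.toCuntzPimsner L.ideal).prodT n x) ∧
      Set.range τ = E.spectralSubspace L.ideal (n + 1) := by
  refine ⟨exists_equiv_crossedProduct L, fun n => ?_⟩
  obtain ⟨τ, h1, h2⟩ := Representation.exists_tensorPower_isometry L.injective_toCuntzPimsner_π n
  refine ⟨τ, h1, ?_⟩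
  rw [h2, (spectralSubspace_eq L.injective_toCuntzPimsner_π
    (L.t_mul_star_t (E.toCuntzPimsner_coisometric _))).2 n]

end CStarCorrespondence

end

theorem mainTheorem10 :
    (∀ (T : RightTensorCStarPrecategory.{u}) (K J : T.Ideal),
      (∀ n m, J.space n m ≤ RightTensorCStarPrecategory.idealJ K n m) →
      (((RightTensorCStarPrecategory.universalRep K J).IsFaithful ∧
          ∀ k : ℕ, LinearMap.range ((RightTensorCStarPrecategory.universalRep K J).toFun k 0) =
            RightTensorCStarPrecategory.spectralSubspace K J k) ↔
        ((∀ n m, J.space n m = RightTensorCStarPrecategory.idealJ K n m ⊓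
            RightTensorCStarPrecategory.annihilator
              (RightTensorCStarPrecategory.tensorKer (T := T)) n m) ∧
          RightTensorCStarPrecategory.AdmitsTransferAction K))) ∧
    (∀ (A : Type u) [NonUnitalCStarAlgebra A] (E : CStarCorrespondence A) (J : Submodule ℂ A),
      IsClosed (J : Set A) → (∀ a, ∀ b ∈ J, a * b ∈ J) → (∀ a, ∀ b ∈ J, b * a ∈ J) → J ≤ E.J →
      ((Function.Injective (E.toCuntzPimsner J).π ∧
          Set.range (E.toCuntzPimsner J).π = E.spectralSubspace J 0) ↔
        (E.IsHilbertBimodule ∧ J = E.kerPerp ⊓ E.J)) ∧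
      ((Function.Injective (E.toCuntzPimsner J).π ∧
          Set.range (E.toCuntzPimsner J).π = E.spectralSubspace J 0) →
        ∀ L : E.LeftInner,
          E.kerPerp ⊓ E.J =
            (Submodule.span ℂ {a | ∃ x y, a = L.toFun x y}).topologicalClosure ∧
          (∃ Φ : E.CuntzPimsner J ≃⋆ₐ[ℂ] CStarCorrespondence.CrossedProduct L,
            (∀ a, Φ ((E.toCuntzPimsner J).π a) =
              (CStarCorrespondence.toCrossedProduct L).π a) ∧
            ∀ x, Φ ((E.toCuntzPimsner J).t x) =
              (CStarCorrespondence.toCrossedProduct L).t x) ∧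
          ∀ n : ℕ, ∃ τ : E.TensorPower n →ₗᵢ[ℂ] E.CuntzPimsner J,
            (∀ x : Fin (n + 1) → E.X, τ (E.tmul x) = (E.toCuntzPimsner J).prodT n x) ∧
            Set.range τ = E.spectralSubspace J (n + 1))) := by
  refine ⟨fun T K J hJ => RightTensorCStarPrecategory.isFaithful_and_spectralSubspace_iff hJ,
    fun A _ E J hJ hl hr hJX =>
      ⟨CStarCorrespondence.injective_and_range_eq_iff hJ hl hr hJX, fun h L => ?_⟩⟩
  -- Only the formula for `J` is kept; the left inner product is the arbitrary `L`, since `ideal_eq`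
  -- holds for every one.
  obtain ⟨-, rfl⟩ := (CStarCorrespondence.injective_and_range_eq_iff hJ hl hr hJX).1 h
  refine ⟨L.ideal_eq, ?_⟩
  rw [L.ideal_eq]
  exact CStarCorrespondence.crossedProduct_and_tensorPower L
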